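/- **Setting.** The input alphabets $\mathbb A_i$ ($i\ge 0$) and the output alphabets $\mathbb B_j$ ($j\in\mathbb Z$) are non-empty standard Borel spaces. Write $a^i=(a_0,\dots,a_i)$, $b^i=(\dots,b_{-1},b_0,\dots,b_i)$ and $b_k^i=(b_k,\dots,b_i)$. The initial data $B^{-1}=(\dots,B_{-2},B_{-1})$ have a fixed distribution $\mu$ (possibly a point mass) and are known to the encoder and to the decoder. A channel is a sequence of stochastic kernels $Q_i(db_i|b^{i-1},a^i)$; it is of Class A if $Q_i$ depends only on $(b^{i-1},a_i)$, and of Class B if $Q_i$ depends only on $(b_{i-M}^{i-1},a_i)$ for a fixed integer $M\ge 0$. The cost is $c_{0,n}=\sum_{i=0}^n\gamma_i(a^i,b^i)$ with measurable $\gamma_i\ge 0$; it is of Class A if $\gamma_i$ depends only on $(a_i,b^i)$, and of Class B if $\gamma_i$ depends only on $(a_i,b_{i-K}^i)$ for a fixed integer $K\ge 0$. An input distribution $P=\{P_i(da_i|a^{i-1},b^{i-1})\}$ together with $Q$ and $\mu$ induces a joint law ${\bf P}^P$ with expectation ${\bf E}^P$. For $\kappa\in[0,\infty)$, let $\mathcal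 P_{[0,n]}(\kappa)$ be the set of all $P$ with $\frac1{n+1}{\bf E}^P\{c_{0,n}(A^n,B^n)\}\le\kappa$, and put $$I(A^n\to B^n)=\sum_{i=0}^n I(A^i;B_i|B^{i-1}),\qquad C^{FB}_{A^n\to B^n}(\kappa)=\sup_{P\in\mathcal P_{[0,n]}(\kappa)}I(A^n\to B^n),$$ $$C^{FB}_{A^\infty\to B^\infty}(\kappa)=\liminf_{n\to\infty}\tfrac1{n+1}C^{FB}_{A^n\to B^n}(\kappa).$$ Let $\mathcal I_i^P=b_{i-J}^{i-1}$ with $J=\max\{M,K\}$ if channel and cost are both of Class B, and $\mathcal I_i^P=b^{i-1}$ otherwise. An $(n,M_n,\epsilon_n)$ feedback code consists of $M_n\ge1$ messages, measurable encoding maps $a_i=g_i(w,b^{i-1})$, $0\le i\le n$, with $\frac1{n+1}{\bf E}^g\{c_{0,n}(A^n,B^n)\}\le\kappa$ (the set of such encoders is $\mathcal E^{FB}_{[0,n]}(\kappa)$), and a measurable decoder $d(B^n)$ such that $\mathbb P^g\{d(B^n)\ne W\}\le\epsilon_n$, where the message $W$ is uniform on the $M_n$ messages and independent of $B^{-1}$.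 A rate $R$ is achievable if there are such codes for $n=0,1,\dots$ with $\epsilon_n\to0$ and $\liminf_n\frac1{n+1}\log M_n\ge R$. **Theorem (Coding theorem).** Let the channel and the cost each be of Class A or B. Suppose that i) (Massey) ${\bf P}_{B_i|B^{i-1},A^i,W}={\bf P}_{B_i|B^{i-1},A^i}=Q_i$ for the transmission of every message; ii) for every $n$ there is an input distribution $\pi^{*}=\pi^{*,n}$ of the form $\{\pi_i^*(da_i|\mathcal I_i^P)\}_{i\le n}$ in $\mathcal P_{[0,n]}(\kappa)$ that attains $$\sup_{\{\pi_i(da_i|\mathcal I_i^P)\}\in\mathcal P_{[0,n]}(\kappa)}\ \sum_{i=0}^nI(A_i;B_i|B^{i-1}).$$ (a) (Converse) For every sequence of feedback codes with $\epsilon_n\to0$, $$\liminf_{n\to\infty}\tfrac1{n+1}\log M_n\le\liminf_{n\to\infty}\sup_{g\in\mathcal E^{FB}_{[0,n]}(\kappa)}\tfrac1{n+1}\sum_{i=0}^nI^g(A_i;B_i|B^{i-1})\le\liminf_{n\to\infty}\sup_{\{\pi_i(da_i|\mathcal I_i^P)\}\in\mathcal P_{[0,n]}(\kappa)}\tfrac1{n+1}\sum_{i=0}^nI(A_i;B_i|B^{i-1}),$$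 and the last quantity equals $C^{FB}_{A^\infty\to B^\infty}(\kappa)$. Hence every achievable rate satisfies $R\le C^{FB}_{A^\infty\to B^\infty}(\kappa)$. (b) (Direct) Let $${\bf i}^{\pi^*}(A^n,B^n)=\sum_{i=0}^n\log\Big(\frac{dQ_i(\cdot|B^{i-1},A^i)}{d{\bf P}^{\pi^*}(\cdot|B^{i-1})}(B_i)\Big),$$ where ${\bf P}^{\pi^*}(\cdot|B^{i-1})$ is the conditional law of $B_i$ given $B^{i-1}$. Suppose in addition that iii) the directed information density is stable: $I(A^n\to B^n)$ is finite under $\pi^{*,n}$ for every $n$, and ${\bf P}^{\pi^*}\{\frac1{n+1}|{\bf E}^{\pi^*}\{{\bf i}^{\pi^*}(A^n,B^n)\}-{\bf i}^{\pi^*}(A^n,B^n)|>\varepsilon\}\to0$ as $n\to\infty$ for every $\varepsilon>0$; iv) the transmission cost is stable: ${\bf P}^{\pi^*}\{\frac1{n+1}|{\bf E}^{\pi^*}\{c_{0,n}(A^n,B^n)\}-c_{0,n}(A^n,B^n)|>\varepsilon\}\to0$ as $n\to\infty$ for every $\varepsilon>0$. Then every rate $R<C^{FB}_{A^\infty\to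 B^\infty}(\kappa)$ is achievable. -/

import Mathlib

open MeasureTheory ProbabilityTheory Filter Topology
open scoped ENNReal NNReal

noncomputable section

namespace FeedbackCoding

universe u v

/-! Channel inputs are indexed by times `i : ℕ`, channel outputs by times `j : ℤ`; the outputs at
negative times form the initial data `b^{-1} = (…, b_{-2}, b_{-1})`. -/

/-- A pair consisting of an input sequence `(a_i)` and an output sequence `(b_j)`. -/
abbrev Path (A : ℕ → Type u) (B : ℤ → Type v) : Type (max u v) := (∀ i, A i) × (∀ j, B j)

/-- `a^{i-1}`. -/
abbrev InPast (A : ℕ → Type u) (i : ℕ) : Type u := ∀ k : Set.Iio i, A k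

/-- `a^i`. -/
abbrev InUpTo (A : ℕ → Type u) (i : ℕ) : Type u := ∀ k : Set.Iic i, A k

/-- Outputs at the times in a set `S`. -/
abbrev OutOn (B : ℤ → Type v) (S : Set ℤ) : Type v := ∀ j : S, B j

/-- `b^{i-1}`, including the initial data. -/
abbrev OutPast (B : ℤ → Type v) (i : ℤ) : Type v := OutOn B (Set.Iio i)

/-- `b^i`, including the initial data. -/
abbrev OutUpTo (B : ℤ → Type v) (i : ℤ) : Type v := OutOn B (Set.Iic i)

section

variable {A : ℕ → Type u} {B : ℤ → Type v}

def inPast (i : ℕ) (x : Path A B) : InPast A i := fun k => x.1 k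
def inUpTo (i : ℕ) (x : Path A B) : InUpTo A i := fun k => x.1 k
def outOn (S : Set ℤ) (x : Path A B) : OutOn B S := fun j => x.2 j
def outPast (i : ℤ) (x : Path A B) : OutPast B i := outOn (Set.Iio i) x
def outUpTo (i : ℤ) (x : Path A B) : OutUpTo B i := outOn (Set.Iic i) x

variable [∀ i, MeasurableSpace (A i)] [∀ j, MeasurableSpace (B j)]

lemma measurable_inPast (i : ℕ) : Measurable (inPast i : Path A B → InPast A i) :=
  measurable_pi_lambda _ fun k => (measurable_pi_apply (k : ℕ)).comp measurable_fst

lemma measurable_inUpTo (i : ℕ) : Measurable (inUpTo i : Path A B → InUpTo A i) :=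
  measurable_pi_lambda _ fun k => (measurable_pi_apply (k : ℕ)).comp measurable_fst

lemma measurable_outOn (S : Set ℤ) : Measurable (outOn S : Path A B → OutOn B S) :=
  measurable_pi_lambda _ fun j => (measurable_pi_apply (j : ℤ)).comp measurable_snd

lemma measurable_outPast (i : ℤ) : Measurable (outPast i : Path A B → OutPast B i) :=
  measurable_outOn _

/-! ### Channels, channel input distributions, transmission costs -/

variable (A B) in
/-- A channel distribution: stochastic kernels `Q_i(db_i | b^{i-1}, a^i)`. -/
structure Channel where
  kern : ∀ i : ℕ, Kernel (OutPast B i × InUpTo A i) (B i)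
  markov : ∀ i, IsMarkovKernel (kern i)

variable (A B) in
/-- A channel input distribution with feedback: stochastic kernels
`P_i(da_i | a^{i-1}, b^{i-1})`. For block length `n + 1` only the times `i ≤ n` matter. -/
structure Policy where
  kern : ∀ i : ℕ, Kernel (InPast A i × OutPast B i) (A i)
  markov : ∀ i, IsMarkovKernel (kern i)

attribute [instance] Channel.markov Policy.markov

variable (A B) in
/-- Per-time transmission costs `γ_i(a^i, b^i) ∈ [0, ∞)`. -/
structure Cost where
  fn : ∀ i : ℕ, InUpTo A i × OutUpTo B i → ℝ≥0
  meas : ∀ i, Measurable (fn i)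

/-- The total cost `c_{0,n}(a^n, b^n) = ∑_{i ≤ n} γ_i(a^i, b^i)`. -/
def Cost.total (γ : Cost A B) (n : ℕ) (x : Path A B) : ℝ≥0 :=
  ∑ i ∈ Finset.range (n + 1), γ.fn i (inUpTo i x, outUpTo i x)

/-- Channel class `A`, or channel class `B` with memory `M`. -/
inductive ChannelClass where
  | A
  | B (M : ℕ)

/-- Cost class `A`, or cost class `B` with memory `K`. -/
inductive CostClass where
  | A
  | B (K : ℕ)

/-- Class A: `Q_i(db_i | b^{i-1}, a^i) = q_i(db_i | b^{i-1}, a_i)`.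
Class B: `Q_i(db_i | b^{i-1}, a^i) = q_i(db_i | b_{i-M}^{i-1}, a_i)`. -/
def Channel.IsOfClass (Q : Channel A B) : ChannelClass → Prop
  | .A => ∀ i : ℕ, ∃ q : Kernel (OutPast B i × A i) (B i), ∀ x : Path A B,
      Q.kern i (outPast i x, inUpTo i x) = q (outPast i x, x.1 i)
  | .B M => ∀ i : ℕ, ∃ q : Kernel (OutOn B (Set.Ico ((i : ℤ) - M) i) × A i) (B i),
      ∀ x : Path A B, Q.kern i (outPast i x, inUpTo i x) = q (outOn _ x, x.1 i)

/-- Class A: `γ_i(a^i, b^i) = γ'_i(a_i, b^i)`. Class B: `γ_i(a^i, b^i) = γ'_i(a_i, b_{i-K}^i)`. -/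
def Cost.IsOfClass (γ : Cost A B) : CostClass → Prop
  | .A => ∀ i : ℕ, ∃ c : A i × OutUpTo B i → ℝ≥0, Measurable c ∧ ∀ x : Path A B,
      γ.fn i (inUpTo i x, outUpTo i x) = c (x.1 i, outUpTo i x)
  | .B K => ∀ i : ℕ, ∃ c : A i × OutOn B (Set.Icc ((i : ℤ) - K) i) → ℝ≥0, Measurable c ∧
      ∀ x : Path A B, γ.fn i (inUpTo i x, outUpTo i x) = c (x.1 i, outOn _ x)

/-- The times of the outputs on which the input at time `i` may depend in the characterization of
the FTFI capacity: `b_{i-J}^{i-1}` with `J = max(M, K)` if both channel and cost are of class B,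
and the whole past `b^{i-1}` otherwise. -/
def infoStructure : ChannelClass → CostClass → ℕ → Set ℤ
  | .B M, .B K, i => Set.Ico ((i : ℤ) - (max M K : ℕ)) i
  | _, _, i => Set.Iio (i : ℤ)

/-- `P_i(da_i | a^{i-1}, b^{i-1}) = π_i(da_i | (b_j)_{j ∈ S i})`. -/
def Policy.HasInfoStructure (P : Policy A B) (S : ℕ → Set ℤ) : Prop :=
  ∀ i : ℕ, ∃ π : Kernel (OutOn B (S i)) (A i), ∀ x : Path A B,
    P.kern i (inPast i x, outPast i x) = π (outOn (S i) x)

/-! ### Joint distributions -/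

/-- The conditional law of `A_i` given the past, read on paths. -/
def Policy.onPath (P : Policy A B) (i : ℕ) : Kernel (Path A B) (A i) :=
  (P.kern i).comap (fun x => (inPast i x, outPast i x))
    ((measurable_inPast i).prodMk (measurable_outPast i))

/-- The conditional law of `B_i` given the past and the present input, read on paths. -/
def Channel.onPath (Q : Channel A B) (i : ℕ) : Kernel (Path A B) (B i) :=
  (Q.kern i).comap (fun x => (outPast i x, inUpTo i x))
    ((measurable_outPast i).prodMk (measurable_inUpTo i))

instance (P : Policy A B) (i : ℕ) : IsMarkovKernel (P.onPath i) := by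
  unfold Policy.onPath; infer_instance

instance (Q : Channel A B) (i : ℕ) : IsMarkovKernel (Q.onPath i) := by
  unfold Channel.onPath; infer_instance

/-- Replace the `i`-th input. -/
def setIn (i : ℕ) (p : Path A B × A i) : Path A B := (Function.update p.1.1 i p.2, p.1.2)

/-- Replace the `i`-th output. -/
def setOut (i : ℕ) (p : Path A B × B i) : Path A B := (p.1.1, Function.update p.1.2 (i : ℤ) p.2)

lemma measurable_setIn (i : ℕ) : Measurable (setIn i : Path A B × A i → Path A B) :=
  (measurable_update'.comp
    ((measurable_fst.comp measurable_fst).prodMk measurable_snd)).prodMk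
    (measurable_snd.comp measurable_fst)

lemma measurable_setOut (i : ℕ) : Measurable (setOut i : Path A B × B i → Path A B) :=
  (measurable_fst.comp measurable_fst).prodMk
    (measurable_update'.comp
      ((measurable_snd.comp measurable_fst).prodMk measurable_snd))

variable [∀ i, Nonempty (A i)] [∀ j, Nonempty (B j)]

/-- A path with given initial data. Its coordinates at times `≥ 0` are placeholders. -/
def startPath (b : OutPast B 0) : Path A B :=
  (fun _ => Classical.arbitrary _,
   fun j => if h : j < 0 then b ⟨j, h⟩ else Classical.arbitrary _)

lemma measurable_startPath : Measurable (startPath : OutPast B 0 → Path A B) := by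
  refine measurable_const.prodMk (measurable_pi_lambda _ fun j => ?_)
  by_cases h : j < 0
  · simpa [h] using measurable_pi_apply (⟨j, h⟩ : Set.Iio (0 : ℤ))
  · simp [h]

/-- The joint law after the times `0, …, m - 1`: starting from `B^{-1} ∼ μ`, at each time `i` in
turn `A_i` is drawn from `P_i(· | A^{i-1}, B^{i-1})` and then `B_i` from `Q_i(· | B^{i-1}, A^i)`.
Coordinates at times `≥ m` are placeholders. -/
def lawUpTo (μ : Measure (OutPast B 0)) (Q : Channel A B) (P : Policy A B) :
    ℕ → Measure (Path A B)
  | 0 => μ.map startPath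
  | m + 1 =>
    ((((lawUpTo μ Q P m) ⊗ₘ (P.onPath m)).map (setIn m)) ⊗ₘ (Q.onPath m)).map (setOut m)

/-- The joint law `P^P(da^n, db^n) = μ(db^{-1}) ⊗_{i ≤ n} (Q_i(db_i | b^{i-1}, a^i) ⊗
P_i(da_i | a^{i-1}, b^{i-1}))` of initial data, inputs and outputs for block length `n + 1`. -/
def jointLaw (μ : Measure (OutPast B 0)) (Q : Channel A B) (P : Policy A B) (n : ℕ) :
    Measure (Path A B) :=
  lawUpTo μ Q P (n + 1)

instance (μ : Measure (OutPast B 0)) [IsProbabilityMeasure μ] (Q : Channel A B)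
    (P : Policy A B) (m : ℕ) : IsProbabilityMeasure (lawUpTo μ Q P m) := by
  induction m with
  | zero => exact Measure.isProbabilityMeasure_map measurable_startPath.aemeasurable
  | succ m ih =>
    have h := Measure.isProbabilityMeasure_map
      (μ := (lawUpTo μ Q P m) ⊗ₘ (P.onPath m)) (measurable_setIn m).aemeasurable
    exact Measure.isProbabilityMeasure_map (measurable_setOut m).aemeasurable

instance (μ : Measure (OutPast B 0)) [IsProbabilityMeasure μ] (Q : Channel A B)
    (P : Policy A B) (n : ℕ) : IsProbabilityMeasure (jointLaw μ Q P n) := by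
  unfold jointLaw; infer_instance

/-- `(1/(n+1)) E{c_{0,n}(A^n, B^n)} ≤ κ`. -/
def MeetsCost (γ : Cost A B) (κ : ℝ≥0) (n : ℕ) (ν : Measure (Path A B)) : Prop :=
  ((n : ℝ≥0∞) + 1)⁻¹ * ∫⁻ x, (γ.total n x : ℝ≥0∞) ∂ν ≤ κ

/-- The set `𝒫_{[0,n]}(κ)` of channel input distributions meeting the cost constraint. -/
def policiesWithCost (μ : Measure (OutPast B 0)) (Q : Channel A B) (γ : Cost A B) (κ : ℝ≥0)
    (n : ℕ) : Set (Policy A B) :=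
  {P | MeetsCost γ κ n (jointLaw μ Q P n)}

end

/-! ### Information measures -/

/-- Conditional mutual information `I(U; Z | W)`: the divergence of the joint law of `(W, U, Z)`
from `P_W ⊗ P_{U|W} ⊗ P_{Z|W} = P_{W,U} ⊗ P_{Z|W}`. -/
def condMutualInfo {Ω 𝓤 𝓩 𝓦 : Type*} [MeasurableSpace Ω] [MeasurableSpace 𝓤]
    [MeasurableSpace 𝓩] [StandardBorelSpace 𝓩] [Nonempty 𝓩] [MeasurableSpace 𝓦]
    (ν : Measure Ω) [IsFiniteMeasure ν] (U : Ω → 𝓤) (Z : Ω → 𝓩) (W : Ω → 𝓦) : ℝ≥0∞ :=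
  InformationTheory.klDiv (ν.map fun x => ((W x, U x), Z x))
    ((ν.map fun x => (W x, U x)) ⊗ₘ ((condDistrib Z W ν).prodMkRight 𝓤))

section

variable {A : ℕ → Type u} {B : ℤ → Type v}
  [∀ i, MeasurableSpace (A i)]
  [∀ j, MeasurableSpace (B j)] [∀ j, StandardBorelSpace (B j)] [∀ j, Nonempty (B j)]

/-- Directed information `I(A^n → B^n) = ∑_{i ≤ n} I(A^i; B_i | B^{i-1})`. -/
def directedInfo (ν : Measure (Path A B)) [IsFiniteMeasure ν] (n : ℕ) : ℝ≥0∞ :=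
  ∑ i ∈ Finset.range (n + 1),
    condMutualInfo ν (inUpTo i) (fun x => x.2 (i : ℤ)) (outPast (i : ℤ))

/-- `∑_{i ≤ n} I(A_i; B_i | B^{i-1})`. -/
def perLetterInfo (ν : Measure (Path A B)) [IsFiniteMeasure ν] (n : ℕ) : ℝ≥0∞ :=
  ∑ i ∈ Finset.range (n + 1),
    condMutualInfo ν (fun x => x.1 i) (fun x => x.2 (i : ℤ)) (outPast (i : ℤ))

variable [∀ i, Nonempty (A i)]

/-- The FTFI capacity `C^{FB}_{A^n → B^n}(κ) = sup_{𝒫_{[0,n]}(κ)} I(A^n → B^n)`. -/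
def ftfiCapacity (μ : Measure (OutPast B 0)) [IsProbabilityMeasure μ] (Q : Channel A B)
    (γ : Cost A B) (κ : ℝ≥0) (n : ℕ) : ℝ≥0∞ :=
  ⨆ P ∈ policiesWithCost μ Q γ κ n, directedInfo (jointLaw μ Q P n) n

/-- `C^{FB}_{A^∞ → B^∞}(κ) = liminf_n (1/(n+1)) C^{FB}_{A^n → B^n}(κ)`. -/
def ftfiRate (μ : Measure (OutPast B 0)) [IsProbabilityMeasure μ] (Q : Channel A B)
    (γ : Cost A B) (κ : ℝ≥0) : ℝ≥0∞ :=
  liminf (fun n : ℕ => ((n : ℝ≥0∞) + 1)⁻¹ * ftfiCapacity μ Q γ κ n) atTop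

/-- The characterization of the FTFI capacity with information structure `S`, per unit time:
`sup (1/(n+1)) ∑_{i ≤ n} I(A_i; B_i | B^{i-1})` over the input distributions in `𝒫_{[0,n]}(κ)` of
the form `π_i(da_i | (b_j)_{j ∈ S i})`. -/
def charCapacityRate (μ : Measure (OutPast B 0)) [IsProbabilityMeasure μ] (Q : Channel A B)
    (γ : Cost A B) (κ : ℝ≥0) (S : ℕ → Set ℤ) (n : ℕ) : ℝ≥0∞ :=
  ⨆ P ∈ {P | P ∈ policiesWithCost μ Q γ κ n ∧ Policy.HasInfoStructure P S},
    ((n : ℝ≥0∞) + 1)⁻¹ * perLetterInfo (jointLaw μ Q P n) n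

/-- `P` is in the restricted class and achieves the characterization of the FTFI capacity for
block length `n + 1`. -/
def IsOptimalPolicy (μ : Measure (OutPast B 0)) [IsProbabilityMeasure μ] (Q : Channel A B)
    (γ : Cost A B) (κ : ℝ≥0) (S : ℕ → Set ℤ) (n : ℕ) (P : Policy A B) : Prop :=
  P ∈ policiesWithCost μ Q γ κ n ∧ P.HasInfoStructure S ∧
    ((n : ℝ≥0∞) + 1)⁻¹ * perLetterInfo (jointLaw μ Q P n) n = charCapacityRate μ Q γ κ S n

/-- The directed information density
`i^P(A^n, B^n) = ∑_{i ≤ n} log (dQ_i(· | B^{i-1}, A^i) / dP^P(· | B^{i-1})) (B_i)`;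
the denominator is the conditional law of `B_i` given `B^{i-1}`. -/
def infoDensity (μ : Measure (OutPast B 0)) [IsProbabilityMeasure μ] (Q : Channel A B)
    (P : Policy A B) (n : ℕ) (x : Path A B) : ℝ :=
  ∑ i ∈ Finset.range (n + 1), Real.log
    ((Q.kern i).rnDeriv
      ((condDistrib (fun y : Path A B => y.2 (i : ℤ)) (outPast (i : ℤ))
        (jointLaw μ Q P n)).prodMkRight (InUpTo A i))
      (outPast i x, inUpTo i x) (x.2 i)).toReal

/-- The directed information density is stable along the input distributions `P n` (`P n` is used
for block length `n + 1`). Finiteness of the directed information says that the densities exist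
and have a finite expectation. -/
def InfoDensityStable (μ : Measure (OutPast B 0)) [IsProbabilityMeasure μ] (Q : Channel A B)
    (P : ℕ → Policy A B) : Prop :=
  (∀ n, directedInfo (jointLaw μ Q (P n) n) n ≠ ∞) ∧
  ∀ ε : ℝ, 0 < ε → Tendsto (fun n : ℕ => jointLaw μ Q (P n) n
    {x | ε < 1 / ((n : ℝ) + 1) *
      |(∫ y, infoDensity μ Q (P n) n y ∂(jointLaw μ Q (P n) n)) - infoDensity μ Q (P n) n x|})
    atTop (𝓝 0)

/-- The transmission cost is stable along the input distributions `P n`. -/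
def CostStable (μ : Measure (OutPast B 0)) (Q : Channel A B) (γ : Cost A B)
    (P : ℕ → Policy A B) : Prop :=
  ∀ ε : ℝ, 0 < ε → Tendsto (fun n : ℕ => jointLaw μ Q (P n) n
    {x | ε < 1 / ((n : ℝ) + 1) *
      |(∫ y, (γ.total n y : ℝ) ∂(jointLaw μ Q (P n) n)) - (γ.total n x : ℝ)|})
    atTop (𝓝 0)

/-! ### Feedback codes -/

variable (A B) in
/-- Encoding maps `a_i = g_i(w, b^{i-1})` for `M` messages. For block length `n + 1` only the
times `i ≤ n` matter. -/
structure Encoder (M : ℕ) where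
  map : ∀ i : ℕ, Fin M → OutPast B i → A i
  meas : ∀ i w, Measurable (map i w)

/-- The (deterministic) channel input distribution of an encoder given the message `w`. -/
def Encoder.policy {M : ℕ} (g : Encoder A B M) (w : Fin M) : Policy A B where
  kern i := Kernel.deterministic (fun h : InPast A i × OutPast B i => g.map i w h.2)
    ((g.meas i w).comp measurable_snd)
  markov _ := inferInstance

variable (A B) in
/-- The laws of the outputs during the transmission of a message: `T M w` consists of the kernels
`P_{B_i | B^{i-1}, A^i, W}(db_i | b^{i-1}, a^i, w)` when `w` is sent, out of `M` messages. -/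
abbrev MessageChannel := ∀ M : ℕ, Fin M → Channel A B

/-- Massey's conditional independence `P_{B_i | B^{i-1}, A^i, W} = P_{B_i | B^{i-1}, A^i}`: given
`(A^i, B^{i-1})`, the output `B_i` does not depend on the transmitted message. -/
def MasseyCI (Q : Channel A B) (T : MessageChannel A B) : Prop :=
  ∀ (M : ℕ) (w : Fin M) (i : ℕ), (T M w).kern i = Q.kern i

/-- The law of initial data, inputs and outputs when a message uniformly distributed over the `M`
messages (and independent of the initial data) is sent by means of the encoder `g`. -/
def codeLaw (μ : Measure (OutPast B 0)) (T : MessageChannel A B) {M : ℕ} (g : Encoder A B M)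
    (n : ℕ) : Measure (Path A B) :=
  (M : ℝ≥0∞)⁻¹ • ∑ w : Fin M, jointLaw μ (T M w) (g.policy w) n

instance (μ : Measure (OutPast B 0)) [IsProbabilityMeasure μ] (T : MessageChannel A B) {M : ℕ}
    (g : Encoder A B M) (n : ℕ) : IsFiniteMeasure (codeLaw μ T g n) := by
  refine ⟨?_⟩
  rcases Nat.eq_zero_or_pos M with rfl | hM
  · simp [codeLaw]
  · have h : (M : ℝ≥0∞) ≠ 0 := by exact_mod_cast hM.ne'
    simp [codeLaw, ENNReal.inv_mul_cancel h (ENNReal.natCast_ne_top M)]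

/-- The set `ℰ^{FB}_{[0,n]}(κ)` of encoders for `M` messages meeting the cost constraint. -/
def encodersWithCost (μ : Measure (OutPast B 0)) (T : MessageChannel A B) (γ : Cost A B)
    (κ : ℝ≥0) (n M : ℕ) : Set (Encoder A B M) :=
  {g | MeetsCost γ κ n (codeLaw μ T g n)}

/-- The average probability of decoding error
`(1/M) ∑_w P^g {d(B^n) ≠ w | W = w}`. -/
def errorProb (μ : Measure (OutPast B 0)) (T : MessageChannel A B) {M : ℕ} (g : Encoder A B M)
    (n : ℕ) (d : OutUpTo B n → Fin M) : ℝ≥0∞ :=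
  (M : ℝ≥0∞)⁻¹ * ∑ w : Fin M, jointLaw μ (T M w) (g.policy w) n {x | d (outUpTo n x) ≠ w}

/-- An `(n, M, ε)` code with feedback. -/
structure FeedbackCode (μ : Measure (OutPast B 0)) (T : MessageChannel A B) (γ : Cost A B)
    (κ : ℝ≥0) (n M : ℕ) (ε : ℝ≥0) where
  enc : Encoder A B M
  enc_mem : enc ∈ encodersWithCost μ T γ κ n M
  dec : OutUpTo B n → Fin M
  dec_meas : Measurable dec
  error_le : errorProb μ T enc n dec ≤ ε

/-- `(M_n, ε_n)` are the parameters of a sequence of codes, each with at least one message, whose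
error probabilities tend to `0`. -/
def IsCodeSequence (μ : Measure (OutPast B 0)) (T : MessageChannel A B) (γ : Cost A B)
    (κ : ℝ≥0) (M : ℕ → ℕ) (ε : ℕ → ℝ≥0) : Prop :=
  (∀ n, 0 < M n ∧ Nonempty (FeedbackCode μ T γ κ n (M n) (ε n))) ∧ Tendsto ε atTop (𝓝 0)

/-- `liminf_n (1/(n+1)) log M_n`. -/
def liminfRate (M : ℕ → ℕ) : EReal :=
  liminf (fun n : ℕ => ((1 / ((n : ℝ) + 1) * Real.log (M n) : ℝ) : EReal)) atTop

/-- `R` is an achievable rate of codes with feedback. -/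
def IsAchievable (μ : Measure (OutPast B 0)) (T : MessageChannel A B) (γ : Cost A B)
    (κ : ℝ≥0) (R : ℝ) : Prop :=
  ∃ (M : ℕ → ℕ) (ε : ℕ → ℝ≥0), IsCodeSequence μ T γ κ M ε ∧ (R : EReal) ≤ liminfRate M

/-- `sup (1/(n+1)) ∑_{i ≤ n} I(A_i; B_i | B^{i-1})` over the encoders for `M` messages in
`ℰ^{FB}_{[0,n]}(κ)`. -/
def encoderInfoRate (μ : Measure (OutPast B 0)) [IsProbabilityMeasure μ] (T : MessageChannel A B)
    (γ : Cost A B) (κ : ℝ≥0) (n M : ℕ) : ℝ≥0∞ :=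
  ⨆ g ∈ encodersWithCost μ T γ κ n M,
    ((n : ℝ≥0∞) + 1)⁻¹ * perLetterInfo (codeLaw μ T g n) n

end

end FeedbackCoding

end

/-! Everything rests on one abstraction, `IsChannelLaw`: a law of paths in which the initial data
have law μ and the outputs up to time n come from Q, however the inputs are produced. The joint law
of an input distribution is of this kind, and so, by Massey's condition, is the law of a code
averaged over the messages.

Characterization. Given a channel law ν, let `condPolicy` draw each input from its conditional law
under ν given the outputs in the information window S i. The channel and the cost at time i see the
past only through (b_{S i}, a_i), and the window at time i + 1 is computed from the one at time i
and b_i. By induction the triples (b_{S i}, a_i, b_i) therefore have the same law under the new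
input distribution as under ν, and the expected cost is unchanged. The information does not
decrease: under the new input distribution the output kernel given the whole past is a function of
the window, whereas under ν the true output kernel given the past minimizes the conditional
divergence and so does no worse than that same kernel (`klDiv_compProd_prodMkRight_le`). Hence the
restricted supremum equals the unrestricted one and dominates all encoders.

Converse. The chain rule for the divergence shows that the mutual information between the message
and all outputs is the sum of the I(A_i; B_i | B^{i-1}), because the input is a function of the
message and the past outputs. Fano's inequality, in divergence form, bounds log M by this sum up to
a factor 1 - ε and a constant.

Direct part. Each input kernel of an optimal distribution is realized by a function of the outputs
and an independent uniform variable, so the distribution is a mixture of deterministic feedback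
strategies (`exists_random_encoder`). These strategies serve as code words in Feinstein's lemma. The
decoding set of a strategy consists of the outputs along which the product of density factors,
evaluated at the inputs that the strategy would have used, exceeds β. Integrating out the last
output repeatedly shows that this product has mean at most 1 under the output law, so the decoding
set has probability at most 1/β there. Stability of the density makes the set likely under the
strategies themselves, on average.

Only the average cost of the strategies is controlled, so the code words are chosen among strategies
whose cost exceeds κ slightly. A small proportion of extra messages, all sent by a strategy cheaper
than κ, restores the constraint. These messages are counted as errors, which costs a vanishing
amount of error probability. -/

namespace FeedbackCoding

/-! ### Divergence of composed laws, and Fano's inequality. -/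

section Divergence

open InformationTheory

variable {𝓧 𝓨 𝓩 𝓤 𝓦 : Type*} [MeasurableSpace 𝓧] [MeasurableSpace 𝓨] [MeasurableSpace 𝓩]
  [MeasurableSpace 𝓤] [MeasurableSpace 𝓦]

/-- Data processing applies both to f and to its left inverse. -/
lemma klDiv_map_of_leftInverse {f : 𝓧 → 𝓨} {g : 𝓨 → 𝓧} (hf : Measurable f) (hg : Measurable g)
    (h : Function.LeftInverse g f) (μ ν : Measure 𝓧) [IsFiniteMeasure μ] [IsFiniteMeasure ν] :
    klDiv (μ.map f) (ν.map f) = klDiv μ ν := by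
  refine le_antisymm (klDiv_map_le μ ν hf) ?_
  have hk := klDiv_map_le (μ.map f) (ν.map f) hg
  rwa [Measure.map_map hg hf, Measure.map_map hg hf, h.comp_eq_id, Measure.map_id,
    Measure.map_id] at hk

/-- A statistic through which the density factors is sufficient: it preserves the divergence. -/
lemma klDiv_map_withDensity_comp (ν : Measure 𝓧) [IsFiniteMeasure ν] {t : 𝓧 → 𝓨}
    (ht : Measurable t) {f : 𝓨 → ℝ≥0∞} (hf : Measurable f)
    [IsFiniteMeasure (ν.withDensity (f ∘ t))] :
    klDiv ((ν.withDensity (f ∘ t)).map t) (ν.map t) = klDiv (ν.withDensity (f ∘ t)) ν := by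
  have hmap : (ν.withDensity (f ∘ t)).map t = (ν.map t).withDensity f := by
    refine Measure.ext_of_lintegral _ fun g hg => ?_
    rw [lintegral_map hg ht, lintegral_withDensity_eq_lintegral_mul _ (hf.comp ht)
        (show Measurable fun x => g (t x) from hg.comp ht),
      lintegral_withDensity_eq_lintegral_mul _ hf hg, lintegral_map (hf.mul hg) ht]
    rfl
  have : IsFiniteMeasure ((ν.map t).withDensity f) := hmap ▸ inferInstance
  rw [hmap, klDiv_eq_lintegral_klFun_of_ac (withDensity_absolutelyContinuous _ _),
    klDiv_eq_lintegral_klFun_of_ac (withDensity_absolutelyContinuous _ _),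
    lintegral_congr_ae ((Measure.rnDeriv_withDensity (ν.map t) hf).mono fun x hx => by rw [hx]),
    lintegral_congr_ae ((Measure.rnDeriv_withDensity ν (hf.comp ht)).mono fun x hx => by rw [hx]),
    lintegral_map (by fun_prop) ht]
  rfl

section Kernels

variable [MeasurableSpace.CountableOrCountablyGenerated 𝓧 𝓩]

lemma compProd_eq_withDensity_rnDeriv (m : Measure 𝓧) [IsFiniteMeasure m] (q r : Kernel 𝓧 𝓩)
    [IsMarkovKernel q] [IsMarkovKernel r] (h : ∀ᵐ x ∂m, q x ≪ r x) :
    m ⊗ₘ q = (m ⊗ₘ r).withDensity fun p => Kernel.rnDeriv q r p.1 p.2 := by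
  refine Measure.ext_of_lintegral _ fun g hg => ?_
  rw [lintegral_withDensity_eq_lintegral_mul _ (Kernel.measurable_rnDeriv q r) hg,
    Measure.lintegral_compProd hg,
    Measure.lintegral_compProd ((Kernel.measurable_rnDeriv q r).mul hg)]
  refine lintegral_congr_ae (h.mono fun x hx => ?_)
  have hgx : Measurable fun z => g (x, z) := hg.comp measurable_prodMk_left
  simp only [Pi.mul_apply]
  rw [← lintegral_rnDeriv_mul hx hgx.aemeasurable]
  refine lintegral_congr_ae ?_
  filter_upwards [Kernel.rnDeriv_eq_rnDeriv_measure (κ := q) (η := r) (a := x)] with z hz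
  rw [hz]

lemma lintegral_kernelRnDeriv_le (q r : Kernel 𝓧 𝓩) [IsMarkovKernel q] [IsMarkovKernel r]
    (x : 𝓧) : ∫⁻ z, Kernel.rnDeriv q r x z ∂(r x) ≤ 1 := by
  rw [lintegral_congr_ae (Kernel.rnDeriv_eq_rnDeriv_measure (κ := q) (η := r) (a := x))]
  exact (Measure.lintegral_rnDeriv_le).trans (by simp)

/-- A density vanishes with probability zero under the measure that it defines. It is finite almost
everywhere for the reference law, and this transfers by the absolute continuity that a finite
divergence supplies. -/
lemma ae_rnDeriv_pos_of_klDiv_ne_top (m : Measure 𝓧) [IsFiniteMeasure m] (q r : Kernel 𝓧 𝓩)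
    [IsMarkovKernel q] [IsMarkovKernel r] (h : klDiv (m ⊗ₘ q) (m ⊗ₘ r) ≠ ∞) :
    ∀ᵐ p ∂(m ⊗ₘ q), Kernel.rnDeriv q r p.1 p.2 ≠ 0 ∧ Kernel.rnDeriv q r p.1 p.2 ≠ ∞ := by
  have hac := (klDiv_ne_top_iff.mp h).1
  have hq := Measure.absolutelyContinuous_compProd_right_iff.mp hac
  have hfin : ∀ᵐ p ∂(m ⊗ₘ r), Kernel.rnDeriv q r p.1 p.2 ≠ ∞ := by
    refine Measure.ae_compProd_of_ae_ae
      ((Kernel.measurable_rnDeriv q r) (measurableSet_singleton ∞)).compl ?_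
    exact Eventually.of_forall fun x => Kernel.rnDeriv_ne_top q r
  have hpos : ∀ᵐ p ∂(m ⊗ₘ q), Kernel.rnDeriv q r p.1 p.2 ≠ 0 := by
    rw [compProd_eq_withDensity_rnDeriv m q r hq,
      ae_withDensity_iff (Kernel.measurable_rnDeriv q r)]
    exact Eventually.of_forall fun p hp => hp
  filter_upwards [hpos, hac.ae_le hfin] with p h1 h2 using ⟨h1, h2⟩

/-- This links the kernel density in the information density with the log-likelihood ratio that
defines the divergence. -/
lemma llr_compProd_ae_eq (m : Measure 𝓧) [IsFiniteMeasure m] (q r : Kernel 𝓧 𝓩)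
    [IsMarkovKernel q] [IsMarkovKernel r] (h : m ⊗ₘ q ≪ m ⊗ₘ r) :
    llr (m ⊗ₘ q) (m ⊗ₘ r) =ᵐ[m ⊗ₘ q]
      fun p => Real.log (Kernel.rnDeriv q r p.1 p.2).toReal := by
  have hq := Measure.absolutelyContinuous_compProd_right_iff.mp h
  have h1 : (m ⊗ₘ q).rnDeriv (m ⊗ₘ r) =ᵐ[m ⊗ₘ r] fun p => Kernel.rnDeriv q r p.1 p.2 := by
    conv_lhs => rw [compProd_eq_withDensity_rnDeriv m q r hq]
    exact Measure.rnDeriv_withDensity _ (Kernel.measurable_rnDeriv q r)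
  filter_upwards [h.ae_le h1] with p hp
  rw [llr, hp]

end Kernels

lemma map_compProd_comap (m : Measure 𝓧) [IsFiniteMeasure m] {g : 𝓧 → 𝓨} (hg : Measurable g)
    (q : Kernel 𝓨 𝓩) [IsSFiniteKernel q] :
    (m ⊗ₘ q.comap g hg).map (Prod.map g id) = m.map g ⊗ₘ q := by
  have hgi : Measurable (Prod.map g (id : 𝓩 → 𝓩)) := hg.prodMap measurable_id
  refine Measure.ext_of_lintegral _ fun f hf => ?_
  rw [lintegral_map hf hgi, Measure.lintegral_compProd (f := fun a => f (Prod.map g id a)) (hf.comp hgi),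
    Measure.lintegral_compProd hf, lintegral_map hf.lintegral_kernel_prod_right' hg]
  rfl

/-- The conditional divergence of two kernels depends only on the law of a statistic through which
both kernels factor. -/
lemma klDiv_compProd_comap [MeasurableSpace.CountableOrCountablyGenerated 𝓨 𝓩] (m : Measure 𝓧)
    [IsFiniteMeasure m] {g : 𝓧 → 𝓨}
    (hg : Measurable g) (q r : Kernel 𝓨 𝓩) [IsMarkovKernel q] [IsMarkovKernel r] :
    klDiv (m ⊗ₘ q.comap g hg) (m ⊗ₘ r.comap g hg) = klDiv (m.map g ⊗ₘ q) (m.map g ⊗ₘ r) := by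
  have hiff : (∀ᵐ y ∂(m.map g), q y ≪ r y) ↔ ∀ᵐ x ∂m, q.comap g hg x ≪ r.comap g hg x := by
    rw [ae_map_iff hg.aemeasurable (Kernel.measurableSet_absolutelyContinuous q r)]
    rfl
  by_cases h : ∀ᵐ y ∂(m.map g), q y ≪ r y
  · have hgi : Measurable (Prod.map g (id : 𝓩 → 𝓩)) := hg.prodMap measurable_id
    -- The density of the two laws factors through `Prod.map g id`, which is therefore a sufficient
    -- statistic.
    have hd : m ⊗ₘ q.comap g hg = (m ⊗ₘ r.comap g hg).withDensity
        ((fun p : 𝓨 × 𝓩 => Kernel.rnDeriv q r p.1 p.2) ∘ Prod.map g id) := by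
      refine Measure.ext_of_lintegral _ fun f hf => ?_
      rw [lintegral_withDensity_eq_lintegral_mul _ ((Kernel.measurable_rnDeriv q r).comp hgi) hf,
        Measure.lintegral_compProd hf,
        Measure.lintegral_compProd (((Kernel.measurable_rnDeriv q r).comp hgi).mul hf)]
      refine lintegral_congr_ae ((hiff.mp h).mono fun x hx => ?_)
      have hfx : Measurable fun z => f (x, z) := hf.comp measurable_prodMk_left
      simp only [Pi.mul_apply]
      rw [← lintegral_rnDeriv_mul hx hfx.aemeasurable]
      refine lintegral_congr_ae ?_
      filter_upwards [Kernel.rnDeriv_eq_rnDeriv_measure (κ := q) (η := r) (a := g x)] with z hz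
      simp [hz]
    have hfin : IsFiniteMeasure ((m ⊗ₘ r.comap g hg).withDensity
        ((fun p : 𝓨 × 𝓩 => Kernel.rnDeriv q r p.1 p.2) ∘ Prod.map g id)) := hd ▸ inferInstance
    rw [← map_compProd_comap m hg q, ← map_compProd_comap m hg r, hd,
      klDiv_map_withDensity_comp _ hgi (Kernel.measurable_rnDeriv q r)]
  · rw [klDiv_of_not_ac, klDiv_of_not_ac]
    · rwa [Measure.absolutelyContinuous_compProd_right_iff]
    · intro hc
      have hc' := hc.map (hg.prodMap (measurable_id (α := 𝓩)))
      rw [map_compProd_comap m hg q, map_compProd_comap m hg r] at hc'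
      exact h (Measure.absolutelyContinuous_compProd_right_iff.mp hc')

/-- Among all kernels from `𝓦`, the conditional law of the output given `𝓦` is the closest to the
true output kernel in conditional divergence. -/
lemma klDiv_compProd_prodMkRight_le [StandardBorelSpace 𝓤] [Nonempty 𝓤] (m : Measure (𝓦 × 𝓤))
    [IsFiniteMeasure m] (q : Kernel (𝓦 × 𝓤) 𝓩) [IsMarkovKernel q] (κ r : Kernel 𝓦 𝓩)
    [IsMarkovKernel κ] [IsMarkovKernel r]
    (hκ : (m ⊗ₘ q).map (fun p => (p.1.1, p.2)) = m.fst ⊗ₘ κ) :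
    klDiv (m ⊗ₘ q) (m ⊗ₘ κ.prodMkRight 𝓤) ≤ klDiv (m ⊗ₘ q) (m ⊗ₘ r.prodMkRight 𝓤) := by
  let e : (𝓦 × 𝓤) × 𝓩 ≃ᵐ (𝓦 × 𝓩) × 𝓤 :=
    { toFun := fun p => ((p.1.1, p.2), p.1.2)
      invFun := fun p => ((p.1.1, p.2), p.1.2)
      left_inv := fun _ => rfl
      right_inv := fun _ => rfl
      measurable_toFun := by simp only [Equiv.coe_fn_mk]; fun_prop
      measurable_invFun := by simp only [Equiv.coe_fn_symm_mk]; fun_prop }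
  have hmap (s : Kernel 𝓦 𝓩) [IsMarkovKernel s] :
      (m ⊗ₘ s.prodMkRight 𝓤).map e = (m.fst ⊗ₘ s) ⊗ₘ m.condKernel.prodMkRight 𝓩 := by
    refine Measure.ext_of_lintegral _ fun f hf => ?_
    have hfe : Measurable fun a => f (e a) := hf.comp e.measurable
    rw [lintegral_map hf e.measurable, Measure.lintegral_compProd hfe]
    conv_lhs => rw [← m.disintegrate m.condKernel]
    rw [Measure.lintegral_compProd hfe.lintegral_kernel_prod_right',
      Measure.lintegral_compProd hf, Measure.lintegral_compProd hf.lintegral_kernel_prod_right']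
    refine lintegral_congr fun w => ?_
    have hw : Measurable fun p : 𝓤 × 𝓩 => f ((w, p.2), p.1) := hf.comp (by fun_prop)
    exact lintegral_lintegral_swap (f := fun u z => f ((w, z), u)) (ν := s w)
      (μ := m.condKernel w) hw.aemeasurable
  have hfst : ((m ⊗ₘ q).map e).fst = m.fst ⊗ₘ κ := by
    rw [← hκ, Measure.fst, Measure.map_map measurable_fst e.measurable]
    rfl
  have hJ : (m ⊗ₘ q).map e = (m.fst ⊗ₘ κ) ⊗ₘ ((m ⊗ₘ q).map e).condKernel := by
    rw [← hfst, Measure.disintegrate]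
  have hkl := klDiv_map_of_leftInverse e.measurable e.symm.measurable e.left_inv
  -- With the middle coordinate moved last, the chain rule gives a Pythagorean identity: replacing κ
  -- by r adds exactly the divergence of `m.fst ⊗ₘ κ` from `m.fst ⊗ₘ r`, and the remaining term is
  -- the same on both sides.
  rw [← hkl, ← hkl (m ⊗ₘ q), hmap κ, hmap r, hJ, klDiv_compProd_eq_add (ν := m.fst ⊗ₘ r)]
  exact le_add_self

/-- Fano's inequality in divergence form. -/
lemma measureReal_mul_log_le_klDiv (P ρ : Measure 𝓧) [IsProbabilityMeasure P]
    [IsProbabilityMeasure ρ] (hkl : klDiv P ρ ≠ ∞) {S : Set 𝓧} (hS : MeasurableSet S) {M : ℕ}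
    (hM : 0 < M) (hρ : ρ.real S ≤ (M : ℝ)⁻¹) :
    P.real S * Real.log M ≤ (klDiv P ρ).toReal + Real.log 2 := by
  obtain ⟨hac, hint⟩ := klDiv_ne_top_iff.mp hkl
  have hM' : (1 : ℝ) ≤ M := by exact_mod_cast hM
  -- Test function for the Donsker–Varadhan bound: exp f = 1 + (M - 1) 1_S has ρ-mean at most 2,
  -- which is the source of log 2.
  let f : 𝓧 → ℝ := S.indicator fun _ => Real.log M
  have hf : Integrable f P := (integrable_const _).indicator hS
  have hexp : (fun x => Real.exp (f x)) = fun x => S.indicator (fun _ => (M : ℝ) - 1) x + 1 := by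
    funext x
    by_cases hx : x ∈ S
    · simp [f, hx, Real.exp_log (zero_lt_one.trans_le hM')]
    · simp [f, hx]
  have hi : Integrable (S.indicator fun _ => (M : ℝ) - 1) ρ := (integrable_const _).indicator hS
  have hexpi : Integrable (fun x => Real.exp (f x)) ρ := by
    rw [hexp]
    exact hi.add (integrable_const _)
  have hexpint : ∫ x, Real.exp (f x) ∂ρ ≤ 2 := by
    rw [hexp, integral_add hi (integrable_const _), integral_indicator_const _ hS]
    simp only [smul_eq_mul, integral_const, probReal_univ, mul_one]
    have h1 : ρ.real S * ((M : ℝ) - 1) ≤ (M : ℝ)⁻¹ * ((M : ℝ) - 1) :=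
      mul_le_mul_of_nonneg_right hρ (by linarith)
    have h2 : (M : ℝ)⁻¹ * ((M : ℝ) - 1) ≤ 1 := by
      rw [inv_mul_le_iff₀ (by linarith)]
      linarith
    linarith
  have hexppos : 0 < ∫ x, Real.exp (f x) ∂ρ := integral_exp_pos hexpi
  have : IsProbabilityMeasure (ρ.tilted f) := isProbabilityMeasure_tilted hexpi
  have hnn := integral_llr_tilted_right hac hf hexpi hint
  -- The Donsker–Varadhan bound is the nonnegativity of the divergence of P from the tilted law.
  have h0 : 0 ≤ ∫ x, llr P (ρ.tilted f) x ∂P := by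
    have := integral_llr_add_sub_measure_univ_nonneg
      (hac.trans (absolutelyContinuous_tilted hexpi))
      (integrable_llr_tilted_right hac hf hint hexpi)
    simpa using this
  rw [toReal_klDiv_of_measure_eq hac (by simp)]
  have hfint : ∫ x, f x ∂P = P.real S * Real.log M := by
    simp [f, integral_indicator_const _ hS]
  have hlog := Real.log_le_log hexppos hexpint
  linarith

end Divergence

end FeedbackCoding

namespace FeedbackCoding

universe u v

/-! ### Coordinates of paths under replacement of one input or output. -/

section Paths

variable {A : ℕ → Type u} {B : ℤ → Type v}

@[simp] lemma setOut_fst (k : ℕ) (p : Path A B × B k) : (setOut k p).1 = p.1.1 := rfl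

@[simp] lemma inUpTo_setOut (i : ℕ) (k : ℕ) (p : Path A B × B k) :
    inUpTo i (setOut k p) = inUpTo i p.1 := rfl

@[simp] lemma inPast_setOut (i : ℕ) (k : ℕ) (p : Path A B × B k) :
    inPast i (setOut k p) = inPast i p.1 := rfl

@[simp] lemma setOut_snd_self (k : ℕ) (p : Path A B × B k) : (setOut k p).2 (k : ℤ) = p.2 := by
  simp [setOut]

@[simp] lemma setIn_fst_self (k : ℕ) (p : Path A B × A k) : (setIn k p).1 k = p.2 := by
  simp [setIn]

lemma setOut_snd_of_ne {k : ℕ} (p : Path A B × B k) {j : ℤ} (h : j ≠ k) :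
    (setOut k p).2 j = p.1.2 j := by
  simp [setOut, h]

lemma setIn_fst_of_ne {k : ℕ} (p : Path A B × A k) {j : ℕ} (h : j ≠ k) :
    (setIn k p).1 j = p.1.1 j := by
  simp [setIn, h]

lemma outOn_setOut {S : Set ℤ} {k : ℕ} (h : (k : ℤ) ∉ S) (p : Path A B × B k) :
    outOn S (setOut k p) = outOn S p.1 := by
  funext j
  exact setOut_snd_of_ne p fun hj => h (hj ▸ j.2)

lemma outPast_setOut {i : ℤ} {k : ℕ} (h : i ≤ k) (p : Path A B × B k) :
    outPast i (setOut k p) = outPast i p.1 :=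
  outOn_setOut (by simpa using h) p

lemma inPast_setIn {i k : ℕ} (h : i ≤ k) (p : Path A B × A k) :
    inPast i (setIn k p) = inPast i p.1 := by
  funext j
  exact setIn_fst_of_ne p (lt_of_lt_of_le j.2 h).ne

lemma inUpTo_setIn {i k : ℕ} (h : i < k) (p : Path A B × A k) :
    inUpTo i (setIn k p) = inUpTo i p.1 := by
  funext j
  exact setIn_fst_of_ne p (lt_of_le_of_lt j.2 h).ne

lemma exists_outOn_eq [∀ i, Nonempty (A i)] [∀ j, Nonempty (B j)] {S : Set ℤ} (i : ℕ)
    (b : OutOn B S) (a : A i) : ∃ x : Path A B, outOn S x = b ∧ x.1 i = a := by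
  classical
  refine ⟨(Function.update (fun _ => Classical.arbitrary _) i a,
    fun j => if h : j ∈ S then b ⟨j, h⟩ else Classical.arbitrary _), ?_, by simp⟩
  funext j
  simp [outOn]

lemma exists_outPast_inUpTo_eq [∀ i, Nonempty (A i)] [∀ j, Nonempty (B j)] {i : ℤ} {k : ℕ}
    (p : OutPast B i × InUpTo A k) : ∃ x : Path A B, (outPast i x, inUpTo k x) = p := by
  classical
  refine ⟨(fun j => if h : j ∈ Set.Iic k then p.2 ⟨j, h⟩ else Classical.arbitrary _,
    fun j => if h : j ∈ Set.Iio i then p.1 ⟨j, h⟩ else Classical.arbitrary _), ?_⟩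
  ext j
  · exact dif_pos j.2
  · exact dif_pos j.2

lemma exists_inPast_outPast_eq [∀ i, Nonempty (A i)] [∀ j, Nonempty (B j)] {i : ℤ} {k : ℕ}
    (p : InPast A k × OutPast B i) : ∃ x : Path A B, (inPast k x, outPast i x) = p := by
  classical
  refine ⟨(fun j => if h : j ∈ Set.Iio k then p.1 ⟨j, h⟩ else Classical.arbitrary _,
    fun j => if h : j ∈ Set.Iio i then p.2 ⟨j, h⟩ else Classical.arbitrary _), ?_⟩
  ext j
  · exact dif_pos j.2
  · exact dif_pos j.2

/-- Assemble outputs at times in `T ⊆ S ∪ {k}` from the outputs at times in `S` and at time `k`. -/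
def joinOut {S T : Set ℤ} {k : ℤ} (h : T ⊆ insert k S) (p : OutOn B S × B k) : OutOn B T :=
  fun j => if hj : (j : ℤ) = k then hj.symm ▸ p.2
    else p.1 ⟨j, (h j.2).resolve_left hj⟩

lemma joinOut_outOn {S T : Set ℤ} {k : ℤ} (h : T ⊆ insert k S) (x : Path A B) :
    joinOut h (outOn S x, x.2 k) = outOn T x := by
  funext ⟨j, hjT⟩
  by_cases hj : j = k
  · subst hj
    simp [joinOut, outOn]
  · simp [joinOut, outOn, hj]

end Paths

/-! ### Laws of paths produced by a channel. -/

section Laws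

variable {A : ℕ → Type u} {B : ℤ → Type v}
  [∀ i, MeasurableSpace (A i)] [∀ j, MeasurableSpace (B j)]

@[fun_prop] lemma measurable_joinOut {S T : Set ℤ} {k : ℤ} (h : T ⊆ insert k S) :
    Measurable (joinOut h : OutOn B S × B k → OutOn B T) := by
  refine measurable_pi_lambda _ fun ⟨j, hjT⟩ => ?_
  by_cases hj : j = k
  · subst hj
    simpa [joinOut] using measurable_snd
  · have hS : j ∈ S := (h hjT).resolve_left hj
    have hm : Measurable fun c : OutOn B S × B k => c.1 ⟨j, hS⟩ :=
      (measurable_pi_apply _).comp measurable_fst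
    simpa [joinOut, hj] using hm

@[fun_prop] lemma measurable_inPast' (i : ℕ) : Measurable (inPast i : Path A B → InPast A i) :=
  measurable_inPast i

@[fun_prop] lemma measurable_inUpTo' (i : ℕ) : Measurable (inUpTo i : Path A B → InUpTo A i) :=
  measurable_inUpTo i

@[fun_prop] lemma measurable_outOn' (S : Set ℤ) : Measurable (outOn S : Path A B → OutOn B S) :=
  measurable_outOn S

@[fun_prop] lemma measurable_outPast' (i : ℤ) : Measurable (outPast i : Path A B → OutPast B i) :=
  measurable_outPast i

@[fun_prop] lemma measurable_outUpTo (i : ℤ) : Measurable (outUpTo i : Path A B → OutUpTo B i) :=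
  measurable_outOn _

@[fun_prop] lemma measurable_input (i : ℕ) : Measurable (fun x : Path A B => x.1 i) := by
  fun_prop

@[fun_prop] lemma measurable_output (j : ℤ) : Measurable (fun x : Path A B => x.2 j) := by
  fun_prop

lemma Cost.measurable_total (γ : Cost A B) (n : ℕ) : Measurable (γ.total n) := by
  unfold Cost.total
  refine Finset.measurable_sum _ fun i _ => (γ.meas i).comp (by fun_prop)

/-- A law of initial data, inputs and outputs in which the initial data have law `μ` and the
outputs at the times `0, …, n` are produced by the channel `Q`. -/
structure IsChannelLaw (μ : Measure (OutPast B 0)) (Q : Channel A B) (n : ℕ)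
    (ν : Measure (Path A B)) : Prop where
  isProbabilityMeasure : IsProbabilityMeasure ν
  map_outPast_zero : ν.map (outPast 0) = μ
  map_output : ∀ i ≤ n, ν.map (fun x => ((outPast i x, inUpTo i x), x.2 (i : ℤ))) =
    ν.map (fun x => (outPast i x, inUpTo i x)) ⊗ₘ Q.kern i

lemma MasseyCI.eq {Q : Channel A B} {T : MessageChannel A B} (hT : MasseyCI Q T) (M : ℕ)
    (w : Fin M) : T M w = Q := by
  have h : (T M w).kern = Q.kern := funext fun i => hT M w i
  rcases hTw : T M w with ⟨k, hk⟩
  rcases Q with ⟨k', hk'⟩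
  simp only [hTw] at h
  subst h
  rfl

/-- A kernel that sees its conditioning variable only through h remains the conditional law when one
conditions on h alone. -/
lemma IsChannelLaw.map_output_of_comap {μ : Measure (OutPast B 0)} {Q : Channel A B} {n : ℕ}
    {ν : Measure (Path A B)} (hν : IsChannelLaw μ Q n ν) {i : ℕ} (hi : i ≤ n) {𝓨 : Type*}
    [MeasurableSpace 𝓨] {h : OutPast B i × InUpTo A i → 𝓨} (hh : Measurable h)
    (q : Kernel 𝓨 (B i)) [IsMarkovKernel q] (hq : Q.kern i = q.comap h hh) :
    ν.map (fun x => (h (outPast i x, inUpTo i x), x.2 (i : ℤ))) =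
      ν.map (fun x => h (outPast i x, inUpTo i x)) ⊗ₘ q := by
  have := hν.isProbabilityMeasure
  have hm := congrArg (Measure.map (Prod.map h id)) (hν.map_output i hi)
  rw [Measure.map_map (by fun_prop) (by fun_prop), hq, map_compProd_comap,
    Measure.map_map hh (by fun_prop)] at hm
  exact hm

/-- The part of the past outputs and of the inputs on which the channel at time `i` depends. -/
def channelStat {S : ℕ → Set ℤ} (hS : ∀ i : ℕ, S i ⊆ Set.Iio (i : ℤ)) (i : ℕ)
    (p : OutPast B i × InUpTo A i) : OutOn B (S i) × A i :=
  (Set.domRestrict₂ (hS i) p.1, p.2 ⟨i, Set.mem_Iic.mpr le_rfl⟩)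

@[fun_prop] lemma measurable_channelStat {S : ℕ → Set ℤ} (hS : ∀ i : ℕ, S i ⊆ Set.Iio (i : ℤ))
    (i : ℕ) : Measurable (channelStat (A := A) (B := B) hS i) :=
  ((Set.measurable_restrict₂ (hS i)).comp measurable_fst).prodMk
    ((measurable_pi_apply _).comp measurable_snd)

variable [∀ i, Nonempty (A i)] [∀ j, Nonempty (B j)]

section Recursion

variable (μ : Measure (OutPast B 0)) [IsProbabilityMeasure μ] (Q : Channel A B) (P : Policy A B)

lemma lintegral_lawUpTo_succ (m : ℕ) {f : Path A B → ℝ≥0∞} (hf : Measurable f) :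
    ∫⁻ x, f x ∂(lawUpTo μ Q P (m + 1)) =
      ∫⁻ x, ∫⁻ a, ∫⁻ b, f (setOut m (setIn m (x, a), b)) ∂(Q.onPath m (setIn m (x, a)))
        ∂(P.onPath m x) ∂(lawUpTo μ Q P m) := by
  have : IsProbabilityMeasure (((lawUpTo μ Q P m) ⊗ₘ (P.onPath m)).map (setIn m)) :=
    Measure.isProbabilityMeasure_map (measurable_setIn m).aemeasurable
  have h1 : Measurable fun p : Path A B × B m => f (setOut m p) := hf.comp (measurable_setOut m)
  have h2 : Measurable fun x : Path A B => ∫⁻ b, f (setOut m (x, b)) ∂(Q.onPath m x) :=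
    h1.lintegral_kernel_prod_right'
  rw [lawUpTo, lintegral_map hf (measurable_setOut m), Measure.lintegral_compProd h1,
    lintegral_map h2 (measurable_setIn m),
    Measure.lintegral_compProd (f := fun p => ∫⁻ b, f (setOut m (setIn m p, b)) ∂(Q.onPath m (setIn m p)))
      (h2.comp (measurable_setIn m))]

/-- The steps from m on overwrite only coordinates that F ignores. -/
lemma map_lawUpTo_of_le {𝓨 : Type*} [MeasurableSpace 𝓨] {m n : ℕ} (hmn : m ≤ n)
    {F : Path A B → 𝓨} (hF : Measurable F)
    (h : ∀ k, m ≤ k → ∀ x a b, F (setOut k (setIn k (x, a), b)) = F x) :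
    (lawUpTo μ Q P n).map F = (lawUpTo μ Q P m).map F := by
  induction n, hmn using Nat.le_induction with
  | base => rfl
  | succ k hk ih =>
    rw [← ih]
    refine Measure.ext_of_lintegral _ fun f hf => ?_
    rw [lintegral_map hf hF, lintegral_map hf hF, lintegral_lawUpTo_succ μ Q P k
      (show Measurable fun x => f (F x) from hf.comp hF)]
    simp [h k hk]

lemma map_outPast_zero_lawUpTo (n : ℕ) : (lawUpTo μ Q P n).map (outPast 0) = μ := by
  rw [map_lawUpTo_of_le μ Q P n.zero_le (measurable_outPast 0)
    fun k _ x a b => outPast_setOut (by positivity) _, lawUpTo,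
    Measure.map_map (measurable_outPast 0) measurable_startPath]
  have : outPast 0 ∘ (startPath : OutPast B 0 → Path A B) = id := by
    funext b j
    exact dif_pos j.2
  rw [this, Measure.map_id]

lemma map_output_lawUpTo {i n : ℕ} (hi : i < n) :
    (lawUpTo μ Q P n).map (fun x => ((outPast i x, inUpTo i x), x.2 (i : ℤ))) =
      (lawUpTo μ Q P n).map (fun x => (outPast i x, inUpTo i x)) ⊗ₘ Q.kern i := by
  have h1 : ∀ k, i + 1 ≤ k → ∀ (x : Path A B) a b,
      (outPast i (setOut k (setIn k (x, a), b)), inUpTo i (setOut k (setIn k (x, a), b))) =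
        (outPast i x, inUpTo i x) := fun k hk x a b => by
    have h1 : (i : ℤ) ≤ k := by omega
    rw [outPast_setOut h1, inUpTo_setOut, inUpTo_setIn hk]
    rfl
  rw [map_lawUpTo_of_le μ Q P hi (by fun_prop), map_lawUpTo_of_le μ Q P hi (by fun_prop) h1]
  · refine Measure.ext_of_lintegral _ fun f hf => ?_
    have hg : Measurable fun x : Path A B =>
        ∫⁻ b, f ((outPast i x, inUpTo i x), b) ∂Q.kern i (outPast i x, inUpTo i x) :=
      hf.lintegral_kernel_prod_right'.comp (by fun_prop)
    rw [lintegral_map hf (by fun_prop), Measure.lintegral_compProd hf,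
      lintegral_map hf.lintegral_kernel_prod_right' (by fun_prop),
      lintegral_lawUpTo_succ μ Q P i (by fun_prop), lintegral_lawUpTo_succ μ Q P i hg]
    refine lintegral_congr fun x => lintegral_congr fun a => ?_
    simp only [setOut_snd_self, inUpTo_setOut, outPast_setOut le_rfl, lintegral_const,
      measure_univ, mul_one]
    rfl
  · intro k hk x a b
    have h2 : (i : ℤ) ≠ k := by omega
    rw [h1 k hk x a b, setOut_snd_of_ne _ h2]
    rfl

lemma map_input_lawUpTo {i n : ℕ} (hi : i < n) :
    (lawUpTo μ Q P n).map (fun x => ((inPast i x, outPast i x), x.1 i)) =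
      (lawUpTo μ Q P n).map (fun x => (inPast i x, outPast i x)) ⊗ₘ P.kern i := by
  have h1 : ∀ k, i ≤ k → ∀ (x : Path A B) a b,
      (inPast i (setOut k (setIn k (x, a), b)), outPast i (setOut k (setIn k (x, a), b))) =
        (inPast i x, outPast i x) := fun k hk x a b => by
    have h1 : (i : ℤ) ≤ k := by omega
    rw [outPast_setOut h1, inPast_setOut, inPast_setIn hk]
    rfl
  -- The input at time i is written by step i, so the left side is frozen only from time i + 1; the
  -- past on the right is frozen from time i. What remains is one step of the recursion.
  rw [map_lawUpTo_of_le μ Q P hi (by fun_prop), map_lawUpTo_of_le μ Q P hi.le (by fun_prop) h1]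
  · refine Measure.ext_of_lintegral _ fun f hf => ?_
    rw [lintegral_map hf (by fun_prop), Measure.lintegral_compProd hf,
      lintegral_map hf.lintegral_kernel_prod_right' (by fun_prop),
      lintegral_lawUpTo_succ μ Q P i (by fun_prop)]
    refine lintegral_congr fun x => ?_
    simp only [inPast_setOut, outPast_setOut le_rfl, setOut_fst, setIn_fst_self,
      inPast_setIn le_rfl, lintegral_const, measure_univ, mul_one]
    rfl
  · intro k hk x a b
    have hk' : i ≤ k := by omega
    rw [h1 k hk' x a b, setOut_fst, setIn_fst_of_ne _ (by omega)]

end Recursion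

lemma isChannelLaw_jointLaw (μ : Measure (OutPast B 0)) [IsProbabilityMeasure μ]
    (Q : Channel A B) (P : Policy A B) (n : ℕ) : IsChannelLaw μ Q n (jointLaw μ Q P n) where
  isProbabilityMeasure := inferInstance
  map_outPast_zero := map_outPast_zero_lawUpTo μ Q P _
  map_output _ hi := map_output_lawUpTo μ Q P (Nat.lt_succ_of_le hi)

lemma isProbabilityMeasure_codeLaw [∀ j, StandardBorelSpace (B j)] (μ : Measure (OutPast B 0))
    [IsProbabilityMeasure μ]
    (T : MessageChannel A B) {M : ℕ} (hM : 0 < M) (g : Encoder A B M) (n : ℕ) :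
    IsProbabilityMeasure (codeLaw μ T g n) := by
  refine ⟨?_⟩
  have h : (M : ℝ≥0∞) ≠ 0 := by exact_mod_cast hM.ne'
  simp [codeLaw, ENNReal.inv_mul_cancel h (ENNReal.natCast_ne_top M)]

lemma lintegral_codeLaw (μ : Measure (OutPast B 0)) (T : MessageChannel A B) {M : ℕ}
    (g : Encoder A B M) (n : ℕ) (f : Path A B → ℝ≥0∞) :
    ∫⁻ x, f x ∂(codeLaw μ T g n) =
      (M : ℝ≥0∞)⁻¹ * ∑ w, ∫⁻ x, f x ∂(jointLaw μ (T M w) (g.policy w) n) := by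
  rw [codeLaw, lintegral_smul_measure, lintegral_finsetSum_measure, smul_eq_mul]

/-- The defining equations of a channel law are linear in the law, so they survive averaging over
messages; Massey's condition makes the channel the same for all of them. -/
lemma isChannelLaw_codeLaw [∀ j, StandardBorelSpace (B j)] (μ : Measure (OutPast B 0))
    [IsProbabilityMeasure μ] {Q : Channel A B}
    {T : MessageChannel A B} (hT : MasseyCI Q T) {M : ℕ} (hM : 0 < M) (g : Encoder A B M)
    (n : ℕ) : IsChannelLaw μ Q n (codeLaw μ T g n) := by
  have hprob := isProbabilityMeasure_codeLaw μ T hM g n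
  have h : (M : ℝ≥0∞) ≠ 0 := by exact_mod_cast hM.ne'
  refine ⟨hprob, ?_, fun i hi => ?_⟩
  · refine Measure.ext_of_lintegral _ fun f hf => ?_
    rw [lintegral_map hf (by fun_prop), lintegral_codeLaw]
    have (w : Fin M) : ∫⁻ x, f (outPast 0 x) ∂(jointLaw μ (T M w) (g.policy w) n) =
        ∫⁻ b, f b ∂μ := by
      rw [← lintegral_map hf (by fun_prop), (isChannelLaw_jointLaw μ _ _ n).map_outPast_zero]
    simp [this, ← mul_assoc, ENNReal.inv_mul_cancel h (ENNReal.natCast_ne_top M)]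
  · refine Measure.ext_of_lintegral _ fun f hf => ?_
    rw [lintegral_map hf (by fun_prop), Measure.lintegral_compProd hf,
      lintegral_map hf.lintegral_kernel_prod_right' (by fun_prop), lintegral_codeLaw,
      lintegral_codeLaw]
    congr 1
    refine Finset.sum_congr rfl fun w _ => ?_
    rw [← lintegral_map hf (by fun_prop), (isChannelLaw_jointLaw μ _ _ n).map_output i hi,
      Measure.lintegral_compProd hf,
      lintegral_map hf.lintegral_kernel_prod_right' (by fun_prop), hT.eq]

/-! ### Information structures -/

/-- The channel and the cost at time `i` depend on the past outputs only through those at the times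
in `S i`, and the information at time `i + 1` is computed from that at time `i` and the output. -/
structure IsCompatible (Q : Channel A B) (γ : Cost A B) (S : ℕ → Set ℤ) : Prop where
  subset : ∀ i : ℕ, S i ⊆ Set.Iio (i : ℤ)
  succ_subset : ∀ i : ℕ, S (i + 1) ⊆ insert (i : ℤ) (S i)
  channel : ∀ i : ℕ, ∃ q : Kernel (OutOn B (S i) × A i) (B i), IsMarkovKernel q ∧
    ∀ x : Path A B, Q.kern i (outPast i x, inUpTo i x) = q (outOn (S i) x, x.1 i)
  cost : ∀ i : ℕ, ∃ c : (OutOn B (S i) × A i) × B i → ℝ≥0, Measurable c ∧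
    ∀ x : Path A B, γ.fn i (inUpTo i x, outUpTo i x) = c ((outOn (S i) x, x.1 i), x.2 (i : ℤ))

lemma infoStructure_subset (chCl : ChannelClass) (coCl : CostClass) (i : ℕ) :
    infoStructure chCl coCl i ⊆ Set.Iio (i : ℤ) := by
  rcases chCl with _ | M <;> rcases coCl with _ | K <;> intro j hj <;>
    simp [infoStructure] at hj ⊢ <;> omega

/-- A window of length max(M, K) contains what the channel needs and, together with the current
output, what the cost needs. When the window slides by one, only the newest output enters. -/
lemma isCompatible_infoStructure {Q : Channel A B} {γ : Cost A B} {chCl : ChannelClass}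
    {coCl : CostClass} (hQ : Q.IsOfClass chCl) (hγ : γ.IsOfClass coCl) :
    IsCompatible Q γ (infoStructure chCl coCl) := by
  refine ⟨infoStructure_subset chCl coCl, fun i => ?_, fun i => ?_, fun i => ?_⟩
  · rcases chCl with _ | M <;> rcases coCl with _ | K <;> intro j hj <;>
      simp [infoStructure] at hj ⊢ <;> omega
  · obtain ⟨S₀, hS₀, q, hq⟩ : ∃ S₀, ∃ _ : S₀ ⊆ infoStructure chCl coCl i,
        ∃ q : Kernel (OutOn B S₀ × A i) (B i), ∀ x : Path A B,
          Q.kern i (outPast i x, inUpTo i x) = q (outOn S₀ x, x.1 i) := by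
      rcases chCl with _ | M
      · obtain ⟨q, hq⟩ := hQ i
        exact ⟨Set.Iio (i : ℤ), by simp [infoStructure], q, hq⟩
      · obtain ⟨q, hq⟩ := hQ i
        refine ⟨Set.Ico ((i : ℤ) - M) i, ?_, q, hq⟩
        rcases coCl with _ | K <;> intro j hj <;> simp [infoStructure] at hj ⊢ <;> omega
    let h : OutOn B (infoStructure chCl coCl i) × A i → OutOn B S₀ × A i :=
      Prod.map (Set.domRestrict₂ hS₀) id
    have hh : Measurable h := (Set.measurable_restrict₂ hS₀).prodMap measurable_id
    refine ⟨q.comap h hh, ⟨fun p => ?_⟩, hq⟩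
    -- `Channel.IsOfClass` does not ask q to be Markov. Every argument extends to a path, so each
    -- value of the pulled-back kernel is a value of `Q.kern i`, hence a probability measure.
    obtain ⟨x, hx1, hx2⟩ := exists_outOn_eq (B := B) i p.1 p.2
    have : q.comap h hh p = Q.kern i (outPast i x, inUpTo i x) := by
      rw [hq, Kernel.comap_apply, ← Prod.mk.eta (p := p), ← hx1, ← hx2]
      rfl
    rw [this]
    infer_instance
  · obtain ⟨S₀, hS₀, c, hc, hcx⟩ : ∃ S₀, ∃ _ : S₀ ⊆ insert (i : ℤ) (infoStructure chCl coCl i),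
        ∃ c : A i × OutOn B S₀ → ℝ≥0, Measurable c ∧ ∀ x : Path A B,
          γ.fn i (inUpTo i x, outUpTo i x) = c (x.1 i, outOn S₀ x) := by
      rcases coCl with _ | K
      · obtain ⟨c, hc, hcx⟩ := hγ i
        refine ⟨Set.Iic (i : ℤ), ?_, c, hc, hcx⟩
        intro j hj
        rcases chCl <;> simp [infoStructure] at hj ⊢ <;> omega
      · obtain ⟨c, hc, hcx⟩ := hγ i
        refine ⟨Set.Icc ((i : ℤ) - K) i, ?_, c, hc, hcx⟩
        rcases chCl with _ | M <;> intro j hj <;> simp [infoStructure] at hj ⊢ <;> omega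
    refine ⟨fun p => c (p.1.2, joinOut hS₀ (p.1.1, p.2)), hc.comp (by fun_prop), fun x => ?_⟩
    rw [hcx]
    exact congrArg (fun b => c (x.1 i, b)) (joinOut_outOn hS₀ x).symm

lemma IsCompatible.exists_kern_eq_comap {Q : Channel A B} {γ : Cost A B} {S : ℕ → Set ℤ}
    (h : IsCompatible Q γ S) (i : ℕ) : ∃ q : Kernel (OutOn B (S i) × A i) (B i),
      IsMarkovKernel q ∧ Q.kern i = q.comap (channelStat h.subset i)
        (measurable_channelStat h.subset i) := by
  obtain ⟨q, hq, hqx⟩ := h.channel i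
  refine ⟨q, hq, Kernel.ext fun p => ?_⟩
  obtain ⟨x, rfl⟩ := exists_outPast_inUpTo_eq p
  rw [hqx]
  rfl

lemma Policy.HasInfoStructure.exists_kern_eq_comap {P : Policy A B} {S : ℕ → Set ℤ}
    (h : P.HasInfoStructure S) (hS : ∀ i : ℕ, S i ⊆ Set.Iio (i : ℤ)) (i : ℕ) :
    ∃ π : Kernel (OutOn B (S i)) (A i), IsMarkovKernel π ∧
      P.kern i = π.comap (fun p : InPast A i × OutPast B i => Set.domRestrict₂ (hS i) p.2)
        ((Set.measurable_restrict₂ (hS i)).comp measurable_snd) := by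
  obtain ⟨π, hπ⟩ := h i
  refine ⟨π, ⟨fun b => ?_⟩, Kernel.ext fun p => ?_⟩
  · obtain ⟨x, hx, -⟩ := exists_outOn_eq i b (Classical.arbitrary (A i))
    rw [← hx, ← hπ]
    infer_instance
  · obtain ⟨x, rfl⟩ := exists_inPast_outPast_eq p
    rw [hπ]
    rfl

end Laws

end FeedbackCoding

namespace FeedbackCoding

universe u v

/-! ### Reduction to input distributions that use only the information window. -/

section CapacityCharacterization

open InformationTheory

variable {A : ℕ → Type u} {B : ℤ → Type v}
  [∀ i, MeasurableSpace (A i)]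
  [∀ j, MeasurableSpace (B j)]

/-- The past outputs and the present input. -/
def letterStat (i : ℕ) (p : OutPast B i × InUpTo A i) : OutPast B i × A i :=
  (p.1, p.2 ⟨i, Set.mem_Iic.mpr le_rfl⟩)

@[fun_prop] lemma measurable_letterStat (i : ℕ) :
    Measurable (letterStat (A := A) (B := B) i) :=
  measurable_fst.prodMk ((measurable_pi_apply _).comp measurable_snd)

/-- Restrict the past outputs to those at the times in `S i`. -/
def restrictPast {S : ℕ → Set ℤ} (hS : ∀ i : ℕ, S i ⊆ Set.Iio (i : ℤ)) (i : ℕ)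
    (p : OutPast B i × A i) : OutOn B (S i) × A i :=
  (Set.domRestrict₂ (hS i) p.1, p.2)

@[fun_prop] lemma measurable_restrictPast {S : ℕ → Set ℤ} (hS : ∀ i : ℕ, S i ⊆ Set.Iio (i : ℤ))
    (i : ℕ) : Measurable (restrictPast (A := A) (B := B) hS i) :=
  ((Set.measurable_restrict₂ (hS i)).comp measurable_fst).prodMk measurable_snd

variable {μ : Measure (OutPast B 0)} {Q : Channel A B} {n : ℕ} {ν : Measure (Path A B)}
  {S : ℕ → Set ℤ} {hS : ∀ i : ℕ, S i ⊆ Set.Iio (i : ℤ)} {i : ℕ}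
  {q : Kernel (OutOn B (S i) × A i) (B i)} [IsMarkovKernel q]

lemma IsChannelLaw.map_letter (hν : IsChannelLaw μ Q n ν) (hi : i ≤ n)
    (hq : Q.kern i = q.comap (channelStat hS i) (measurable_channelStat hS i)) :
    ν.map (fun x => ((outPast i x, x.1 i), x.2 (i : ℤ))) =
      ν.map (fun x => (outPast i x, x.1 i)) ⊗ₘ
        q.comap (restrictPast hS i) (measurable_restrictPast hS i) :=
  hν.map_output_of_comap hi (measurable_letterStat i) _ hq

lemma IsChannelLaw.map_info (hν : IsChannelLaw μ Q n ν) (hi : i ≤ n)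
    (hq : Q.kern i = q.comap (channelStat hS i) (measurable_channelStat hS i)) :
    ν.map (fun x => ((outOn (S i) x, x.1 i), x.2 (i : ℤ))) =
      ν.map (fun x => (outOn (S i) x, x.1 i)) ⊗ₘ q :=
  hν.map_output_of_comap hi (measurable_channelStat hS i) _ hq

variable [∀ j, StandardBorelSpace (B j)] [∀ j, Nonempty (B j)]

lemma condMutualInfo_inUpTo_eq [IsFiniteMeasure ν] (hν : IsChannelLaw μ Q n ν) (hi : i ≤ n) :
    condMutualInfo ν (inUpTo i) (fun x => x.2 (i : ℤ)) (outPast (i : ℤ)) =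
      klDiv (ν.map (fun x => (outPast i x, inUpTo i x)) ⊗ₘ Q.kern i)
        (ν.map (fun x => (outPast i x, inUpTo i x)) ⊗ₘ
          (condDistrib (fun x : Path A B => x.2 (i : ℤ)) (outPast (i : ℤ)) ν).prodMkRight
            (InUpTo A i)) := by
  rw [condMutualInfo, hν.map_output i hi]

lemma condMutualInfo_letter_eq [IsFiniteMeasure ν] (hν : IsChannelLaw μ Q n ν) (hi : i ≤ n)
    (hq : Q.kern i = q.comap (channelStat hS i) (measurable_channelStat hS i)) :
    condMutualInfo ν (fun x => x.1 i) (fun x => x.2 (i : ℤ)) (outPast (i : ℤ)) =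
      klDiv (ν.map (fun x => (outPast i x, x.1 i)) ⊗ₘ
          q.comap (restrictPast hS i) (measurable_restrictPast hS i))
        (ν.map (fun x => (outPast i x, x.1 i)) ⊗ₘ
          (condDistrib (fun x : Path A B => x.2 (i : ℤ)) (outPast (i : ℤ)) ν).prodMkRight
            (A i)) := by
  rw [condMutualInfo, hν.map_letter hi hq]

/-- Both kernels compared, the channel and the output law given b^{i-1}, see a^i at most through
a_i, so the earlier inputs do not affect the divergence. -/
lemma condMutualInfo_inUpTo_eq_letter [IsFiniteMeasure ν] (hν : IsChannelLaw μ Q n ν)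
    (hi : i ≤ n)
    (hq : Q.kern i = q.comap (channelStat hS i) (measurable_channelStat hS i)) :
    condMutualInfo ν (inUpTo i) (fun x => x.2 (i : ℤ)) (outPast (i : ℤ)) =
      condMutualInfo ν (fun x => x.1 i) (fun x => x.2 (i : ℤ)) (outPast (i : ℤ)) := by
  have hm : ν.map (fun x => (outPast i x, x.1 i)) =
      (ν.map (fun x => (outPast i x, inUpTo i x))).map (letterStat i) := by
    rw [Measure.map_map (by fun_prop) (by fun_prop)]
    rfl
  rw [condMutualInfo_inUpTo_eq hν hi, condMutualInfo_letter_eq hν hi hq, hm,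
    ← klDiv_compProd_comap _ (measurable_letterStat i), hq]
  rfl

lemma IsCompatible.directedInfo_eq_perLetterInfo [∀ i, Nonempty (A i)] {γ : Cost A B}
    (hC : IsCompatible Q γ S) [IsFiniteMeasure ν] (hν : IsChannelLaw μ Q n ν) :
    directedInfo ν n = perLetterInfo ν n := by
  refine Finset.sum_congr rfl fun i hi => ?_
  obtain ⟨q, _, hq⟩ := hC.exists_kern_eq_comap i
  exact condMutualInfo_inUpTo_eq_letter hν (Finset.mem_range_succ_iff.mp hi) hq

/-- The output law given b^{i-1} minimizes the divergence among kernels from b^{i-1}, and r read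
through the window is one such kernel. For this competitor both kernels factor through (b_{S i},
a_i), so only the law of that pair remains. -/
lemma condMutualInfo_letter_le [StandardBorelSpace (A i)] [Nonempty (A i)] [IsFiniteMeasure ν]
    (hν : IsChannelLaw μ Q n ν) (hi : i ≤ n)
    (hq : Q.kern i = q.comap (channelStat hS i) (measurable_channelStat hS i))
    (r : Kernel (OutOn B (S i)) (B i)) [IsMarkovKernel r] :
    condMutualInfo ν (fun x => x.1 i) (fun x => x.2 (i : ℤ)) (outPast (i : ℤ)) ≤
      klDiv (ν.map (fun x => (outOn (S i) x, x.1 i)) ⊗ₘ q)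
        (ν.map (fun x => (outOn (S i) x, x.1 i)) ⊗ₘ r.prodMkRight (A i)) := by
  have hm : ν.map (fun x => (outOn (S i) x, x.1 i)) =
      (ν.map (fun x => (outPast i x, x.1 i))).map (restrictPast hS i) := by
    rw [Measure.map_map (by fun_prop) (by fun_prop)]
    rfl
  rw [condMutualInfo_letter_eq hν hi hq, hm,
    ← klDiv_compProd_comap _ (measurable_restrictPast hS i)]
  refine klDiv_compProd_prodMkRight_le _ _ _
    (r.comap (Set.domRestrict₂ (hS i)) (Set.measurable_restrict₂ (hS i))) ?_
  rw [← hν.map_letter hi hq, Measure.map_map (by fun_prop) (by fun_prop), Measure.fst,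
    Measure.map_map (by fun_prop) (by fun_prop)]
  exact (compProd_map_condDistrib (by fun_prop)).symm

section Policies

variable [∀ i, Nonempty (A i)] [IsProbabilityMeasure μ] {P : Policy A B}
  {π : Kernel (OutOn B (S i)) (A i)} [IsMarkovKernel π]

omit [∀ j, StandardBorelSpace (B j)] in
lemma map_outPast_input_jointLaw (hi : i ≤ n)
    (hπ : P.kern i = π.comap (fun p : InPast A i × OutPast B i => Set.domRestrict₂ (hS i) p.2)
        ((Set.measurable_restrict₂ (hS i)).comp measurable_snd)) :
    (jointLaw μ Q P n).map (fun x => (outPast i x, x.1 i)) =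
      (jointLaw μ Q P n).map (outPast (i : ℤ)) ⊗ₘ
        π.comap (Set.domRestrict₂ (hS i)) (Set.measurable_restrict₂ (hS i)) := by
  have hm := congrArg (Measure.map (Prod.map (Prod.snd : InPast A i × OutPast B i → _) id))
    (map_input_lawUpTo μ Q P (Nat.lt_succ_of_le hi))
  have hP : P.kern i = (π.comap (Set.domRestrict₂ (hS i)) (Set.measurable_restrict₂ (hS i))).comap
    (Prod.snd : InPast A i × OutPast B i → _) measurable_snd := hπ
  rw [Measure.map_map (by fun_prop) (by fun_prop), hP, map_compProd_comap,
    Measure.map_map (by fun_prop) (by fun_prop)] at hm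
  exact hm

omit [∀ j, StandardBorelSpace (B j)] in
lemma map_info_input_jointLaw (hi : i ≤ n)
    (hπ : P.kern i = π.comap (fun p : InPast A i × OutPast B i => Set.domRestrict₂ (hS i) p.2)
        ((Set.measurable_restrict₂ (hS i)).comp measurable_snd)) :
    (jointLaw μ Q P n).map (fun x => (outOn (S i) x, x.1 i)) =
      (jointLaw μ Q P n).map (outOn (S i)) ⊗ₘ π := by
  have hm := congrArg (Measure.map (Prod.map (Set.domRestrict₂ (hS i)) id))
    (map_outPast_input_jointLaw (μ := μ) (Q := Q) (P := P) hi hπ)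
  rw [Measure.map_map ((Set.measurable_restrict₂ (hS i)).prodMap measurable_id) (by fun_prop),
    map_compProd_comap, Measure.map_map (Set.measurable_restrict₂ (hS i)) (by fun_prop)] at hm
  exact hm

/-- Under an input distribution with information structure `S`, the output at time `i` depends on
the past outputs only through those at the times in `S i`. -/
lemma condMutualInfo_letter_jointLaw (hi : i ≤ n)
    (hq : Q.kern i = q.comap (channelStat hS i) (measurable_channelStat hS i))
    (hπ : P.kern i = π.comap (fun p : InPast A i × OutPast B i => Set.domRestrict₂ (hS i) p.2)
        ((Set.measurable_restrict₂ (hS i)).comp measurable_snd)) :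
    condMutualInfo (jointLaw μ Q P n) (fun x => x.1 i) (fun x => x.2 (i : ℤ)) (outPast (i : ℤ)) =
      klDiv ((jointLaw μ Q P n).map (fun x => (outOn (S i) x, x.1 i)) ⊗ₘ q)
        ((jointLaw μ Q P n).map (fun x => (outOn (S i) x, x.1 i)) ⊗ₘ
          (π ⊗ₖ q).snd.prodMkRight (A i)) := by
  set ρ := jointLaw μ Q P n with hρ
  have hch : IsChannelLaw μ Q n ρ := isChannelLaw_jointLaw μ Q P n
  let res : OutPast B i → OutOn B (S i) := Set.domRestrict₂ (hS i)
  have hres : Measurable res := Set.measurable_restrict₂ (hS i)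
  have hout : ρ.map (fun x => (outPast i x, x.2 (i : ℤ))) =
      ρ.map (outPast (i : ℤ)) ⊗ₘ (π ⊗ₖ q).snd.comap res hres := by
    refine Measure.ext_of_lintegral _ fun f hf => ?_
    have hf' : Measurable fun p : (OutPast B i × A i) × B i => f (p.1.1, p.2) :=
      hf.comp (by fun_prop)
    calc ∫⁻ y, f y ∂(ρ.map (fun x => (outPast i x, x.2 (i : ℤ))))
        = ∫⁻ y, f (y.1.1, y.2) ∂(ρ.map (fun x => ((outPast i x, x.1 i), x.2 (i : ℤ)))) := by
          rw [lintegral_map hf (by fun_prop), lintegral_map hf' (by fun_prop)]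
      _ = _ := by
          rw [hch.map_letter hi hq, Measure.lintegral_compProd hf',
            map_outPast_input_jointLaw hi hπ,
            Measure.lintegral_compProd hf'.lintegral_kernel_prod_right',
            Measure.lintegral_compProd hf]
          refine lintegral_congr fun b => ?_
          have hfb : Measurable fun z => f (b, z) := hf.comp measurable_prodMk_left
          rw [Kernel.comap_apply, Kernel.comap_apply, Kernel.snd_apply,
            lintegral_map hfb measurable_snd,
            Kernel.lintegral_compProd _ _ _ (f := fun p => f (b, p.2)) (hfb.comp measurable_snd)]
          rfl
  -- Uniqueness of conditional laws: averaging q over the window-dependent input kernel already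
  -- disintegrates the output over the past.
  have hcond : condDistrib (fun x : Path A B => x.2 (i : ℤ)) (outPast (i : ℤ)) ρ
      =ᵐ[ρ.map (outPast (i : ℤ))] (π ⊗ₖ q).snd.comap res hres :=
    condDistrib_ae_eq_of_measure_eq_compProd _ (by fun_prop) hout
  have hcond' : (condDistrib (fun x : Path A B => x.2 (i : ℤ)) (outPast (i : ℤ)) ρ).prodMkRight
        (A i) =ᵐ[ρ.map (fun x => (outPast i x, x.1 i))]
      ((π ⊗ₖ q).snd.comap res hres).prodMkRight (A i) := by
    have hfst : (ρ.map (fun x => (outPast i x, x.1 i))).map Prod.fst = ρ.map (outPast (i : ℤ)) := by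
      rw [Measure.map_map (by fun_prop) (by fun_prop)]
      rfl
    rw [← hfst] at hcond
    exact ae_of_ae_map measurable_fst.aemeasurable hcond
  have hm : ρ.map (fun x => (outOn (S i) x, x.1 i)) =
      (ρ.map (fun x => (outPast i x, x.1 i))).map (restrictPast hS i) := by
    rw [Measure.map_map (by fun_prop) (by fun_prop)]
    rfl
  rw [condMutualInfo_letter_eq hch hi hq, Measure.compProd_congr hcond', hm,
    ← klDiv_compProd_comap _ (measurable_restrictPast hS i)]
  rfl

variable (hS) in
/-- The input distribution that, at each time, uses a given kernel from the outputs at the times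
in `S i`. -/
def infoPolicy (π : ∀ i : ℕ, Kernel (OutOn B (S i)) (A i)) [∀ i, IsMarkovKernel (π i)] :
    Policy A B where
  kern i := (π i).comap (fun p : InPast A i × OutPast B i => Set.domRestrict₂ (hS i) p.2)
    ((Set.measurable_restrict₂ (hS i)).comp measurable_snd)
  markov _ := inferInstance

omit [∀ j, StandardBorelSpace (B j)] [∀ j, Nonempty (B j)] [∀ i, Nonempty (A i)] in
lemma hasInfoStructure_infoPolicy (π : ∀ i : ℕ, Kernel (OutOn B (S i)) (A i))
    [∀ i, IsMarkovKernel (π i)] : (infoPolicy hS π).HasInfoStructure S :=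
  fun i => ⟨π i, fun _ => rfl⟩

end Policies

section Domination

variable [∀ i, StandardBorelSpace (A i)] [∀ i, Nonempty (A i)] [IsProbabilityMeasure μ]
  {γ : Cost A B}

/-- The input distribution obtained from the conditional laws, under `ν`, of the inputs given the
outputs at the times in `S`. -/
noncomputable def condPolicy (hS : ∀ i : ℕ, S i ⊆ Set.Iio (i : ℤ)) (ν : Measure (Path A B))
    [IsFiniteMeasure ν] : Policy A B :=
  infoPolicy hS fun i => condDistrib (fun x : Path A B => x.1 i) (outOn (S i)) ν

omit [∀ j, StandardBorelSpace (B j)] in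
-- If the windows agree in law, the input kernel restores the joint law with a_i by its definition,
-- and the common channel then restores the law of b_i.
lemma IsCompatible.map_info_condPolicy (hC : IsCompatible Q γ S) [IsFiniteMeasure ν]
    (hν : IsChannelLaw μ Q n ν) (hi : i ≤ n)
    (h : (jointLaw μ Q (condPolicy hC.subset ν) n).map (outOn (S i)) = ν.map (outOn (S i))) :
    (jointLaw μ Q (condPolicy hC.subset ν) n).map (fun x => (outOn (S i) x, x.1 i)) =
        ν.map (fun x => (outOn (S i) x, x.1 i)) ∧
      (jointLaw μ Q (condPolicy hC.subset ν) n).map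
          (fun x => ((outOn (S i) x, x.1 i), x.2 (i : ℤ))) =
        ν.map (fun x => ((outOn (S i) x, x.1 i), x.2 (i : ℤ))) := by
  obtain ⟨q, _, hq⟩ := hC.exists_kern_eq_comap i
  have h1 : (jointLaw μ Q (condPolicy hC.subset ν) n).map (fun x => (outOn (S i) x, x.1 i)) =
      ν.map (fun x => (outOn (S i) x, x.1 i)) := by
    rw [map_info_input_jointLaw (P := condPolicy hC.subset ν) hi rfl, h,
      compProd_map_condDistrib (by fun_prop)]
  refine ⟨h1, ?_⟩
  rw [(isChannelLaw_jointLaw μ Q _ n).map_info hi hq, hν.map_info hi hq, h1]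

omit [∀ j, StandardBorelSpace (B j)] in
-- Induction on time, starting from the common law μ of the initial data: the next window is a
-- function of the current window and output, whose joint law was just matched.
lemma IsCompatible.map_outOn_condPolicy (hC : IsCompatible Q γ S) [IsFiniteMeasure ν]
    (hν : IsChannelLaw μ Q n ν) (hi : i ≤ n) :
    (jointLaw μ Q (condPolicy hC.subset ν) n).map (outOn (S i)) = ν.map (outOn (S i)) := by
  induction i with
  | zero =>
    have hr : (outOn (S 0) : Path A B → _) =
        Set.domRestrict₂ (hC.subset 0) ∘ (outPast ((0 : ℕ) : ℤ)) := rfl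
    have h1 := (isChannelLaw_jointLaw μ Q (condPolicy hC.subset ν) n).map_outPast_zero
    rw [hr, ← Measure.map_map (Set.measurable_restrict₂ _) (by fun_prop),
      ← Measure.map_map (Set.measurable_restrict₂ _) (by fun_prop)]
    exact congrArg _ (h1.trans hν.map_outPast_zero.symm)
  | succ k ih =>
    have h2 := (hC.map_info_condPolicy hν (Nat.le_of_succ_le hi) (ih (Nat.le_of_succ_le hi))).2
    have hr : (outOn (S (k + 1)) : Path A B → _) =
        (fun p : (OutOn B (S k) × A k) × B k => joinOut (hC.succ_subset k) (p.1.1, p.2)) ∘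
          fun x => ((outOn (S k) x, x.1 k), x.2 (k : ℤ)) :=
      funext fun x => (joinOut_outOn (hC.succ_subset k) x).symm
    rw [hr, ← Measure.map_map (by fun_prop) (by fun_prop), h2,
      Measure.map_map (by fun_prop) (by fun_prop)]

omit [∀ j, StandardBorelSpace (B j)] in
lemma IsCompatible.lintegral_total_condPolicy (hC : IsCompatible Q γ S) [IsFiniteMeasure ν]
    (hν : IsChannelLaw μ Q n ν) :
    ∫⁻ x, (γ.total n x : ℝ≥0∞) ∂(jointLaw μ Q (condPolicy hC.subset ν) n) =
      ∫⁻ x, (γ.total n x : ℝ≥0∞) ∂ν := by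
  have hmeas (i : ℕ) : Measurable fun x : Path A B => (γ.fn i (inUpTo i x, outUpTo i x) : ℝ≥0∞) :=
    ((γ.meas i).comp (by fun_prop)).coe_nnreal_ennreal
  simp only [Cost.total, ENNReal.ofNNReal_finsetSum]
  rw [lintegral_finsetSum _ fun i _ => hmeas i, lintegral_finsetSum _ fun i _ => hmeas i]
  refine Finset.sum_congr rfl fun i hi => ?_
  have hi' := Finset.mem_range_succ_iff.mp hi
  obtain ⟨c, hc, hcx⟩ := hC.cost i
  have h2 := (hC.map_info_condPolicy hν hi' (hC.map_outOn_condPolicy hν hi')).2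
  simp only [hcx]
  have hc' : Measurable fun p => (c p : ℝ≥0∞) := hc.coe_nnreal_ennreal
  rw [← lintegral_map hc' (g := fun x : Path A B => ((outOn (S i) x, x.1 i), x.2 (i : ℤ)))
    (by fun_prop), h2, lintegral_map hc' (by fun_prop)]

/-- For `condPolicy` the output kernel depends only on the window, so its information equals the
divergence against that kernel. The windows and inputs have the same law under ν, where that kernel
is merely a competitor. -/
lemma IsCompatible.perLetterInfo_le_condPolicy (hC : IsCompatible Q γ S) [IsFiniteMeasure ν]
    (hν : IsChannelLaw μ Q n ν) :
    perLetterInfo ν n ≤ perLetterInfo (jointLaw μ Q (condPolicy hC.subset ν) n) n := by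
  refine Finset.sum_le_sum fun i hi => ?_
  have hi' := Finset.mem_range_succ_iff.mp hi
  obtain ⟨q, _, hq⟩ := hC.exists_kern_eq_comap i
  rw [condMutualInfo_letter_jointLaw (P := condPolicy hC.subset ν) hi' hq rfl,
    (hC.map_info_condPolicy hν hi' (hC.map_outOn_condPolicy hν hi')).1]
  exact condMutualInfo_letter_le hν hi' hq _

/-- Input distributions with a compatible information structure are as good as any mechanism
producing the inputs. -/
lemma IsCompatible.perLetterInfo_le_charCapacityRate (hC : IsCompatible Q γ S)
    [IsFiniteMeasure ν] (hν : IsChannelLaw μ Q n ν) {κ : ℝ≥0} (hκ : MeetsCost γ κ n ν) :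
    ((n : ℝ≥0∞) + 1)⁻¹ * perLetterInfo ν n ≤ charCapacityRate μ Q γ κ S n := by
  have hmem : condPolicy hC.subset ν ∈
      {P | P ∈ policiesWithCost μ Q γ κ n ∧ Policy.HasInfoStructure P S} := by
    refine ⟨?_, hasInfoStructure_infoPolicy _⟩
    simpa only [policiesWithCost, Set.mem_ofPred_eq, MeetsCost,
      hC.lintegral_total_condPolicy hν] using hκ
  exact (mul_le_mul_right (hC.perLetterInfo_le_condPolicy hν) _).trans
    (le_iSup₂ (f := fun P (_ : P ∈ {P | P ∈ policiesWithCost μ Q γ κ n ∧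
      Policy.HasInfoStructure P S}) =>
        ((n : ℝ≥0∞) + 1)⁻¹ * perLetterInfo (jointLaw μ Q P n) n) _ hmem)

/-- One direction is inclusion of the restricted class; the other is domination applied to the joint
law of an arbitrary input distribution. Directed and per-letter information agree throughout. -/
lemma IsCompatible.charCapacityRate_eq (hC : IsCompatible Q γ S) (κ : ℝ≥0) (n : ℕ) :
    charCapacityRate μ Q γ κ S n = ((n : ℝ≥0∞) + 1)⁻¹ * ftfiCapacity μ Q γ κ n := by
  refine le_antisymm (iSup₂_le fun P hP => ?_) ?_
  · rw [← hC.directedInfo_eq_perLetterInfo (isChannelLaw_jointLaw μ Q P n)]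
    exact mul_le_mul_right (le_iSup₂ (f := fun P (_ : P ∈ policiesWithCost μ Q γ κ n) =>
      directedInfo (jointLaw μ Q P n) n) P hP.1) _
  · rw [ftfiCapacity, ENNReal.mul_iSup]
    refine iSup_le fun P => ?_
    rw [ENNReal.mul_iSup]
    refine iSup_le fun hP => ?_
    rw [hC.directedInfo_eq_perLetterInfo (isChannelLaw_jointLaw μ Q P n)]
    exact hC.perLetterInfo_le_charCapacityRate (isChannelLaw_jointLaw μ Q P n) hP

end Domination

end CapacityCharacterization

end FeedbackCoding

namespace FeedbackCoding

universe u v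

/-! ### Information between the message and the outputs. -/

section Fano

open InformationTheory

/-- The uniform law on the messages. -/
noncomputable def messageUniform (M : ℕ) : Measure (Fin M) := (M : ℝ≥0∞)⁻¹ • Measure.count

lemma isProbabilityMeasure_messageUniform {M : ℕ} (hM : 0 < M) :
    IsProbabilityMeasure (messageUniform M) := by
  refine ⟨?_⟩
  have h : (M : ℝ≥0∞) ≠ 0 := by exact_mod_cast hM.ne'
  simp [messageUniform, ENNReal.inv_mul_cancel h (ENNReal.natCast_ne_top M)]

lemma lintegral_messageUniform {M : ℕ} (f : Fin M → ℝ≥0∞) :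
    ∫⁻ w, f w ∂(messageUniform M) = (M : ℝ≥0∞)⁻¹ * ∑ w, f w := by
  rw [messageUniform, lintegral_smul_measure, lintegral_count, tsum_fintype, smul_eq_mul]

instance {M : ℕ} : IsFiniteMeasure (messageUniform M) := by
  rcases Nat.eq_zero_or_pos M with rfl | hM
  · exact ⟨by simp [messageUniform]⟩
  · have := isProbabilityMeasure_messageUniform hM
    infer_instance

variable {A : ℕ → Type u} {B : ℤ → Type v}
  [∀ i, MeasurableSpace (A i)] [∀ i, StandardBorelSpace (A i)] [∀ i, Nonempty (A i)]
  [∀ j, MeasurableSpace (B j)] [∀ j, StandardBorelSpace (B j)] [∀ j, Nonempty (B j)]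
  (μ : Measure (OutPast B 0)) [IsProbabilityMeasure μ] (Q : Channel A B)
  {M : ℕ} (g : Encoder A B M) {n : ℕ}

omit [∀ j, StandardBorelSpace (B j)] in
lemma Encoder.ae_input_eq (w : Fin M) {i : ℕ} (hi : i ≤ n) :
    ∀ᵐ x ∂(jointLaw μ Q (g.policy w) n), x.1 i = g.map i w (outPast i x) := by
  have hg : Measurable fun h : InPast A i × OutPast B i => g.map i w h.2 :=
    (g.meas i w).comp measurable_snd
  have h1 := map_input_lawUpTo μ Q (g.policy w) (Nat.lt_succ_of_le hi)
  have h2 : (g.policy w).kern i =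
      Kernel.deterministic (fun h : InPast A i × OutPast B i => g.map i w h.2) hg := rfl
  rw [h2, Measure.compProd_deterministic, Measure.map_map (by fun_prop) (by fun_prop)] at h1
  have h3 : ∀ᵐ p ∂((jointLaw μ Q (g.policy w) n).map
      fun x => ((inPast i x, outPast (i : ℤ) x), x.1 i)), p.2 = g.map i w p.1.2 := by
    have hset : MeasurableSet {p : (InPast A i × OutPast B i) × A i | p.2 = g.map i w p.1.2} :=
      measurableSet_eq_fun measurable_snd (hg.comp measurable_fst)
    have hmeas : Measurable fun x : Path A B => (inPast i x, outPast (i : ℤ) x) := by fun_prop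
    rw [jointLaw, h1]
    exact (ae_map_iff ((measurable_id.prodMk hg).comp hmeas).aemeasurable hset).mpr
      (Eventually.of_forall fun x => rfl)
  exact ae_of_ae_map (by fun_prop) h3

/-- The law of initial data, inputs and outputs given the message. -/
noncomputable def messageKernel (n : ℕ) : Kernel (Fin M) (Path A B) :=
  Kernel.ofFunOfCountable fun w => jointLaw μ Q (g.policy w) n

instance : IsMarkovKernel (messageKernel μ Q g n) :=
  ⟨fun w => by
    change IsProbabilityMeasure (jointLaw μ Q (g.policy w) n)
    infer_instance⟩

/-- The joint law of the uniformly distributed message, the initial data, the inputs and the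
outputs. -/
noncomputable def messageLaw (n : ℕ) : Measure (Fin M × Path A B) :=
  messageUniform M ⊗ₘ messageKernel μ Q g n

omit [∀ i, StandardBorelSpace (A i)] [∀ j, StandardBorelSpace (B j)] in
lemma isProbabilityMeasure_messageLaw (hM : 0 < M) :
    IsProbabilityMeasure (messageLaw μ Q g n) := by
  have := isProbabilityMeasure_messageUniform hM
  unfold messageLaw
  infer_instance

instance : IsFiniteMeasure (messageLaw μ Q g n) := by
  unfold messageLaw
  infer_instance

omit [∀ i, StandardBorelSpace (A i)] [∀ j, StandardBorelSpace (B j)] in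
lemma lintegral_messageLaw {f : Fin M × Path A B → ℝ≥0∞} (hf : Measurable f) :
    ∫⁻ p, f p ∂(messageLaw μ Q g n) =
      (M : ℝ≥0∞)⁻¹ * ∑ w, ∫⁻ x, f (w, x) ∂(jointLaw μ Q (g.policy w) n) := by
  rw [messageLaw, Measure.lintegral_compProd hf, lintegral_messageUniform]
  rfl

/-- The past outputs and the present input computed from the message and the past outputs. -/
def Encoder.letter (i : ℕ) (p : Fin M × OutPast B i) : OutPast B i × A i :=
  (p.2, g.map i p.1 p.2)

omit [∀ i, StandardBorelSpace (A i)] [∀ i, Nonempty (A i)] [∀ j, StandardBorelSpace (B j)]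
  [∀ j, Nonempty (B j)] in
@[fun_prop] lemma Encoder.measurable_letter (i : ℕ) : Measurable (g.letter i) :=
  measurable_snd.prodMk (measurable_from_prod_countable_right fun w => g.meas i w)

variable {Q}

omit [∀ j, StandardBorelSpace (B j)] in
-- Given the message and the past outputs, the input is almost surely the one computed by the
-- encoder, so the channel becomes a kernel from the pair (message, past).
lemma map_output_messageLaw {i : ℕ} (hi : i ≤ n) (q : Kernel (OutPast B i × A i) (B i))
    [IsMarkovKernel q]
    (hq : Q.kern i = q.comap (letterStat i) (measurable_letterStat i)) :
    (messageLaw μ Q g n).map (fun p => ((p.1, outPast i p.2), p.2.2 (i : ℤ))) =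
      (messageLaw μ Q g n).map (fun p => (p.1, outPast i p.2)) ⊗ₘ
        q.comap (g.letter i) (g.measurable_letter i) := by
  refine Measure.ext_of_lintegral _ fun f hf => ?_
  let F : Fin M × OutPast B i → ℝ≥0∞ :=
    fun p => ∫⁻ z, f (p, z) ∂(q.comap (g.letter i) (g.measurable_letter i) p)
  have hF : Measurable F := hf.lintegral_kernel_prod_right'
  have hF' : Measurable fun p : Fin M × Path A B => F (p.1, outPast (i : ℤ) p.2) :=
    hF.comp (by fun_prop)
  rw [lintegral_map hf (by fun_prop), lintegral_messageLaw μ Q g (by fun_prop),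
    Measure.lintegral_compProd hf, lintegral_map hF (by fun_prop), lintegral_messageLaw μ Q g hF']
  congr 1
  refine Finset.sum_congr rfl fun w _ => ?_
  have hfw : Measurable fun p : (OutPast B i × A i) × B i => f ((w, p.1.1), p.2) :=
    hf.comp (by fun_prop)
  have hm := (isChannelLaw_jointLaw μ Q (g.policy w) n).map_output_of_comap hi
    (measurable_letterStat i) q hq
  calc ∫⁻ x, f ((w, outPast i x), x.2 i) ∂(jointLaw μ Q (g.policy w) n)
      = ∫⁻ y, f ((w, y.1.1), y.2) ∂((jointLaw μ Q (g.policy w) n).map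
          (fun x => (letterStat i (outPast i x, inUpTo i x), x.2 (i : ℤ)))) := by
        rw [lintegral_map hfw (by fun_prop)]
        rfl
    _ = _ := by
        rw [hm, Measure.lintegral_compProd hfw,
          lintegral_map hfw.lintegral_kernel_prod_right' (by fun_prop)]
        refine lintegral_congr_ae ((g.ae_input_eq μ Q w hi).mono fun x hx => ?_)
        have hs : letterStat i (outPast i x, inUpTo i x) = g.letter i (w, outPast i x) :=
          Prod.ext rfl hx
        simp only [hs]
        rfl

omit [∀ j, StandardBorelSpace (B j)] in
lemma map_letter_codeLaw {T : MessageChannel A B} (hT : MasseyCI Q T) {i : ℕ} (hi : i ≤ n) :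
    (codeLaw μ T g n).map (fun x => (outPast i x, x.1 i)) =
      ((messageLaw μ Q g n).map (fun p => (p.1, outPast i p.2))).map (g.letter i) := by
  refine Measure.ext_of_lintegral _ fun f hf => ?_
  rw [lintegral_map hf (by fun_prop), lintegral_codeLaw, lintegral_map hf (by fun_prop),
    lintegral_map (show Measurable fun a => f (g.letter i a) from
      hf.comp (g.measurable_letter i)) (by fun_prop),
    lintegral_messageLaw μ Q g (f := fun a => f (g.letter i (a.1, outPast (i : ℤ) a.2)))
      (hf.comp ((g.measurable_letter i).comp (by fun_prop)))]
  congr 1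
  refine Finset.sum_congr rfl fun w _ => ?_
  rw [hT.eq]
  refine lintegral_congr_ae ((g.ae_input_eq μ Q w hi).mono fun x hx => ?_)
  simp only [hx]
  rfl

/-- One step of the chain rule for the divergence of the joint law of message and outputs from the
product of the marginals. -/
lemma klDiv_messageLaw_succ {T : MessageChannel A B} (hT : MasseyCI Q T) (hM : 0 < M) {i : ℕ}
    (hi : i ≤ n) (q : Kernel (OutPast B i × A i) (B i)) [IsMarkovKernel q]
    (hq : Q.kern i = q.comap (letterStat i) (measurable_letterStat i)) :
    klDiv ((messageLaw μ Q g n).map (fun p => (p.1, outPast ((i + 1 : ℕ) : ℤ) p.2)))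
        ((messageUniform M).prod ((codeLaw μ T g n).map (outPast ((i + 1 : ℕ) : ℤ)))) =
      klDiv ((messageLaw μ Q g n).map (fun p => (p.1, outPast (i : ℤ) p.2)))
        ((messageUniform M).prod ((codeLaw μ T g n).map (outPast (i : ℤ)))) +
      condMutualInfo (codeLaw μ T g n) (fun x => x.1 i) (fun x => x.2 (i : ℤ))
        (outPast (i : ℤ)) := by
  set C := codeLaw μ T g n with hC
  set L := messageLaw μ Q g n with hL
  have hch : IsChannelLaw μ Q n C := isChannelLaw_codeLaw μ hT hM g n
  set k := condDistrib (fun x : Path A B => x.2 (i : ℤ)) (outPast (i : ℤ)) C with hk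
  have hsub : Set.Iio ((i + 1 : ℕ) : ℤ) ⊆ insert (i : ℤ) (Set.Iio (i : ℤ)) := by
    intro j hj
    simp only [Set.mem_Iio, Set.mem_insert_iff] at hj ⊢
    omega
  have hsub' : Set.Iio (i : ℤ) ⊆ Set.Iio ((i + 1 : ℕ) : ℤ) := Set.Iio_subset_Iio (by omega)
  have hmem : (i : ℤ) ∈ Set.Iio ((i + 1 : ℕ) : ℤ) := by simp
  let join : (Fin M × OutPast B i) × B i → Fin M × OutPast B ((i + 1 : ℕ) : ℤ) :=
    fun p => (p.1.1, joinOut hsub (p.1.2, p.2))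
  have hjoin : Measurable join := by fun_prop
  let split : Fin M × OutPast B ((i + 1 : ℕ) : ℤ) → (Fin M × OutPast B i) × B i :=
    fun p => ((p.1, Set.domRestrict₂ hsub' p.2), p.2 ⟨i, hmem⟩)
  have hsplit : Measurable split :=
    (measurable_fst.prodMk ((Set.measurable_restrict₂ hsub').comp measurable_snd)).prodMk
      ((measurable_pi_apply _).comp measurable_snd)
  -- Appending b_i to b^{i-1} loses nothing, so the divergence may be computed before joining.
  have hinv : Function.LeftInverse split join := by
    rintro ⟨⟨w, b⟩, z⟩
    obtain ⟨x, hx, -⟩ := exists_outOn_eq (A := A) 0 b (Classical.arbitrary _)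
    have hb : joinOut hsub (b, z) = outPast ((i + 1 : ℕ) : ℤ) (setOut i (x, z)) := by
      rw [outPast, ← joinOut_outOn hsub, setOut_snd_self, ← hx]
      exact congrArg (fun b => joinOut hsub (b, z)) (outPast_setOut le_rfl (x, z)).symm
    simp only [join, split, hb]
    refine Prod.ext (Prod.ext rfl ?_) (setOut_snd_self i (x, z))
    exact (outPast_setOut le_rfl (x, z)).trans hx
  have h1 : L.map (fun p => (p.1, outPast ((i + 1 : ℕ) : ℤ) p.2)) =
      (L.map (fun p => (p.1, outPast i p.2)) ⊗ₘ
        q.comap (g.letter i) (g.measurable_letter i)).map join := by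
    rw [← map_output_messageLaw μ g hi q hq, Measure.map_map hjoin (by fun_prop)]
    congr 1
    funext p
    exact congrArg (Prod.mk p.1) (joinOut_outOn hsub p.2).symm
  have hsucc : C.map (outPast ((i + 1 : ℕ) : ℤ)) =
      (C.map (outPast (i : ℤ)) ⊗ₘ k).map (joinOut hsub) := by
    rw [hk, compProd_map_condDistrib (by fun_prop), Measure.map_map (by fun_prop) (by fun_prop)]
    congr 1
    funext x
    exact (joinOut_outOn hsub x).symm
  have h2 : (messageUniform M).prod (C.map (outPast ((i + 1 : ℕ) : ℤ))) =
      ((messageUniform M).prod (C.map (outPast (i : ℤ))) ⊗ₘ k.prodMkLeft (Fin M)).map join := by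
    refine Measure.ext_of_lintegral _ fun f hf => ?_
    have hfj : Measurable fun p => f (join p) := hf.comp hjoin
    rw [lintegral_prod _ hf.aemeasurable, lintegral_map hf hjoin,
      Measure.lintegral_compProd hfj,
      lintegral_prod _ hfj.lintegral_kernel_prod_right'.aemeasurable]
    refine lintegral_congr fun w => ?_
    have hfw : Measurable fun b => f (w, b) := hf.comp measurable_prodMk_left
    have hfw' : Measurable fun p => f (w, joinOut hsub p) := hfw.comp (measurable_joinOut hsub)
    rw [hsucc, lintegral_map hfw (by fun_prop), Measure.lintegral_compProd hfw']
    rfl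
  have hprob := isProbabilityMeasure_messageUniform hM
  rw [h1, h2, klDiv_map_of_leftInverse hjoin hsplit hinv, klDiv_compProd_eq_add]
  congr 1
  -- The kernels with and without the message both factor through (b^{i-1}, a_i). The conditional
  -- term of the chain rule thus needs only the law of this pair, which is its law under the code.
  have h3 : k.prodMkLeft (Fin M) =
      (k.prodMkRight (A i)).comap (g.letter i) (g.measurable_letter i) := rfl
  rw [h3, klDiv_compProd_comap, ← map_letter_codeLaw μ g hT hi, condMutualInfo]
  congr 1
  exact (hch.map_output_of_comap hi (measurable_letterStat i) q hq).symm

/-- The steps telescope from zero, because the message is independent of the initial data. -/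
lemma klDiv_messageLaw {T : MessageChannel A B} (hT : MasseyCI Q T) (hM : 0 < M)
    {γ : Cost A B} {S : ℕ → Set ℤ} (hC : IsCompatible Q γ S) {m : ℕ} (hm : m ≤ n + 1) :
    klDiv ((messageLaw μ Q g n).map (fun p => (p.1, outPast (m : ℤ) p.2)))
        ((messageUniform M).prod ((codeLaw μ T g n).map (outPast (m : ℤ)))) =
      ∑ i ∈ Finset.range m, condMutualInfo (codeLaw μ T g n) (fun x => x.1 i)
        (fun x => x.2 (i : ℤ)) (outPast (i : ℤ)) := by
  induction m with
  | zero =>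
    have h0 : (messageLaw μ Q g n).map (fun p => (p.1, outPast ((0 : ℕ) : ℤ) p.2)) =
        (messageUniform M).prod ((codeLaw μ T g n).map (outPast ((0 : ℕ) : ℤ))) := by
      have h1 : (codeLaw μ T g n).map (outPast ((0 : ℕ) : ℤ)) = μ :=
        (isChannelLaw_codeLaw μ hT hM g n).map_outPast_zero
      rw [h1]
      refine Measure.ext_of_lintegral _ fun f hf => ?_
      rw [lintegral_map hf (by fun_prop), lintegral_messageLaw μ Q g (by fun_prop),
        lintegral_prod _ hf.aemeasurable, lintegral_messageUniform]
      congr 1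
      refine Finset.sum_congr rfl fun w _ => ?_
      have h2 : (jointLaw μ Q (g.policy w) n).map (outPast ((0 : ℕ) : ℤ)) = μ :=
        (isChannelLaw_jointLaw μ Q (g.policy w) n).map_outPast_zero
      have hfw : Measurable fun b => f (w, b) := hf.comp measurable_prodMk_left
      conv_rhs => rw [← h2]
      rw [lintegral_map hfw (by fun_prop)]
    have := isProbabilityMeasure_messageUniform hM
    have := (isChannelLaw_codeLaw μ hT hM g n).isProbabilityMeasure
    rw [h0, Finset.sum_range_zero]
    exact klDiv_self _
  | succ i ih =>
    obtain ⟨q, _, hq⟩ := hC.exists_kern_eq_comap i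
    rw [klDiv_messageLaw_succ μ g hT hM (by omega)
      (q.comap (restrictPast hC.subset i) (measurable_restrictPast hC.subset i)) hq,
      ih (by omega), Finset.sum_range_succ]

/-- Fano's inequality for feedback codes. -/
lemma one_sub_mul_log_le_perLetterInfo {T : MessageChannel A B} (hT : MasseyCI Q T)
    (hM : 0 < M) {γ : Cost A B} {S : ℕ → Set ℤ} (hC : IsCompatible Q γ S)
    {d : OutUpTo B n → Fin M} (hd : Measurable d) {ε : ℝ≥0} (hε : errorProb μ T g n d ≤ ε)
    (hfin : perLetterInfo (codeLaw μ T g n) n ≠ ∞) :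
    (1 - ε) * Real.log M ≤ (perLetterInfo (codeLaw μ T g n) n).toReal + Real.log 2 := by
  have hkl : klDiv ((messageLaw μ Q g n).map (fun p => (p.1, outPast ((n + 1 : ℕ) : ℤ) p.2)))
        ((messageUniform M).prod ((codeLaw μ T g n).map (outPast ((n + 1 : ℕ) : ℤ)))) =
      perLetterInfo (codeLaw μ T g n) n := klDiv_messageLaw μ g hT hM hC le_rfl
  have hprob := isProbabilityMeasure_messageUniform hM
  have hprob' := isProbabilityMeasure_messageLaw μ Q g (n := n) hM
  have hprob'' := isProbabilityMeasure_codeLaw μ T hM g n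
  -- The decoder sees b^n, which is the past of time n + 1.
  have hsub : Set.Iic (n : ℤ) ⊆ Set.Iio ((n + 1 : ℕ) : ℤ) := by
    intro j hj
    simp only [Set.mem_Iic, Set.mem_Iio] at hj ⊢
    omega
  let d' : OutPast B ((n + 1 : ℕ) : ℤ) → Fin M := fun b => d (Set.domRestrict₂ hsub b)
  have hd' : Measurable d' := hd.comp (Set.measurable_restrict₂ hsub)
  let D : Set (Fin M × OutPast B ((n + 1 : ℕ) : ℤ)) := {p | d' p.2 = p.1}
  have hD : MeasurableSet D := measurableSet_eq_fun (hd'.comp measurable_snd) measurable_fst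
  have hpm : Measurable fun p : Fin M × Path A B => (p.1, outPast ((n + 1 : ℕ) : ℤ) p.2) := by
    fun_prop
  have := Measure.isProbabilityMeasure_map (μ := messageLaw μ Q g n) hpm.aemeasurable
  have := Measure.isProbabilityMeasure_map (μ := codeLaw μ T g n)
    (measurable_outPast ((n + 1 : ℕ) : ℤ)).aemeasurable
  -- Under the product law the outputs carry no information on the uniform message, so any decoder
  -- is right with probability exactly 1/M.
  have hR : ((messageUniform M).prod
      ((codeLaw μ T g n).map (outPast ((n + 1 : ℕ) : ℤ)))) D = (M : ℝ≥0∞)⁻¹ := by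
    rw [Measure.prod_apply_symm hD]
    have h1 (b : OutPast B ((n + 1 : ℕ) : ℤ)) :
        messageUniform M ((fun w => (w, b)) ⁻¹' D) = (M : ℝ≥0∞)⁻¹ := by
      have : (fun w => (w, b)) ⁻¹' D = {d' b} := by
        ext w
        simp [D, eq_comm]
      rw [this]
      simp [messageUniform]
    rw [lintegral_congr h1, lintegral_const, measure_univ, mul_one]
  have hE : ((messageLaw μ Q g n).map (fun p => (p.1, outPast ((n + 1 : ℕ) : ℤ) p.2))) Dᶜ ≤ ε := by
    refine le_trans (le_of_eq ?_) hε
    rw [← lintegral_indicator_one hD.compl, lintegral_map (by fun_prop (disch := exact hD.compl))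
      hpm, lintegral_messageLaw μ Q g (by fun_prop (disch := exact hD.compl)), errorProb]
    congr 1
    refine Finset.sum_congr rfl fun w _ => ?_
    rw [hT.eq, ← lintegral_indicator_one]
    · refine lintegral_congr fun x => ?_
      rfl
    · exact (hd.comp (measurable_outUpTo n)) (measurableSet_singleton w).compl
  have hP : 1 - (ε : ℝ) ≤
      ((messageLaw μ Q g n).map (fun p => (p.1, outPast ((n + 1 : ℕ) : ℤ) p.2))).real D := by
    have h1 := probReal_add_probReal_compl
      (μ := (messageLaw μ Q g n).map (fun p => (p.1, outPast ((n + 1 : ℕ) : ℤ) p.2))) hD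
    have h2 : ((messageLaw μ Q g n).map
        (fun p => (p.1, outPast ((n + 1 : ℕ) : ℤ) p.2))).real Dᶜ ≤ ε :=
      ENNReal.toReal_le_coe_of_le_coe hE
    linarith
  have hfano := measureReal_mul_log_le_klDiv
    ((messageLaw μ Q g n).map (fun p => (p.1, outPast ((n + 1 : ℕ) : ℤ) p.2)))
    ((messageUniform M).prod ((codeLaw μ T g n).map (outPast ((n + 1 : ℕ) : ℤ))))
    (by rwa [hkl]) hD hM (by rw [measureReal_def, hR]; simp)
  rw [hkl] at hfano
  refine le_trans (mul_le_mul_of_nonneg_right hP (Real.log_natCast_nonneg M)) hfano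

end Fano

end FeedbackCoding

namespace FeedbackCoding

universe u v

/-! ### The converse: passage to the limit in Fano's inequality. -/

section Converse

lemma lt_ofReal_of_coe_lt_coe {x : ℝ≥0∞} {r : ℝ} (h : (x : EReal) < (r : EReal)) :
    0 < r ∧ x < ENNReal.ofReal r := by
  have hr : 0 < r := by
    have := (EReal.coe_ennreal_nonneg x).trans_lt h
    exact_mod_cast this
  refine ⟨hr, ?_⟩
  rw [← EReal.coe_ennreal_lt_coe_ennreal_iff, EReal.coe_ennreal_ofReal, max_eq_left hr.le]
  exact h

/-- If `(1 - ε_n) a_n ≤ b_n + δ_n` with `ε_n, δ_n → 0`, then `liminf a_n ≤ liminf b_n`. -/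
lemma liminf_coe_le_liminf_coe {a : ℕ → ℝ} {b : ℕ → ℝ≥0∞} {ε : ℕ → ℝ≥0} {δ : ℕ → ℝ}
    (hε : Tendsto ε atTop (𝓝 0)) (hδ : Tendsto δ atTop (𝓝 0))
    (h : ∀ n, b n ≠ ∞ → (1 - ε n) * a n ≤ (b n).toReal + δ n) :
    liminf (fun n => (a n : EReal)) atTop ≤ ((liminf b atTop : ℝ≥0∞) : EReal) := by
  by_contra! hlt
  -- Two levels r < s separate the limits: b_n < r infinitely often, in particular with b_n finite,
  -- while a_n > s eventually. The gap s - r absorbs ε_n and δ_n.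
  obtain ⟨r, hbr, hra⟩ := EReal.lt_iff_exists_real_btwn.mp hlt
  obtain ⟨s, hrs, hsa⟩ := EReal.lt_iff_exists_real_btwn.mp hra
  obtain ⟨hr, hbr'⟩ := lt_ofReal_of_coe_lt_coe hbr
  have hrs' : r < s := by exact_mod_cast hrs
  have h1 : ∃ᶠ n in atTop, b n < ENNReal.ofReal r := frequently_lt_of_liminf_lt (by isBoundedDefault) hbr'
  have h2 : ∀ᶠ n in atTop, (s : EReal) < a n := eventually_lt_of_lt_liminf hsa
  have hε' : Tendsto (fun n => (ε n : ℝ)) atTop (𝓝 0) := by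
    simpa using NNReal.tendsto_coe.mpr hε
  have h3 : ∀ᶠ n in atTop, 0 < (1 - ε n) * s - (r + δ n) := by
    have : Tendsto (fun n => (1 - (ε n : ℝ)) * s - (r + δ n)) atTop
        (𝓝 ((1 - 0) * s - (r + 0))) :=
      ((hε'.const_sub 1).mul_const s).sub (hδ.const_add r)
    refine this.eventually (lt_mem_nhds ?_)
    linarith
  have h4 : ∀ᶠ n in atTop, (ε n : ℝ) < 1 := hε'.eventually (gt_mem_nhds one_pos)
  obtain ⟨n, hn1, hn2, hn3, hn4⟩ := (h1.and_eventually (h2.and (h3.and h4))).exists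
  have hfin : b n ≠ ∞ := (hn1.trans ENNReal.ofReal_lt_top).ne
  have hb : (b n).toReal < r := by
    rwa [← ENNReal.ofReal_lt_ofReal_iff hr, ENNReal.ofReal_toReal hfin]
  have hs : s < a n := by exact_mod_cast hn2
  have := h n hfin
  nlinarith [mul_lt_mul_of_pos_left hs (sub_pos.mpr hn4)]

variable {A : ℕ → Type u} {B : ℤ → Type v}
  [∀ i, MeasurableSpace (A i)] [∀ i, StandardBorelSpace (A i)] [∀ i, Nonempty (A i)]
  [∀ j, MeasurableSpace (B j)] [∀ j, StandardBorelSpace (B j)] [∀ j, Nonempty (B j)]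
  {μ : Measure (OutPast B 0)} [IsProbabilityMeasure μ] {Q : Channel A B} {γ : Cost A B}
  {S : ℕ → Set ℤ}

lemma IsCompatible.liminfRate_le (hC : IsCompatible Q γ S) {T : MessageChannel A B}
    (hT : MasseyCI Q T) {κ : ℝ≥0} {M : ℕ → ℕ} {ε : ℕ → ℝ≥0}
    (h : IsCodeSequence μ T γ κ M ε) :
    liminfRate M ≤
      ((liminf (fun n => encoderInfoRate μ T γ κ n (M n)) atTop : ℝ≥0∞) : EReal) := by
  refine liminf_coe_le_liminf_coe (δ := fun n : ℕ => 1 / ((n : ℝ) + 1) * Real.log 2) h.2 ?_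
    fun n hn => ?_
  · simpa using (tendsto_one_div_add_atTop_nhds_zero_nat (𝕜 := ℝ)).mul_const (Real.log 2)
  · obtain ⟨hM, ⟨c⟩⟩ := h.1 n
    have hn0 : ((n : ℝ≥0∞) + 1) ≠ 0 := by simp
    have hn1 : ((n : ℝ≥0∞) + 1) ≠ ∞ := by finiteness
    have hle : ((n : ℝ≥0∞) + 1)⁻¹ * perLetterInfo (codeLaw μ T c.enc n) n ≤
        encoderInfoRate μ T γ κ n (M n) :=
      le_iSup₂ (f := fun g (_ : g ∈ encodersWithCost μ T γ κ n (M n)) =>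
        ((n : ℝ≥0∞) + 1)⁻¹ * perLetterInfo (codeLaw μ T g n) n) c.enc c.enc_mem
    have hfin : perLetterInfo (codeLaw μ T c.enc n) n ≠ ∞ := by
      intro htop
      rw [htop, ENNReal.mul_top (ENNReal.inv_ne_zero.mpr hn1), top_le_iff] at hle
      exact hn hle
    have hfano := one_sub_mul_log_le_perLetterInfo μ c.enc hT hM hC c.dec_meas c.error_le hfin
    have hle' := ENNReal.toReal_mono hn hle
    rw [ENNReal.toReal_mul, ENNReal.toReal_inv, ENNReal.toReal_add (by finiteness) (by finiteness),
      ENNReal.toReal_natCast, ENNReal.toReal_one] at hle'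
    have hpos : (0 : ℝ) < 1 / ((n : ℝ) + 1) := by positivity
    have := mul_le_mul_of_nonneg_left hfano hpos.le
    rw [inv_eq_one_div] at hle'
    linarith

lemma IsCompatible.encoderInfoRate_le (hC : IsCompatible Q γ S) {T : MessageChannel A B}
    (hT : MasseyCI Q T) {κ : ℝ≥0} {M : ℕ} (hM : 0 < M) (n : ℕ) :
    encoderInfoRate μ T γ κ n M ≤ charCapacityRate μ Q γ κ S n :=
  iSup₂_le fun g hg => hC.perLetterInfo_le_charCapacityRate (isChannelLaw_codeLaw μ hT hM g n) hg

lemma IsCompatible.liminf_charCapacityRate_eq (hC : IsCompatible Q γ S) (κ : ℝ≥0) :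
    liminf (fun n => charCapacityRate μ Q γ κ S n) atTop = ftfiRate μ Q γ κ := by
  simp only [hC.charCapacityRate_eq, ftfiRate]

end Converse

end FeedbackCoding

namespace FeedbackCoding

/-! ### Choice of error levels, decoders, low-cost strategies and code words. -/

section CodeSelection

/-- The infimum of the admissible levels tends to 0. Adding 1/(n + 1) puts the level strictly above
the infimum, hence by monotonicity among the admissible ones. -/
lemma exists_tendsto_zero_of_eventually {p : ℕ → ℝ≥0 → Prop} (hne : ∀ n, ∃ δ, p n δ)
    (hmono : ∀ n δ δ', δ ≤ δ' → p n δ → p n δ') (h : ∀ δ, 0 < δ → ∀ᶠ n in atTop, p n δ) :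
    ∃ ε : ℕ → ℝ≥0, Tendsto ε atTop (𝓝 0) ∧ ∀ n, p n (ε n) := by
  refine ⟨fun n => sInf {δ | p n δ} + ((n : ℝ≥0) + 1)⁻¹, ?_, fun n => ?_⟩
  · have h1 : Tendsto (fun n : ℕ => sInf {δ | p n δ}) atTop (𝓝 0) := by
      refine tendsto_order.mpr ⟨fun a ha => absurd ha not_lt_zero, fun a ha => ?_⟩
      obtain ⟨b, hb, hba⟩ := exists_between ha
      filter_upwards [h b hb] with n hn
      exact (csInf_le (OrderBot.bddBelow _) hn).trans_lt hba
    have h2 : Tendsto (fun n : ℕ => ((n : ℝ≥0) + 1)⁻¹) atTop (𝓝 0) := by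
      simpa [one_div] using tendsto_one_div_add_atTop_nhds_zero_nat (𝕜 := ℝ≥0)
    simpa using h1.add h2
  · obtain ⟨δ, hδ, hlt⟩ := exists_lt_of_csInf_lt (s := {δ | p n δ}) (hne n)
      (lt_add_of_pos_right (sInf {δ | p n δ}) (by positivity : (0 : ℝ≥0) < ((n : ℝ≥0) + 1)⁻¹))
    exact hmono n δ _ hlt.le hδ

/-- Outputs outside all the sets are sent to message 0, which keeps the decoder measurable. -/
lemma exists_measurable_decoder {Y : Type*} [MeasurableSpace Y] {M : ℕ} (hM : 0 < M)
    {E : Fin M → Set Y} (hE : ∀ w, MeasurableSet (E w)) (hdisj : Pairwise (Function.onFun Disjoint E)) :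
    ∃ d : Y → Fin M, Measurable d ∧ ∀ w, ∀ y ∈ E w, d y = w := by
  classical
  let d : Y → Fin M := fun y => if h : ∃ w, y ∈ E w then h.choose else ⟨0, hM⟩
  have hd (w : Fin M) (y : Y) (hy : y ∈ E w) : d y = w := by
    have h : ∃ w, y ∈ E w := ⟨w, hy⟩
    simp only [d, dif_pos h]
    by_contra hne
    exact Set.disjoint_left.mp (hdisj hne) h.choose_spec hy
  refine ⟨d, measurable_to_countable' fun w => ?_, hd⟩
  have hpre : d ⁻¹' {w} = E w ∪ (if w = ⟨0, hM⟩ then (⋃ v, E v)ᶜ else ∅) := by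
    ext y
    by_cases h : ∃ v, y ∈ E v
    · obtain ⟨v, hv⟩ := h
      have hU : y ∈ ⋃ v, E v := Set.mem_iUnion.mpr ⟨v, hv⟩
      have : y ∉ (if w = ⟨0, hM⟩ then (⋃ v, E v)ᶜ else ∅) := by
        split_ifs
        · exact fun h => h hU
        · exact Set.notMem_empty y
      simp only [Set.mem_preimage, Set.mem_singleton_iff, Set.mem_union, this, or_false, hd v y hv]
      exact ⟨fun hvw => hvw ▸ hv, fun hw => by rw [← hd v y hv, hd w y hw]⟩
    · have hU : y ∉ ⋃ v, E v := by simpa using h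
      have hd0 : d y = ⟨0, hM⟩ := by simp only [d, dif_neg h]
      have hw : y ∉ E w := fun hw => h ⟨w, hw⟩
      simp only [Set.mem_preimage, Set.mem_singleton_iff, Set.mem_union, hd0, hw, false_or]
      by_cases hw0 : w = ⟨0, hM⟩
      · simp only [hw0, if_true, true_iff]
        exact hU
      · simp only [hw0, if_false, Set.mem_empty_iff_false, iff_false]
        exact fun h => hw0 h.symm
  rw [hpre]
  refine (hE w).union ?_
  split_ifs
  · exact (MeasurableSet.iUnion hE).compl
  · exact MeasurableSet.empty

/-- If a cost has mean at most `κ`, then some point has a cost at most halfway between its infimum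
and `κ`, and the cost exceeds `κ` only slightly (on this scale) on a set that is not too small. -/
lemma exists_lowCost_set {U : Type*} [MeasurableSpace U] (lam : Measure U)
    [IsProbabilityMeasure lam] {c : U → ℝ≥0∞} (hc : Measurable c) {κ : ℝ≥0}
    (h : ∫⁻ u, c u ∂lam ≤ κ) {s : ℝ≥0} (hs : 0 < s) :
    ∃ (F : Set U) (u₀ : U) (m y : ℝ≥0), MeasurableSet F ∧ m + y = κ ∧
      ((s / (1 + s) : ℝ≥0) : ℝ≥0∞) ≤ lam F ∧
      (∀ u ∈ F, c u ≤ ((m + y * (1 + s) : ℝ≥0) : ℝ≥0∞)) ∧ c u₀ ≤ ((m + y / 2 : ℝ≥0) : ℝ≥0∞) := by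
  have hmle : ⨅ u, c u ≤ κ := by
    refine le_trans ?_ h
    calc ⨅ u, c u = ∫⁻ _, ⨅ u, c u ∂lam := by simp
      _ ≤ ∫⁻ u, c u ∂lam := lintegral_mono fun u => iInf_le c u
  obtain ⟨m, hm⟩ : ∃ m : ℝ≥0, (m : ℝ≥0∞) = ⨅ u, c u :=
    ⟨_, ENNReal.coe_toNNReal (ne_top_of_le_ne_top ENNReal.coe_ne_top hmle)⟩
  rw [← hm, ENNReal.coe_le_coe] at hmle
  have hmc (u : U) : (m : ℝ≥0∞) ≤ c u := hm ▸ iInf_le c u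
  obtain ⟨y, hy⟩ := exists_add_of_le hmle
  -- The excess over the infimum m is nonnegative with mean at most y = κ - m. Markov's inequality
  -- at level y(1 + s) leaves a set of probability at least 1 - 1/(1 + s) = s/(1 + s).
  have hexc : ∫⁻ u, (c u - m) ∂lam ≤ y := by
    rw [lintegral_sub measurable_const (by simp) (Eventually.of_forall hmc)]
    simp only [lintegral_const, measure_univ, mul_one]
    rw [tsub_le_iff_left]
    exact_mod_cast hy ▸ h
  have hF : MeasurableSet {u | c u ≤ ((m + y * (1 + s) : ℝ≥0) : ℝ≥0∞)} :=
    measurableSet_le hc measurable_const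
  have hs1 : s / (1 + s) ≤ 1 := by
    rw [div_le_one (by positivity)]
    exact le_add_of_nonneg_left zero_le_one
  have hsmall : ((s / (1 + s) : ℝ≥0) : ℝ≥0∞) ≤
      lam {u | c u ≤ ((m + y * (1 + s) : ℝ≥0) : ℝ≥0∞)} := by
    rcases eq_or_ne y 0 with hy0 | hy0
    · have h0 : ∀ᵐ u ∂lam, c u - m = 0 := by
        rw [hy0] at hexc
        exact (lintegral_eq_zero_iff (hc.sub_const _)).mp (le_antisymm (by simpa using hexc) bot_le)
      have h1 : lam {u | c u ≤ ((m + y * (1 + s) : ℝ≥0) : ℝ≥0∞)} = 1 := by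
        rw [prob_compl_eq_zero_iff hF |>.symm]
        refine measure_eq_zero_iff_ae_notMem.mpr ?_
        filter_upwards [h0] with u hu
        simpa [hy0] using tsub_eq_zero_iff_le.mp hu
      rw [h1]
      exact_mod_cast hs1
    · have hmark := mul_meas_ge_le_lintegral₀ (μ := lam) (hc.sub_const (m : ℝ≥0∞)).aemeasurable
        ((y * (1 + s) : ℝ≥0) : ℝ≥0∞)
      have hsub : {u | c u ≤ ((m + y * (1 + s) : ℝ≥0) : ℝ≥0∞)}ᶜ ⊆
          {u | ((y * (1 + s) : ℝ≥0) : ℝ≥0∞) ≤ c u - m} := by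
        intro u hu
        simp only [Set.mem_compl_iff, Set.mem_ofPred_eq, not_le] at hu ⊢
        refine ENNReal.le_sub_of_add_le_left ENNReal.coe_ne_top ?_
        exact_mod_cast hu.le
      have h1 : ((y * (1 + s) : ℝ≥0) : ℝ≥0∞) *
          lam {u | c u ≤ ((m + y * (1 + s) : ℝ≥0) : ℝ≥0∞)}ᶜ ≤ y :=
        (mul_le_mul_right (measure_mono hsub) _).trans (hmark.trans hexc)
      have h2 := ENNReal.toReal_mono ENNReal.coe_ne_top h1
      rw [ENNReal.toReal_mul, ENNReal.coe_toReal, ENNReal.coe_toReal, ← measureReal_def,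
        probReal_compl_eq_one_sub hF] at h2
      have hy' : (0 : ℝ) < y := by exact_mod_cast pos_iff_ne_zero.mpr hy0
      have h3 : ((s / (1 + s) : ℝ≥0) : ℝ) ≤
          lam.real {u | c u ≤ ((m + y * (1 + s) : ℝ≥0) : ℝ≥0∞)} := by
        generalize lam.real {u | c u ≤ ((m + y * (1 + s) : ℝ≥0) : ℝ≥0∞)} = t at h2 ⊢
        push_cast at h2 ⊢
        rw [div_le_iff₀ (by positivity)]
        have h4 : (1 + (s : ℝ)) * (1 - t) ≤ 1 :=
          le_of_mul_le_mul_left (by linarith) hy'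
        linarith
      rw [← ENNReal.ofReal_coe_nnreal]
      exact ENNReal.ofReal_le_of_le_toReal h3
  have hFne : {u | c u ≤ ((m + y * (1 + s) : ℝ≥0) : ℝ≥0∞)}.Nonempty := by
    refine nonempty_of_measure_ne_zero (μ := lam) (ne_of_gt (lt_of_lt_of_le ?_ hsmall))
    exact_mod_cast (by positivity : 0 < s / (1 + s))
  -- For y > 0 the level lies strictly above the infimum. For y = 0 the infimum must be attained,
  -- and any point of the nonempty set F attains it.
  obtain ⟨u₀, hu₀⟩ : ∃ u₀, c u₀ ≤ ((m + y / 2 : ℝ≥0) : ℝ≥0∞) := by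
    rcases eq_or_ne y 0 with hy0 | hy0
    · obtain ⟨u, hu⟩ := hFne
      exact ⟨u, by simpa [hy0] using hu⟩
    · have : ⨅ u, c u < ((m + y / 2 : ℝ≥0) : ℝ≥0∞) := by
        rw [← hm, ENNReal.coe_lt_coe]
        exact lt_add_of_pos_right _ (by positivity)
      obtain ⟨u, hu⟩ := iInf_lt_iff.mp this
      exact ⟨u, hu.le⟩
  exact ⟨_, u₀, m, y, hF, hy.symm, hsmall, fun u hu => hu, hu₀⟩

/-- Feinstein's lemma, in a form in which the code words are selected from a prescribed set `F`. -/
lemma exists_maximal_code {U X Y : Type*} [MeasurableSpace U] [MeasurableSpace X]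
    [MeasurableSpace Y] (lam : Measure U) [IsProbabilityMeasure lam] (K : Kernel U X)
    [IsMarkovKernel K] {O : X → Y} (hO : Measurable O) {T : Set X} (hT : MeasurableSet T)
    {D : U → Set Y} (hD : ∀ u, MeasurableSet (D u)) (hTD : ∀ u, K u (T \ O ⁻¹' D u) = 0)
    {η : ℝ≥0∞} (hη : ∀ u, ∫⁻ v, K v (O ⁻¹' D u) ∂lam ≤ η) {F : Set U} (hF : MeasurableSet F)
    {ε : ℝ≥0∞} {k : ℕ} (hk : k * η + ∫⁻ v, K v Tᶜ ∂lam < ε * lam F) :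
    ∃ (c : ℕ → U) (E : ℕ → Set Y), (∀ j, MeasurableSet (E j)) ∧
      Pairwise (Function.onFun Disjoint E) ∧
      ∀ j < k, c j ∈ F ∧ K (c j) (O ⁻¹' E j)ᶜ ≤ ε := by
  classical
  -- Code words are added one at a time; the sets with index at least l are empty placeholders.
  -- Containment of each E j in D (c j) bounds the mean probability of the region already used by l
  -- η.
  suffices h : ∀ l ≤ k, ∃ (c : ℕ → U) (E : ℕ → Set Y), (∀ j, MeasurableSet (E j)) ∧
      Pairwise (Function.onFun Disjoint E) ∧ (∀ j, l ≤ j → E j = ∅) ∧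
      ∀ j < l, c j ∈ F ∧ K (c j) (O ⁻¹' E j)ᶜ ≤ ε ∧ E j ⊆ D (c j) by
    obtain ⟨c, E, h1, h2, -, h3⟩ := h k le_rfl
    exact ⟨c, E, h1, h2, fun j hj => ⟨(h3 j hj).1, (h3 j hj).2.1⟩⟩
  intro l
  induction l with
  | zero =>
    intro _
    obtain ⟨u⟩ : Nonempty U := nonempty_of_isProbabilityMeasure lam
    exact ⟨fun _ => u, fun _ => ∅, by simp, fun i j _ => by simp [Function.onFun], by simp, by simp⟩
  | succ l ih =>
    intro hl
    obtain ⟨c, E, hE, hdisj, hempty, hc⟩ := ih (Nat.le_of_succ_le hl)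
    have hV : MeasurableSet (⋃ j, E j) := MeasurableSet.iUnion hE
    have hVint : ∫⁻ v, K v (O ⁻¹' ⋃ j, E j) ∂lam ≤ k * η := by
      have hsub : O ⁻¹' (⋃ j, E j) ⊆ ⋃ j ∈ Finset.range l, O ⁻¹' D (c j) := by
        intro x hx
        obtain ⟨j, hj⟩ := Set.mem_iUnion.mp hx
        have hjl : j < l := by
          by_contra hjl
          simp [hempty j (not_lt.mp hjl)] at hj
        exact Set.mem_biUnion (Finset.mem_coe.mpr (Finset.mem_range.mpr hjl)) ((hc j hjl).2.2 hj)
      calc ∫⁻ v, K v (O ⁻¹' ⋃ j, E j) ∂lam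
          ≤ ∫⁻ v, ∑ j ∈ Finset.range l, K v (O ⁻¹' D (c j)) ∂lam :=
            lintegral_mono fun v => (measure_mono hsub).trans (measure_biUnion_finset_le _ _)
        _ = ∑ j ∈ Finset.range l, ∫⁻ v, K v (O ⁻¹' D (c j)) ∂lam :=
            lintegral_finsetSum _ fun j _ => Kernel.measurable_coe K (hO (hD _))
        _ ≤ ∑ _j ∈ Finset.range l, η := Finset.sum_le_sum fun j _ => hη _
        _ = l * η := by simp
        _ ≤ k * η := by gcongr; exact Nat.le_of_succ_le hl
    -- If no point of F could be added, then at each of them leaving T or hitting the used region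
    -- would have total probability at least ε. Integrating over F contradicts `hk`.
    obtain ⟨u, huF, hu⟩ : ∃ u ∈ F, K u (O ⁻¹' (D u \ ⋃ j, E j))ᶜ ≤ ε := by
      by_contra! hcon
      have hlt : ∀ u ∈ F, ε ≤ K u Tᶜ + K u (O ⁻¹' ⋃ j, E j) := by
        intro u hu
        have hsub : (O ⁻¹' (D u \ ⋃ j, E j))ᶜ ⊆
            (Tᶜ ∪ O ⁻¹' ⋃ j, E j) ∪ (T \ O ⁻¹' D u) := by
          intro x hx
          by_cases hxT : x ∈ T <;> by_cases hxD : O x ∈ D u <;>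
            by_cases hxE : O x ∈ ⋃ j, E j <;> simp_all
        calc ε ≤ K u (O ⁻¹' (D u \ ⋃ j, E j))ᶜ := (hcon u hu).le
          _ ≤ K u (Tᶜ ∪ O ⁻¹' ⋃ j, E j) + K u (T \ O ⁻¹' D u) :=
            (measure_mono hsub).trans (measure_union_le _ _)
          _ ≤ K u Tᶜ + K u (O ⁻¹' ⋃ j, E j) := by
            rw [hTD, add_zero]
            exact measure_union_le _ _
      have : ε * lam F ≤ k * η + ∫⁻ v, K v Tᶜ ∂lam := by
        calc ε * lam F = ∫⁻ _ in F, ε ∂lam := by simp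
          _ ≤ ∫⁻ u in F, (K u Tᶜ + K u (O ⁻¹' ⋃ j, E j)) ∂lam := setLIntegral_mono' hF hlt
          _ ≤ ∫⁻ u, (K u Tᶜ + K u (O ⁻¹' ⋃ j, E j)) ∂lam := setLIntegral_le_lintegral _ _
          _ = ∫⁻ u, K u Tᶜ ∂lam + ∫⁻ u, K u (O ⁻¹' ⋃ j, E j) ∂lam :=
            lintegral_add_left (Kernel.measurable_coe K hT.compl) _
          _ ≤ k * η + ∫⁻ v, K v Tᶜ ∂lam := by
            rw [add_comm]
            gcongr
      exact absurd hk (not_lt.mpr this)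
    refine ⟨Function.update c l u, Function.update E l (D u \ ⋃ j, E j), fun j => ?_, ?_,
      fun j hj => ?_, fun j hj => ?_⟩
    · by_cases hj : j = l
      · subst hj
        simpa using (hD u).diff hV
      · simpa [hj] using hE j
    · have hdl (j : ℕ) : Disjoint (E j) (D u \ ⋃ j, E j) :=
        Set.disjoint_sdiff_right.mono_left (Set.subset_iUnion E j)
      intro i j hij
      by_cases hi : i = l
      · have hj : j ≠ l := fun h => hij (hi.trans h.symm)
        simpa [Function.onFun, hi, hj] using (hdl j).symm
      · by_cases hj : j = l
        · simpa [Function.onFun, hi, hj] using hdl i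
        · simpa [Function.onFun, hi, hj] using hdisj hij
    · rw [Function.update_of_ne (by omega), hempty j (by omega)]
    · by_cases hjl : j = l
      · subst hjl
        simp only [Function.update_self]
        exact ⟨huF, hu, Set.sdiff_subset⟩
      · simp only [ne_eq, hjl, not_false_eq_true, Function.update_of_ne]
        exact hc j (by omega)

end CodeSelection

end FeedbackCoding

namespace FeedbackCoding

universe u v

/-! ### Input distributions as mixtures of deterministic feedback strategies. -/

section RandomStrategies

open unitInterval

variable {A : ℕ → Type u} {B : ℤ → Type v}
  [∀ i, MeasurableSpace (A i)] [∀ i, Nonempty (A i)]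
  [∀ j, MeasurableSpace (B j)] [∀ j, Nonempty (B j)]
  (μ : Measure (OutPast B 0)) (Q : Channel A B)

lemma lawUpTo_congr {P P' : Policy A B} {m : ℕ} (h : ∀ k < m, P.kern k = P'.kern k) :
    lawUpTo μ Q P m = lawUpTo μ Q P' m := by
  induction m with
  | zero => rfl
  | succ m ih =>
    have hm : P.onPath m = P'.onPath m := by simp only [Policy.onPath, h m m.lt_succ_self]
    rw [lawUpTo, lawUpTo, ih fun k hk => h k (hk.trans m.lt_succ_self), hm]

/-- Replace the encoding map at time `m`. -/
noncomputable def Encoder.updateAt {M : ℕ} (g : Encoder A B M) (m : ℕ)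
    (f : OutPast B m → A m) (hf : Measurable f) : Encoder A B M where
  map := Function.update g.map m fun _ => f
  meas i w := by
    by_cases h : i = m
    · subst h
      simpa using hf
    · simpa [h] using g.meas i w

omit [∀ i, Nonempty (A i)] [∀ j, Nonempty (B j)] in
lemma Encoder.updateAt_map_self {M : ℕ} (g : Encoder A B M) (m : ℕ) (f : OutPast B m → A m)
    (hf : Measurable f) (w : Fin M) : (g.updateAt m f hf).map m w = f := by
  simp [Encoder.updateAt]

omit [∀ i, Nonempty (A i)] [∀ j, Nonempty (B j)] in
lemma Encoder.policy_updateAt_of_ne {M : ℕ} (g : Encoder A B M) {m k : ℕ} (f : OutPast B m → A m)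
    (hf : Measurable f) (w : Fin M) (h : k ≠ m) :
    ((g.updateAt m f hf).policy w).kern k = (g.policy w).kern k := by
  simp [Encoder.policy, Encoder.updateAt, h]

variable [IsProbabilityMeasure μ]

lemma Encoder.lintegral_lawUpTo_succ {M : ℕ} (g : Encoder A B M) (w : Fin M) (m : ℕ)
    {f : Path A B → ℝ≥0∞} (hf : Measurable f) :
    ∫⁻ x, f x ∂(lawUpTo μ Q (g.policy w) (m + 1)) =
      ∫⁻ x, ∫⁻ b, f (setOut m (setIn m (x, g.map m w (outPast m x)), b))
        ∂(Q.onPath m (setIn m (x, g.map m w (outPast m x)))) ∂(lawUpTo μ Q (g.policy w) m) := by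
  rw [FeedbackCoding.lintegral_lawUpTo_succ μ Q _ m hf]
  refine lintegral_congr fun x => ?_
  have hG : Measurable fun a : A m => ∫⁻ b, f (setOut m (setIn m (x, a), b))
      ∂(Q.onPath m (setIn m (x, a))) := by
    have h1 : Measurable fun p : Path A B × B m => f (setOut m p) := hf.comp (measurable_setOut m)
    exact h1.lintegral_kernel_prod_right'.comp ((measurable_setIn m).comp measurable_prodMk_left)
  have h2 : (g.policy w).onPath m x = Measure.dirac (g.map m w (outPast m x)) := by
    simp only [Policy.onPath, Encoder.policy, Kernel.comap_apply]
    rw [Kernel.deterministic_apply]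
  rw [h2, lintegral_dirac' _ hG]

/-- A feedback policy is a mixture of feedback strategies. -/
lemma exists_random_encoder [∀ i, StandardBorelSpace (A i)] {P : Policy A B} {S : ℕ → Set ℤ}
    (hP : P.HasInfoStructure S) (hS : ∀ i : ℕ, S i ⊆ Set.Iio (i : ℤ)) (m : ℕ) :
    ∃ (U : Type) (_ : MeasurableSpace U) (lam : Measure U) (E : U → Encoder A B 1)
      (K : Kernel U (Path A B)), IsProbabilityMeasure lam ∧
      (∀ u, K u = lawUpTo μ Q ((E u).policy 0) m) ∧
      ∀ f : Path A B → ℝ≥0∞, Measurable f →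
        ∫⁻ u, ∫⁻ x, f x ∂(K u) ∂lam = ∫⁻ x, f x ∂(lawUpTo μ Q P m) := by
  induction m with
  | zero =>
    let g : Encoder A B 1 := ⟨fun _ _ _ => Classical.arbitrary _, fun _ _ => measurable_const⟩
    refine ⟨Unit, inferInstance, Measure.dirac (), fun _ => g,
      Kernel.const Unit (lawUpTo μ Q P 0), inferInstance, fun u => rfl, fun f hf => ?_⟩
    simp
  | succ m ih =>
    obtain ⟨U, mU, lam, E, K, hlam, hK, hmix⟩ := ih
    -- Since the input kernel depends on outputs only, its functional representation f(b, t), with t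
    -- uniform on [0, 1], is an encoding map for each fixed t.
    obtain ⟨π, hπ, hPπ⟩ := hP.exists_kern_eq_comap hS m
    obtain ⟨f, hf, hfπ⟩ := π.exists_measurable_map_eq_unitInterval
    have hKm : IsMarkovKernel K := ⟨fun u => hK u ▸ inferInstance⟩
    let res : OutPast B m → OutOn B (S m) := Set.domRestrict₂ (hS m)
    have hres : Measurable res := Set.measurable_restrict₂ (hS m)
    have hft (t : I) : Measurable fun b : OutPast B m => f (res b) t :=
      hf.comp (hres.prodMk measurable_const)
    -- A strategy is an encoder for a single message. Time m receives its own uniform variable,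
    -- independent of those used earlier.
    let E' : U × I → Encoder A B 1 := fun p => (E p.1).updateAt m (fun b => f (res b) p.2) (hft p.2)
    have hE' (p : U × I) : lawUpTo μ Q ((E' p).policy 0) m = K p.1 := by
      rw [hK]
      exact lawUpTo_congr μ Q fun k hk => (E p.1).policy_updateAt_of_ne _ (hft p.2) 0 hk.ne
    have hG {g : Path A B → ℝ≥0∞} (hg : Measurable g) :
        Measurable fun y : Path A B => ∫⁻ b, g (setOut m (y, b)) ∂(Q.onPath m y) :=
      (show Measurable fun p : Path A B × B m => g (setOut m p) from
        hg.comp (measurable_setOut m)).lintegral_kernel_prod_right'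
    have hstep {g : Path A B → ℝ≥0∞} (hg : Measurable g) (p : U × I) :
        ∫⁻ x, g x ∂(lawUpTo μ Q ((E' p).policy 0) (m + 1)) =
          ∫⁻ x, (fun y : Path A B => ∫⁻ b, g (setOut m (y, b)) ∂(Q.onPath m y))
            (setIn m (x, f (res (outPast m x)) p.2)) ∂(K p.1) := by
      rw [(E' p).lintegral_lawUpTo_succ μ Q 0 m hg, hE' p]
      simp only [E', Encoder.updateAt_map_self]
    have hin : Measurable fun q : (U × I) × Path A B =>
        setIn m (q.2, f (res (outPast m q.2)) q.1.2) :=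
      (measurable_setIn m).comp (measurable_snd.prodMk (hf.comp
        ((hres.comp ((measurable_outPast m).comp measurable_snd)).prodMk
          (measurable_snd.comp measurable_fst))))
    have hint {g : Path A B → ℝ≥0∞} (hg : Measurable g) :
        Measurable fun p : U × I => ∫⁻ x, g x ∂(lawUpTo μ Q ((E' p).policy 0) (m + 1)) := by
      simp only [hstep hg]
      exact ((hG hg).comp hin).lintegral_kernel_prod_right' (κ := K.comap Prod.fst measurable_fst)
    -- Encoders carry no σ-algebra; measurability in the random parameter is recorded by this kernel
    -- of path laws instead.
    let K' : Kernel (U × I) (Path A B) :=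
      { toFun := fun p => lawUpTo μ Q ((E' p).policy 0) (m + 1)
        measurable' := by
          refine Measure.measurable_of_measurable_coe _ fun s hs => ?_
          simpa only [lintegral_indicator_one hs] using
            hint (g := s.indicator 1) (measurable_one.indicator hs) }
    refine ⟨U × I, inferInstance, lam.prod volume, E', K', inferInstance, fun p => rfl,
      fun g hg => ?_⟩
    change ∫⁻ p, ∫⁻ x, g x ∂(lawUpTo μ Q ((E' p).policy 0) (m + 1)) ∂(lam.prod volume) = _
    rw [lintegral_prod _ (hint hg).aemeasurable, FeedbackCoding.lintegral_lawUpTo_succ μ Q P m hg,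
      ← hmix _ ?_]
    · refine lintegral_congr fun u => ?_
      simp only [hstep hg]
      have hsw : Measurable fun q : I × Path A B =>
          setIn m (q.2, f (res (outPast m q.2)) q.1) :=
        hin.comp ((measurable_const.prodMk measurable_fst).prodMk measurable_snd :
          Measurable fun q : I × Path A B => ((u, q.1), q.2))
      -- The earlier path does not depend on the new variable t; integrating t out first turns f(b,
      -- t) into the input kernel.
      rw [lintegral_lintegral_swap (f := fun t x =>
        (fun y : Path A B => ∫⁻ b, g (setOut m (y, b)) ∂(Q.onPath m y))
            (setIn m (x, f (res (outPast m x)) t))) ((hG hg).comp hsw).aemeasurable]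
      refine lintegral_congr fun x => ?_
      have hPx : P.onPath m x = volume.map (f (res (outPast m x))) := by
        rw [hfπ, Policy.onPath, Kernel.comap_apply, hPπ]
        rfl
      rw [hPx]
      exact (lintegral_map
        (f := fun a => ∫⁻ b, g (setOut m (setIn m (x, a), b)) ∂(Q.onPath m (setIn m (x, a))))
        ((hG hg).comp ((measurable_setIn m).comp measurable_prodMk_left))
        (hf.comp measurable_prodMk_left)).symm
    · exact ((hG hg).comp (measurable_setIn m)).lintegral_kernel_prod_right'

end RandomStrategies

/-! ### The information density and the decoding sets built from it. -/

section InformationDensity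

open InformationTheory

variable {A : ℕ → Type u} {B : ℤ → Type v}
  [∀ i, MeasurableSpace (A i)] [∀ i, Nonempty (A i)]
  [∀ j, MeasurableSpace (B j)] [∀ j, StandardBorelSpace (B j)] [∀ j, Nonempty (B j)]
  (μ : Measure (OutPast B 0)) [IsProbabilityMeasure μ] (Q : Channel A B) (P : Policy A B) (n : ℕ)

/-- The density of `Q_i(· | B^{i-1}, A^i)` with respect to the conditional law of `B_i` given
`B^{i-1}`. -/
noncomputable def densityFactor (i : ℕ) (x : Path A B) : ℝ≥0∞ :=
  (Q.kern i).rnDeriv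
    ((condDistrib (fun y : Path A B => y.2 (i : ℤ)) (outPast (i : ℤ))
      (jointLaw μ Q P n)).prodMkRight (InUpTo A i))
    (outPast i x, inUpTo i x) (x.2 i)

@[fun_prop] lemma measurable_densityFactor (i : ℕ) : Measurable (densityFactor μ Q P n i) :=
  (Kernel.measurable_rnDeriv (Q.kern i)
    ((condDistrib (fun y : Path A B => y.2 (i : ℤ)) (outPast (i : ℤ))
      (jointLaw μ Q P n)).prodMkRight (InUpTo A i))).comp
    (show Measurable fun x : Path A B => ((outPast i x, inUpTo i x), x.2 (i : ℤ)) by fun_prop)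

lemma infoDensity_eq (x : Path A B) : infoDensity μ Q P n x =
    ∑ i ∈ Finset.range (n + 1), Real.log (densityFactor μ Q P n i x).toReal := rfl

variable {μ Q P n}

lemma condMutualInfo_ne_top (h : directedInfo (jointLaw μ Q P n) n ≠ ∞) {i : ℕ} (hi : i ≤ n) :
    condMutualInfo (jointLaw μ Q P n) (inUpTo i) (fun x => x.2 (i : ℤ)) (outPast (i : ℤ)) ≠ ∞ :=
  ENNReal.sum_ne_top.mp h i (Finset.mem_range_succ_iff.mpr hi)

lemma ae_densityFactor (h : directedInfo (jointLaw μ Q P n) n ≠ ∞) {i : ℕ} (hi : i ≤ n) :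
    ∀ᵐ x ∂(jointLaw μ Q P n), densityFactor μ Q P n i x ≠ 0 ∧ densityFactor μ Q P n i x ≠ ∞ := by
  have hch := isChannelLaw_jointLaw μ Q P n
  have hfin := condMutualInfo_ne_top h hi
  rw [condMutualInfo_inUpTo_eq hch hi] at hfin
  have h1 := ae_rnDeriv_pos_of_klDiv_ne_top _ _ _ hfin
  rw [← hch.map_output i hi] at h1
  exact ae_of_ae_map (by fun_prop) h1

/-- The logarithm of the factor is, almost surely, the log-likelihood ratio whose mean is the
conditional mutual information. -/
lemma integrable_log_densityFactor (h : directedInfo (jointLaw μ Q P n) n ≠ ∞) {i : ℕ}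
    (hi : i ≤ n) :
    Integrable (fun x => Real.log (densityFactor μ Q P n i x).toReal) (jointLaw μ Q P n) ∧
    ∫ x, Real.log (densityFactor μ Q P n i x).toReal ∂(jointLaw μ Q P n) =
      (condMutualInfo (jointLaw μ Q P n) (inUpTo i) (fun x => x.2 (i : ℤ))
        (outPast (i : ℤ))).toReal := by
  have hch := isChannelLaw_jointLaw μ Q P n
  have hfin := condMutualInfo_ne_top h hi
  rw [condMutualInfo_inUpTo_eq hch hi] at hfin ⊢
  obtain ⟨hac, hint⟩ := klDiv_ne_top_iff.mp hfin
  have hae := llr_compProd_ae_eq _ _ _ hac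
  have hm : Measurable fun x : Path A B => ((outPast i x, inUpTo i x), x.2 (i : ℤ)) := by fun_prop
  have hint' := (integrable_congr hae).mp hint
  rw [toReal_klDiv_of_measure_eq hac (by simp), integral_congr_ae hae]
  rw [← hch.map_output i hi] at hint' ⊢
  exact ⟨hint'.comp_measurable hm, (integral_map hm.aemeasurable hint'.aestronglyMeasurable).symm⟩

lemma integral_infoDensity (h : directedInfo (jointLaw μ Q P n) n ≠ ∞) :
    ∫ x, infoDensity μ Q P n x ∂(jointLaw μ Q P n) =
      (directedInfo (jointLaw μ Q P n) n).toReal := by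
  simp only [infoDensity_eq]
  rw [integral_finsetSum _ fun i hi =>
    (integrable_log_densityFactor h (Finset.mem_range_succ_iff.mp hi)).1, directedInfo,
    ENNReal.toReal_sum fun i hi => condMutualInfo_ne_top h (Finset.mem_range_succ_iff.mp hi)]
  exact Finset.sum_congr rfl fun i hi =>
    (integrable_log_densityFactor h (Finset.mem_range_succ_iff.mp hi)).2

/-- The product of the density factors is the exponential of the information density. -/
lemma ae_prod_densityFactor_eq (h : directedInfo (jointLaw μ Q P n) n ≠ ∞) :
    ∀ᵐ x ∂(jointLaw μ Q P n), ∏ i ∈ Finset.range (n + 1), densityFactor μ Q P n i x =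
      ENNReal.ofReal (Real.exp (infoDensity μ Q P n x)) := by
  have h1 : ∀ᵐ x ∂(jointLaw μ Q P n), ∀ i ∈ Finset.range (n + 1),
      densityFactor μ Q P n i x ≠ 0 ∧ densityFactor μ Q P n i x ≠ ∞ :=
    (Finset.eventually_all _).mpr fun i hi => ae_densityFactor h (Finset.mem_range_succ_iff.mp hi)
  filter_upwards [h1] with x hx
  rw [infoDensity_eq, Real.exp_sum, ENNReal.ofReal_prod_of_nonneg fun i _ => (Real.exp_pos _).le]
  refine Finset.prod_congr rfl fun i hi => ?_
  rw [Real.exp_log (ENNReal.toReal_pos (hx i hi).1 (hx i hi).2), ENNReal.ofReal_toReal (hx i hi).2]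

/-- Replace the inputs by those that a feedback strategy produces from the outputs. -/
def Encoder.encode (g : Encoder A B 1) (x : Path A B) : Path A B :=
  (fun i => g.map i 0 (outPast i x), x.2)

omit [∀ i, Nonempty (A i)] [∀ j, StandardBorelSpace (B j)] [∀ j, Nonempty (B j)] in
@[fun_prop] lemma Encoder.measurable_encode (g : Encoder A B 1) : Measurable g.encode :=
  (measurable_pi_lambda _ fun i => (g.meas i 0).comp (measurable_outPast i)).prodMk measurable_snd

/-- A path with prescribed outputs at the times in `S`. -/
noncomputable def extOut (S : Set ℤ) (b : OutOn B S) : Path A B :=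
  open Classical in
  (fun _ => Classical.arbitrary _, fun j => if h : j ∈ S then b ⟨j, h⟩ else Classical.arbitrary _)

omit [∀ j, StandardBorelSpace (B j)] in
@[fun_prop] lemma measurable_extOut (S : Set ℤ) :
    Measurable (extOut S : OutOn B S → Path A B) := by
  refine measurable_const.prodMk (measurable_pi_lambda _ fun j => ?_)
  by_cases h : j ∈ S
  · simpa [h] using measurable_pi_apply (⟨j, h⟩ : S)
  · simp [h]

omit [∀ i, MeasurableSpace (A i)] [∀ j, MeasurableSpace (B j)] [∀ j, StandardBorelSpace (B j)] in
lemma extOut_snd {S : Set ℤ} (x : Path A B) {j : ℤ} (h : j ∈ S) :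
    (extOut S (outOn S x) : Path A B).2 j = x.2 j := by
  simp [extOut, h, outOn]

/-- The strategy computes the inputs up to time i from outputs before time i, so along it the i-th
factor is a function of b^i alone. This is what lets a decoder evaluate it. -/
lemma densityFactor_encode_congr (g : Encoder A B 1) {i : ℕ} {x y : Path A B}
    (h : ∀ j ≤ (i : ℤ), x.2 j = y.2 j) :
    densityFactor μ Q P n i (g.encode x) = densityFactor μ Q P n i (g.encode y) := by
  have h1 (k : ℕ) (hk : k ≤ i) : outPast k x = outPast k y :=
    funext fun j => h j (by have : (j : ℤ) < k := j.2; omega)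
  have h2 : outPast i (g.encode x) = outPast i (g.encode y) := h1 i le_rfl
  have h3 : inUpTo i (g.encode x) = inUpTo i (g.encode y) :=
    funext fun j => congrArg (g.map j 0) (h1 j j.2)
  have h4 : (g.encode x).2 (i : ℤ) = (g.encode y).2 (i : ℤ) := h i le_rfl
  rw [densityFactor, densityFactor, h2, h3, h4]

/-- Along a fixed feedback strategy, the product of the density factors has mean at most `1` when
the outputs follow their own law. -/
lemma lintegral_prod_densityFactor_encode_le (g : Encoder A B 1) {k : ℕ} (hk : k ≤ n + 1) :
    ∫⁻ x, ∏ i ∈ Finset.range k, densityFactor μ Q P n i (g.encode x) ∂(jointLaw μ Q P n) ≤ 1 := by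
  induction k with
  | zero => simp
  | succ k ih =>
    refine le_trans ?_ (ih (Nat.le_of_succ_le hk))
    set ρ := jointLaw μ Q P n with hρ
    let r := condDistrib (fun y : Path A B => y.2 (k : ℤ)) (outPast (k : ℤ)) ρ
    let ext : OutPast B k → Path A B := extOut (Set.Iio (k : ℤ))
    have hext : Measurable ext := measurable_extOut _
    -- The first k factors and the inputs up to time k are functions of b^{k-1}. Conditionally on
    -- it, only the last factor varies, and its integral against the law r of b_k is at most 1.
    let F : OutPast B k → ℝ≥0∞ :=
      fun b => ∏ i ∈ Finset.range k, densityFactor μ Q P n i (g.encode (ext b))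
    have hF : Measurable F := by fun_prop
    have hFx (x : Path A B) :
        F (outPast k x) = ∏ i ∈ Finset.range k, densityFactor μ Q P n i (g.encode x) := by
      refine Finset.prod_congr rfl fun i hi => densityFactor_encode_congr g fun j hj =>
        extOut_snd x ?_
      have := Finset.mem_range.mp hi
      simp only [Set.mem_Iio]
      omega
    let a : OutPast B k → InUpTo A k := fun b => inUpTo k (g.encode (ext b))
    have ha : Measurable a := by fun_prop
    have hax (x : Path A B) : a (outPast k x) = inUpTo k (g.encode x) := by
      refine funext fun j => congrArg (g.map j 0) (funext fun l => extOut_snd x ?_)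
      have h1 : (l : ℤ) < (j : ℕ) := l.2
      have h2 : (j : ℕ) ≤ k := j.2
      simp only [Set.mem_Iio]
      omega
    let G : OutPast B k × B k → ℝ≥0∞ :=
      fun p => (Q.kern k).rnDeriv (r.prodMkRight (InUpTo A k)) (p.1, a p.1) p.2
    have hG : Measurable G :=
      (Kernel.measurable_rnDeriv (Q.kern k) (r.prodMkRight (InUpTo A k))).comp
        (show Measurable fun p : OutPast B k × B k => ((p.1, a p.1), p.2) by fun_prop)
    have hGx (x : Path A B) :
        G (outPast k x, x.2 k) = densityFactor μ Q P n k (g.encode x) := by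
      simp only [G, hax]
      rfl
    have hFG : Measurable fun p : OutPast B k × B k => F p.1 * G p :=
      (hF.comp measurable_fst).mul hG
    calc ∫⁻ x, ∏ i ∈ Finset.range (k + 1), densityFactor μ Q P n i (g.encode x) ∂ρ
        = ∫⁻ x, F (outPast k x) * G (outPast k x, x.2 k) ∂ρ := by
          simp only [Finset.prod_range_succ, hFx, hGx]
      _ = ∫⁻ p, F p.1 * G p ∂(ρ.map (outPast (k : ℤ)) ⊗ₘ r) := by
          rw [compProd_map_condDistrib (by fun_prop), lintegral_map hFG (by fun_prop)]
      _ = ∫⁻ b, F b * ∫⁻ z, G (b, z) ∂(r b) ∂(ρ.map (outPast (k : ℤ))) := by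
          rw [Measure.lintegral_compProd hFG]
          refine lintegral_congr fun b => ?_
          exact lintegral_const_mul (F b) (f := fun z => G (b, z))
            (hG.comp measurable_prodMk_left)
      _ ≤ ∫⁻ b, F b ∂(ρ.map (outPast (k : ℤ))) := by
          refine lintegral_mono fun b => mul_le_of_le_one_right' ?_
          exact lintegral_kernelRnDeriv_le (Q.kern k) (r.prodMkRight (InUpTo A k)) (b, a b)
      _ = ∫⁻ x, ∏ i ∈ Finset.range k, densityFactor μ Q P n i (g.encode x) ∂ρ := by
          rw [lintegral_map hF (by fun_prop)]
          simp only [hFx]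

variable (μ Q P n) in
/-- The outputs along which the density of a feedback strategy exceeds `β`. -/
noncomputable def decodingSet (β : ℝ≥0∞) (g : Encoder A B 1) : Set (OutUpTo B n) :=
  {y | β < ∏ i ∈ Finset.range (n + 1), densityFactor μ Q P n i (g.encode (extOut _ y))}

lemma measurableSet_decodingSet (β : ℝ≥0∞) (g : Encoder A B 1) :
    MeasurableSet (decodingSet μ Q P n β g) :=
  measurableSet_lt measurable_const (by fun_prop)

lemma preimage_decodingSet (β : ℝ≥0∞) (g : Encoder A B 1) :
    outUpTo (n : ℤ) ⁻¹' decodingSet μ Q P n β g =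
      {x | β < ∏ i ∈ Finset.range (n + 1), densityFactor μ Q P n i (g.encode x)} := by
  ext x
  simp only [decodingSet, Set.mem_preimage, Set.mem_ofPred_eq]
  refine iff_of_eq (congrArg _ (Finset.prod_congr rfl fun i hi =>
    densityFactor_encode_congr g fun j hj => extOut_snd (S := Set.Iic (n : ℤ)) x ?_))
  have := Finset.mem_range_succ_iff.mp hi
  simp only [Set.mem_Iic]
  omega

/-- Markov's inequality for a product with mean at most 1. -/
lemma jointLaw_decodingSet_le {β : ℝ≥0∞} (hβ : β ≠ 0) (hβ' : β ≠ ∞) (g : Encoder A B 1) :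
    jointLaw μ Q P n (outUpTo (n : ℤ) ⁻¹' decodingSet μ Q P n β g) ≤ β⁻¹ := by
  rw [preimage_decodingSet]
  have h1 := mul_meas_ge_le_lintegral (μ := jointLaw μ Q P n)
    (f := fun x => ∏ i ∈ Finset.range (n + 1), densityFactor μ Q P n i (g.encode x))
    (by fun_prop) β
  have h2 := h1.trans (lintegral_prod_densityFactor_encode_le g le_rfl)
  rw [← one_mul β⁻¹, ← div_eq_mul_inv, ENNReal.le_div_iff_mul_le (Or.inl hβ) (Or.inl hβ'), mul_comm]
  refine le_trans ?_ h2
  gcongr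
  intro (hx : β < _)
  exact hx.le

/-- Under its own law the strategy almost surely produced the actual inputs, so the product of
factors on the path is the one that the decoder computes. -/
lemma jointLaw_policy_sdiff_decodingSet [∀ i, StandardBorelSpace (A i)] (β : ℝ≥0∞) (g : Encoder A B 1) :
    jointLaw μ Q (g.policy 0) n
      ({x | β < ∏ i ∈ Finset.range (n + 1), densityFactor μ Q P n i x} \
        outUpTo (n : ℤ) ⁻¹' decodingSet μ Q P n β g) = 0 := by
  rw [preimage_decodingSet]
  have h1 : ∀ᵐ x ∂(jointLaw μ Q (g.policy 0) n), ∀ i ∈ Finset.range (n + 1),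
      x.1 i = g.map i 0 (outPast i x) :=
    (Finset.eventually_all _).mpr fun i hi =>
      g.ae_input_eq μ Q 0 (Finset.mem_range_succ_iff.mp hi)
  refine measure_eq_zero_iff_ae_notMem.mpr ?_
  filter_upwards [h1] with x hx
  simp only [Set.mem_sdiff, Set.mem_ofPred_eq, not_and, not_not]
  intro hβ
  refine lt_of_lt_of_eq hβ (Finset.prod_congr rfl fun i hi => ?_)
  have h2 : inUpTo i x = inUpTo i (g.encode x) := by
    refine funext fun j => hx j ?_
    have h3 : (j : ℕ) ≤ i := j.2
    have := Finset.mem_range.mp hi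
    exact Finset.mem_range.mpr (by omega)
  rw [densityFactor, densityFactor, h2]
  rfl

end InformationDensity

end FeedbackCoding

namespace FeedbackCoding

universe u v

/-! ### Construction of codes and achievability. -/

section Direct

lemma inv_mul_sum_append_le {k N : ℕ} (hk : 0 < k) {f : Fin (k + N) → ℝ≥0∞} {a b c : ℝ≥0}
    (ha : ∀ j : Fin k, f (Fin.castAdd N j) ≤ a) (hb : ∀ j : Fin N, f (Fin.natAdd k j) ≤ b)
    (h : k * a + N * b ≤ (k + N) * c) : ((k + N : ℕ) : ℝ≥0∞)⁻¹ * ∑ w, f w ≤ c := by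
  have h0 : ((k + N : ℕ) : ℝ≥0∞) ≠ 0 := by exact_mod_cast (Nat.add_pos_left hk N).ne'
  rw [mul_comm, ← div_eq_mul_inv, ENNReal.div_le_iff_le_mul (Or.inl h0)
    (Or.inl (ENNReal.natCast_ne_top _)), Fin.sum_univ_add]
  calc ∑ j : Fin k, f (Fin.castAdd N j) + ∑ j : Fin N, f (Fin.natAdd k j)
      ≤ ∑ _j : Fin k, (a : ℝ≥0∞) + ∑ _j : Fin N, (b : ℝ≥0∞) :=
        add_le_add (Finset.sum_le_sum fun j _ => ha j) (Finset.sum_le_sum fun j _ => hb j)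
    _ = ((k * a + N * b : ℝ≥0) : ℝ≥0∞) := by simp
    _ ≤ (((k + N) * c : ℝ≥0) : ℝ≥0∞) := by exact_mod_cast h
    _ = c * ((k + N : ℕ) : ℝ≥0∞) := by push_cast; ring

variable {A : ℕ → Type u} {B : ℤ → Type v}
  [∀ i, MeasurableSpace (A i)] [∀ j, MeasurableSpace (B j)]

/-- The encoder that uses the feedback strategy `e w` for the message `w`. -/
def Encoder.ofStrategies {M : ℕ} (e : Fin M → Encoder A B 1) : Encoder A B M where
  map i w := (e w).map i 0
  meas i w := (e w).meas i 0

variable [∀ i, StandardBorelSpace (A i)] [∀ i, Nonempty (A i)]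
  [∀ j, StandardBorelSpace (B j)] [∀ j, Nonempty (B j)]
  {μ : Measure (OutPast B 0)} [IsProbabilityMeasure μ] {Q : Channel A B} {γ : Cost A B}
  {T : MessageChannel A B} {S : ℕ → Set ℤ} {P : Policy A B} {n : ℕ} {κ : ℝ≥0}

/-- The mean cost per unit time of a feedback strategy. -/
noncomputable def strategyCost (μ : Measure (OutPast B 0)) (Q : Channel A B) (γ : Cost A B)
    (n : ℕ) (g : Encoder A B 1) : ℝ≥0∞ :=
  ((n : ℝ≥0∞) + 1)⁻¹ * ∫⁻ x, (γ.total n x : ℝ≥0∞) ∂(jointLaw μ Q (g.policy 0) n)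

omit [∀ i, StandardBorelSpace (A i)] [IsProbabilityMeasure μ] [∀ j, StandardBorelSpace (B j)] in
lemma ofStrategies_mem_encodersWithCost (hT : MasseyCI Q T) {M : ℕ} (e : Fin M → Encoder A B 1)
    (h : (M : ℝ≥0∞)⁻¹ * ∑ w, strategyCost μ Q γ n (e w) ≤ κ) :
    Encoder.ofStrategies e ∈ encodersWithCost μ T γ κ n M := by
  change ((n : ℝ≥0∞) + 1)⁻¹ * ∫⁻ x, (γ.total n x : ℝ≥0∞) ∂(codeLaw μ T _ n) ≤ κ
  rw [lintegral_codeLaw, mul_left_comm, Finset.mul_sum]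
  simp only [hT.eq]
  exact h

omit [∀ i, StandardBorelSpace (A i)] [∀ j, StandardBorelSpace (B j)] in
/-- A code that uses strategies of low cost for `k` messages and, for the remaining ones, a
strategy with a cost below the constraint. -/
lemma exists_feedbackCode_of_strategies (hT : MasseyCI Q T) {s m y : ℝ≥0} (hκ : m + y = κ)
    {k : ℕ} (hk : 0 < k) {e : ℕ → Encoder A B 1} {e₀ : Encoder A B 1}
    {E : ℕ → Set (OutUpTo B n)} (hE : ∀ j, MeasurableSet (E j))
    (hdisj : Pairwise (Function.onFun Disjoint E))
    (hcost : ∀ j < k, strategyCost μ Q γ n (e j) ≤ ((m + y * (1 + s) : ℝ≥0) : ℝ≥0∞))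
    (hcost₀ : strategyCost μ Q γ n e₀ ≤ ((m + y / 2 : ℝ≥0) : ℝ≥0∞))
    (herr : ∀ j < k, jointLaw μ Q ((e j).policy 0) n (outUpTo (n : ℤ) ⁻¹' E j)ᶜ ≤ s) :
    ∃ M, k ≤ M ∧ Nonempty (FeedbackCode μ T γ κ n M (3 * s + 1 / k)) := by
  -- The k code words exceed the budget by at most k·y·s in total and each extra message saves at
  -- least y/2, so 2sk of them suffice. Counted as errors, they give at most sk + 2sk + 1 errors in
  -- total, within (k + N)(3s + 1/k).
  set N := ⌈2 * s * k⌉₊ with hN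
  have hN1 : 2 * s * k ≤ N := Nat.le_ceil _
  have hN2 : (N : ℝ≥0) ≤ 2 * s * k + 1 := (Nat.ceil_lt_add_one zero_le).le
  have hk0 : (0 : ℝ≥0) < k := by exact_mod_cast hk
  let e' : Fin (k + N) → Encoder A B 1 := Fin.append (fun j : Fin k => e j) fun _ => e₀
  obtain ⟨d, hd, hdE⟩ := exists_measurable_decoder (M := k + N) (Nat.add_pos_left hk N)
    (E := fun w => E w) (fun w => hE w) fun v w hvw => hdisj fun h => hvw (Fin.ext h)
  refine ⟨k + N, Nat.le_add_right k N, ⟨⟨Encoder.ofStrategies e',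
    ofStrategies_mem_encodersWithCost hT e' ?_, d, hd, ?_⟩⟩⟩
  · refine inv_mul_sum_append_le hk (a := m + y * (1 + s)) (b := m + y / 2) (fun j => ?_)
      (fun j => ?_) ?_
    · simpa [e'] using hcost j j.2
    · simpa [e'] using hcost₀
    · rw [← hκ, ← NNReal.coe_le_coe]
      rw [← NNReal.coe_le_coe] at hN1
      push_cast at hN1 ⊢
      nlinarith [mul_le_mul_of_nonneg_left hN1 y.coe_nonneg]
  · rw [errorProb]
    refine inv_mul_sum_append_le hk (a := s) (b := 1) (fun j => ?_) (fun j => ?_) ?_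
    · rw [hT.eq]
      refine le_trans ?_ (herr j j.2)
      have hpol : (Encoder.ofStrategies e').policy (Fin.castAdd N j) = (e j).policy 0 := by
        change (e' (Fin.castAdd N j)).policy 0 = _
        simp [e']
      rw [hpol]
      refine measure_mono fun x hx hxE => hx ?_
      exact hdE (Fin.castAdd N j) _ hxE
    · rw [ENNReal.coe_one]
      exact prob_le_one
    · rw [← NNReal.coe_le_coe]
      rw [← NNReal.coe_le_coe] at hN1 hN2
      push_cast at hN1 hN2 ⊢
      have hk' : (k : ℝ) * (1 / k) = 1 := mul_one_div_cancel (by exact_mod_cast hk.ne')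
      have h1 : (0 : ℝ) ≤ N * (3 * s + 1 / k) := by positivity
      nlinarith

omit [∀ j, StandardBorelSpace (B j)] in
/-- A random strategy with the law of a policy meeting the cost constraint. -/
lemma exists_random_strategy (hP : P.HasInfoStructure S) (hS : ∀ i : ℕ, S i ⊆ Set.Iio (i : ℤ))
    (hcost : P ∈ policiesWithCost μ Q γ κ n) :
    ∃ (U : Type) (_ : MeasurableSpace U) (lam : Measure U) (E : U → Encoder A B 1)
      (K : Kernel U (Path A B)), IsProbabilityMeasure lam ∧ IsMarkovKernel K ∧
      (∀ u, K u = jointLaw μ Q ((E u).policy 0) n) ∧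
      (∀ s, MeasurableSet s → ∫⁻ u, K u s ∂lam = jointLaw μ Q P n s) ∧
      Measurable (fun u => strategyCost μ Q γ n (E u)) ∧
      ∫⁻ u, strategyCost μ Q γ n (E u) ∂lam ≤ κ := by
  obtain ⟨U, mU, lam, E, K, hlam, hK, hmix⟩ := exists_random_encoder μ Q hP hS (n + 1)
  have hK' (u : U) : K u = jointLaw μ Q ((E u).policy 0) n := hK u
  have htot : Measurable fun x : Path A B => (γ.total n x : ℝ≥0∞) :=
    (γ.measurable_total n).coe_nnreal_ennreal
  have hc : Measurable fun u => ∫⁻ x, (γ.total n x : ℝ≥0∞) ∂(K u) := htot.lintegral_kernel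
  refine ⟨U, mU, lam, E, K, hlam, ⟨fun u => hK u ▸ inferInstance⟩, hK', fun s hs => ?_, ?_, ?_⟩
  · have := hmix (s.indicator 1) (measurable_one.indicator hs)
    simp only [lintegral_indicator_one hs] at this
    exact this
  · simp only [strategyCost, ← hK']
    exact hc.const_mul _
  · simp only [strategyCost, ← hK']
    rw [lintegral_const_mul _ hc, hmix _ htot]
    exact hcost

/-- Feinstein's lemma with the decoding sets of the random strategies. The mixture has the output
law of P, so η = 1/β bounds the mean probability of each decoding set, and `h` is the required
inequality because the low-cost set F has probability at least s/(1 + s). -/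
lemma exists_feedbackCode (hT : MasseyCI Q T) (hP : P.HasInfoStructure S)
    (hS : ∀ i : ℕ, S i ⊆ Set.Iio (i : ℤ)) (hcost : P ∈ policiesWithCost μ Q γ κ n) {s : ℝ≥0}
    (hs : 0 < s) {k : ℕ} (hk : 0 < k) {β : ℝ≥0∞} (hβ : β ≠ 0) (hβ' : β ≠ ∞)
    (h : k * β⁻¹ + jointLaw μ Q P n
        {x | β < ∏ i ∈ Finset.range (n + 1), densityFactor μ Q P n i x}ᶜ <
      (s * (s / (1 + s)) : ℝ≥0)) :
    ∃ M, k ≤ M ∧ Nonempty (FeedbackCode μ T γ κ n M (3 * s + 1 / k)) := by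
  obtain ⟨U, mU, lam, E, K, hlam, hKm, hK, hmix, hmeas, hle⟩ := exists_random_strategy hP hS hcost
  obtain ⟨F, u₀, m, y, hF, hmy, hlamF, hcF, hcu⟩ := exists_lowCost_set lam hmeas hle hs
  have hTm : MeasurableSet
      {x | β < ∏ i ∈ Finset.range (n + 1), densityFactor μ Q P n i x} :=
    measurableSet_lt measurable_const (by fun_prop)
  obtain ⟨c, D, hD, hdisj, hc⟩ := exists_maximal_code lam K (measurable_outUpTo (n : ℤ)) hTm
    (D := fun u => decodingSet μ Q P n β (E u)) (fun u => measurableSet_decodingSet β (E u))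
    (fun u => hK u ▸ jointLaw_policy_sdiff_decodingSet β (E u)) (η := β⁻¹)
    (fun u => by
      rw [hmix _ (measurable_outUpTo (n : ℤ) (measurableSet_decodingSet β (E u)))]
      exact jointLaw_decodingSet_le hβ hβ' (E u)) hF (ε := s) (k := k)
    (by
      rw [hmix _ hTm.compl]
      refine h.trans_le ?_
      rw [ENNReal.coe_mul]
      gcongr)
  exact exists_feedbackCode_of_strategies hT hmy hk (e := fun j => E (c j)) hD hdisj
    (fun j hj => hcF _ (hc j hj).1) hcu fun j hj => hK (c j) ▸ (hc j hj).2

omit [∀ j, StandardBorelSpace (B j)] in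
-- Sending every message by one strategy that meets the cost constraint gives a valid, if useless,
-- code with any number of messages. It fills in the block lengths where the construction does not
-- apply, and has no error for a single message.
lemma exists_feedbackCode_of_pos (hT : MasseyCI Q T) (hP : P.HasInfoStructure S)
    (hS : ∀ i : ℕ, S i ⊆ Set.Iio (i : ℤ)) (hcost : P ∈ policiesWithCost μ Q γ κ n) {M : ℕ}
    (hM : 0 < M) : ∃ c : FeedbackCode μ T γ κ n M 1, M = 1 → errorProb μ T c.enc n c.dec = 0 := by
  obtain ⟨U, mU, lam, E, K, hlam, hKm, hK, hmix, hmeas, hle⟩ := exists_random_strategy hP hS hcost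
  obtain ⟨F, u₀, m, y, -, hmy, -, -, hu⟩ := exists_lowCost_set lam hmeas hle one_pos
  have hM0 : (M : ℝ≥0∞) ≠ 0 := by exact_mod_cast hM.ne'
  have hu' : strategyCost μ Q γ n (E u₀) ≤ κ := by
    refine hu.trans ?_
    rw [← hmy]
    exact_mod_cast add_le_add_right (half_le_self zero_le) m
  have hmem : Encoder.ofStrategies (fun _ : Fin M => E u₀) ∈ encodersWithCost μ T γ κ n M := by
    refine ofStrategies_mem_encodersWithCost hT _ ?_
    simpa [← mul_assoc, ENNReal.inv_mul_cancel hM0 (ENNReal.natCast_ne_top M)] using hu'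
  refine ⟨⟨_, hmem, fun _ => ⟨0, hM⟩, measurable_const, ?_⟩, ?_⟩
  · rw [errorProb]
    calc (M : ℝ≥0∞)⁻¹ * ∑ w : Fin M, jointLaw μ (T M w) _ n _
        ≤ (M : ℝ≥0∞)⁻¹ * ∑ _w : Fin M, 1 := by
          gcongr
          exact prob_le_one
      _ = (1 : ℝ≥0) := by
          simp [ENNReal.inv_mul_cancel hM0 (ENNReal.natCast_ne_top M)]
  · rintro rfl
    simp [errorProb]

omit [∀ j, StandardBorelSpace (B j)] in
lemma isAchievable_of_nonpos (hT : MasseyCI Q T) {πs : ℕ → Policy A B}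
    (hP : ∀ n, (πs n).HasInfoStructure S) (hS : ∀ i : ℕ, S i ⊆ Set.Iio (i : ℤ))
    (hcost : ∀ n, πs n ∈ policiesWithCost μ Q γ κ n) {R : ℝ} (hR : R ≤ 0) :
    IsAchievable μ T γ κ R := by
  refine ⟨fun _ => 1, fun _ => 0, ⟨fun n => ⟨one_pos, ?_⟩, tendsto_const_nhds⟩, ?_⟩
  · obtain ⟨c, hc⟩ := exists_feedbackCode_of_pos (M := 1) hT (hP n) hS (hcost n) one_pos
    exact ⟨⟨c.enc, c.enc_mem, c.dec, c.dec_meas, (hc rfl).trans_le zero_le⟩⟩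
  · simpa [liminfRate] using hR

lemma le_liminfRate_of_exp_le {R : ℝ} {M : ℕ → ℕ}
    (h : ∀ n : ℕ, Real.exp (((n : ℝ) + 1) * R) ≤ M n) : (R : EReal) ≤ liminfRate M := by
  refine le_liminf_of_le (by isBoundedDefault) (Eventually.of_forall fun n => ?_)
  have h1 : ((n : ℝ) + 1) * R ≤ Real.log (M n) := by
    rw [← Real.log_exp (((n : ℝ) + 1) * R)]
    exact Real.log_le_log (Real.exp_pos _) (h n)
  rw [EReal.coe_le_coe_iff, one_div, le_inv_mul_iff₀ (by positivity)]
  exact h1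

lemma tendsto_exp_neg_mul_atTop {c : ℝ} (hc : 0 < c) :
    Tendsto (fun n : ℕ => Real.exp (-(((n : ℝ) + 1) * c))) atTop (𝓝 0) := by
  refine Real.tendsto_exp_neg_atTop_nhds_zero.comp ?_
  exact (tendsto_atTop_add_const_right _ 1 tendsto_natCast_atTop_atTop).atTop_mul_const hc

omit [∀ i, StandardBorelSpace (A i)] in
/-- If the directed information exceeds the threshold `(n + 1) R₂`, the density falls below
`exp ((n + 1) R₁)` only where it deviates from its mean. -/
lemma jointLaw_compl_le {R₁ R₂ : ℝ} (hfin : directedInfo (jointLaw μ Q P n) n ≠ ∞)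
    (h : R₂ < ((n : ℝ) + 1)⁻¹ * (directedInfo (jointLaw μ Q P n) n).toReal) :
    jointLaw μ Q P n {x | ENNReal.ofReal (Real.exp (((n : ℝ) + 1) * R₁)) <
        ∏ i ∈ Finset.range (n + 1), densityFactor μ Q P n i x}ᶜ ≤
      jointLaw μ Q P n {x | R₂ - R₁ < 1 / ((n : ℝ) + 1) *
        |(∫ y, infoDensity μ Q P n y ∂(jointLaw μ Q P n)) - infoDensity μ Q P n x|} := by
  refine measure_mono_ae ?_
  filter_upwards [ae_prod_densityFactor_eq hfin] with x hx
  intro (hxT : ¬ ENNReal.ofReal _ < _)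
  change R₂ - R₁ < _
  rw [hx, not_lt, ENNReal.ofReal_le_ofReal_iff (Real.exp_pos _).le, Real.exp_le_exp] at hxT
  rw [integral_infoDensity hfin]
  have hn : (0 : ℝ) < (n : ℝ) + 1 := by positivity
  have h1 : ((n : ℝ) + 1)⁻¹ * infoDensity μ Q P n x ≤ R₁ := by
    rwa [inv_mul_le_iff₀ hn]
  have h2 := mul_le_mul_of_nonneg_left (le_abs_self
    ((directedInfo (jointLaw μ Q P n) n).toReal - infoDensity μ Q P n x)) (inv_pos.mpr hn).le
  rw [one_div]
  linarith

/-- With R < R₁ < R₂, about exp((n + 1)R) messages and the threshold β = exp((n + 1)R₁), the term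
k/β decays exponentially. By `jointLaw_compl_le`, a density below the threshold deviates from its
mean by more than R₂ - R₁ per unit time, which stability makes unlikely. -/
lemma isAchievable_of_pos (hT : MasseyCI Q T) {πs : ℕ → Policy A B}
    (hP : ∀ n, (πs n).HasInfoStructure S) (hS : ∀ i : ℕ, S i ⊆ Set.Iio (i : ℤ))
    (hcost : ∀ n, πs n ∈ policiesWithCost μ Q γ κ n) (hstab : InfoDensityStable μ Q πs) {R R₂ : ℝ}
    (hR : 0 < R) (hRR : R < R₂)
    (hinfo : ∀ᶠ n : ℕ in atTop,
      R₂ < ((n : ℝ) + 1)⁻¹ * (directedInfo (jointLaw μ Q (πs n) n) n).toReal) :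
    IsAchievable μ T γ κ R := by
  obtain ⟨R₁, hR₁, hR₂⟩ := exists_between hRR
  let k : ℕ → ℕ := fun n => ⌈Real.exp (((n : ℝ) + 1) * R)⌉₊
  have hk (n : ℕ) : Real.exp (((n : ℝ) + 1) * R) ≤ k n := Nat.le_ceil _
  have hk0 (n : ℕ) : 0 < k n := Nat.ceil_pos.mpr (Real.exp_pos _)
  have hk2 (n : ℕ) : (k n : ℝ) ≤ 2 * Real.exp (((n : ℝ) + 1) * R) := by
    have h1 := (Nat.ceil_lt_add_one (Real.exp_pos (((n : ℝ) + 1) * R)).le).le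
    have h2 : 1 ≤ Real.exp (((n : ℝ) + 1) * R) := Real.one_le_exp (by positivity)
    change (⌈Real.exp (((n : ℝ) + 1) * R)⌉₊ : ℝ) ≤ _
    linarith
  let β : ℕ → ℝ≥0∞ := fun n => ENNReal.ofReal (Real.exp (((n : ℝ) + 1) * R₁))
  have hkβ : Tendsto (fun n => (k n : ℝ≥0∞) * (β n)⁻¹) atTop (𝓝 0) := by
    have h0 : Tendsto (fun n : ℕ => ENNReal.ofReal
        (2 * Real.exp (-(((n : ℝ) + 1) * (R₁ - R))))) atTop (𝓝 0) := by
      have := (tendsto_exp_neg_mul_atTop (sub_pos.mpr hR₁)).const_mul 2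
      simpa using ENNReal.tendsto_ofReal this
    refine tendsto_of_tendsto_of_tendsto_of_le_of_le tendsto_const_nhds h0 (fun n => zero_le)
      fun n => ?_
    change (k n : ℝ≥0∞) * (ENNReal.ofReal _)⁻¹ ≤ _
    rw [← ENNReal.ofReal_inv_of_pos (Real.exp_pos _), ← ENNReal.ofReal_natCast,
      ← ENNReal.ofReal_mul (Nat.cast_nonneg _), ← Real.exp_neg]
    refine ENNReal.ofReal_le_ofReal ?_
    calc (k n : ℝ) * Real.exp (-(((n : ℝ) + 1) * R₁))
        ≤ 2 * Real.exp (((n : ℝ) + 1) * R) * Real.exp (-(((n : ℝ) + 1) * R₁)) := by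
          gcongr
          exact hk2 n
      _ = 2 * Real.exp (-(((n : ℝ) + 1) * (R₁ - R))) := by
          rw [mul_assoc, ← Real.exp_add]
          congr 2
          ring
  have hkinv : Tendsto (fun n => 1 / (k n : ℝ≥0)) atTop (𝓝 0) := by
    rw [← NNReal.tendsto_coe]
    refine tendsto_of_tendsto_of_tendsto_of_le_of_le tendsto_const_nhds
      (tendsto_exp_neg_mul_atTop hR) (fun n => NNReal.coe_nonneg _) fun n => ?_
    simp only [Real.exp_neg, one_div]
    exact inv_anti₀ (Real.exp_pos _) (hk n)
  -- For each fixed error level good codes exist for all large n; the diagonal choice yields levels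
  -- that tend to zero, with the trivial code at level 1 as fallback.
  obtain ⟨ε, hε, hcode⟩ := exists_tendsto_zero_of_eventually
    (p := fun n δ => ∃ M : ℕ, Real.exp (((n : ℝ) + 1) * R) ≤ M ∧ 0 < M ∧
      Nonempty (FeedbackCode μ T γ κ n M δ))
    (fun n => ⟨1, k n, hk n, hk0 n,
      ⟨(exists_feedbackCode_of_pos hT (hP n) hS (hcost n) (hk0 n)).choose⟩⟩)
    (fun n δ δ' hδ ⟨M, hM, hM0, ⟨c⟩⟩ => ⟨M, hM, hM0, ⟨⟨c.enc, c.enc_mem, c.dec, c.dec_meas,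
      c.error_le.trans (by exact_mod_cast hδ)⟩⟩⟩)
    (fun δ hδ => by
      -- The construction has error at most 3s + 1/k; taking s = δ/4 and 1/k < δ/4 keeps it below δ.
      have hs : 0 < δ / 4 := by positivity
      have hpos : (0 : ℝ≥0∞) < ((δ / 4 * (δ / 4 / (1 + δ / 4)) : ℝ≥0) : ℝ≥0∞) := by
        exact_mod_cast (by positivity : 0 < δ / 4 * (δ / 4 / (1 + δ / 4)))
      have hsum := hkβ.add (hstab.2 (R₂ - R₁) (sub_pos.mpr hR₂))
      rw [add_zero] at hsum
      filter_upwards [hsum.eventually (gt_mem_nhds hpos), hkinv.eventually (gt_mem_nhds hs),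
        hinfo] with n h1 h2 h3
      obtain ⟨M, hM, ⟨c⟩⟩ := exists_feedbackCode hT (hP n) hS (hcost n) hs (hk0 n) (β := β n)
        (ENNReal.ofReal_pos.mpr (Real.exp_pos _)).ne' ENNReal.ofReal_ne_top
        ((add_le_add_right (jointLaw_compl_le (hstab.1 n) h3) _).trans_lt h1)
      refine ⟨M, (hk n).trans (by exact_mod_cast hM), (hk0 n).trans_le hM,
        ⟨⟨c.enc, c.enc_mem, c.dec, c.dec_meas, c.error_le.trans ?_⟩⟩⟩
      have h4 : 3 * (δ / 4) + 1 / (k n : ℝ≥0) ≤ δ := by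
        calc 3 * (δ / 4) + 1 / (k n : ℝ≥0) ≤ 3 * (δ / 4) + δ / 4 := by gcongr
          _ = δ := by
            rw [← NNReal.coe_inj]
            push_cast
            ring
      exact_mod_cast h4)
  choose M hM hM0 hcode using hcode
  exact ⟨M, ε, ⟨fun n => ⟨hM0 n, hcode n⟩, hε⟩, le_liminfRate_of_exp_le hM⟩

lemma IsCompatible.isAchievable_of_lt (hC : IsCompatible Q γ S) (hT : MasseyCI Q T)
    {πs : ℕ → Policy A B} (hπs : ∀ n, IsOptimalPolicy μ Q γ κ S n (πs n))
    (hstab : InfoDensityStable μ Q πs) {R : ℝ}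
    (hR : (R : EReal) < ((ftfiRate μ Q γ κ : ℝ≥0∞) : EReal)) : IsAchievable μ T γ κ R := by
  rcases le_or_gt R 0 with hR0 | hR0
  · exact isAchievable_of_nonpos hT (fun n => (hπs n).2.1) hC.subset (fun n => (hπs n).1) hR0
  obtain ⟨R₂, hRR, hR₂⟩ := EReal.lt_iff_exists_real_btwn.mp hR
  have hRR' : R < R₂ := by exact_mod_cast hRR
  have hR₂0 : 0 ≤ R₂ := (hR0.trans hRR').le
  have hlt : ENNReal.ofReal R₂ < liminf (fun n => charCapacityRate μ Q γ κ S n) atTop := by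
    rw [hC.liminf_charCapacityRate_eq, ← EReal.coe_ennreal_lt_coe_ennreal_iff,
      EReal.coe_ennreal_ofReal, max_eq_left hR₂0]
    exact hR₂
  refine isAchievable_of_pos hT (fun n => (hπs n).2.1) hC.subset (fun n => (hπs n).1) hstab hR0
    hRR' ?_
  filter_upwards [eventually_lt_of_lt_liminf hlt] with n hn
  -- By optimality, the directed information of the given input distribution is the capacity at this
  -- block length, so it exceeds the threshold R₂ for all large n.
  rw [← (hπs n).2.2, ← hC.directedInfo_eq_perLetterInfo (isChannelLaw_jointLaw μ Q (πs n) n)] at hn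
  have hfin : ((n : ℝ≥0∞) + 1)⁻¹ * directedInfo (jointLaw μ Q (πs n) n) n ≠ ∞ :=
    ENNReal.mul_ne_top (by simp) (hstab.1 n)
  rw [ENNReal.ofReal_lt_iff_lt_toReal hR₂0 hfin, ENNReal.toReal_mul, ENNReal.toReal_inv,
    ENNReal.toReal_add (by finiteness) (by finiteness), ENNReal.toReal_natCast,
    ENNReal.toReal_one] at hn
  exact hn

end Direct

end FeedbackCoding

/-! ### The coding theorem. -/

theorem theorem7 {A : ℕ → Type*} {B : ℤ → Type*}
    [∀ i, MeasurableSpace (A i)] [∀ i, StandardBorelSpace (A i)] [∀ i, Nonempty (A i)]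
    [∀ j, MeasurableSpace (B j)] [∀ j, StandardBorelSpace (B j)] [∀ j, Nonempty (B j)]
    (μ : Measure (FeedbackCoding.OutPast B 0)) [IsProbabilityMeasure μ]
    (Q : FeedbackCoding.Channel A B) (γ : FeedbackCoding.Cost A B) (κ : ℝ≥0)
    (chCl : FeedbackCoding.ChannelClass) (coCl : FeedbackCoding.CostClass)
    (hQ : Q.IsOfClass chCl) (hγ : γ.IsOfClass coCl)
    -- i) Massey's conditional independence
    (T : FeedbackCoding.MessageChannel A B) (hT : FeedbackCoding.MasseyCI Q T)
    -- ii) optimal input distributions achieving the characterization of the FTFI capacity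
    (πs : ℕ → FeedbackCoding.Policy A B)
    (hπs : ∀ n, FeedbackCoding.IsOptimalPolicy μ Q γ κ
      (FeedbackCoding.infoStructure chCl coCl) n (πs n)) :
    -- (a) converse
    (∀ (M : ℕ → ℕ) (ε : ℕ → ℝ≥0), FeedbackCoding.IsCodeSequence μ T γ κ M ε →
      FeedbackCoding.liminfRate M ≤
        ((liminf (fun n => FeedbackCoding.encoderInfoRate μ T γ κ n (M n)) atTop : ℝ≥0∞) : EReal) ∧
      liminf (fun n => FeedbackCoding.encoderInfoRate μ T γ κ n (M n)) atTop ≤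
        liminf (fun n => FeedbackCoding.charCapacityRate μ Q γ κ
          (FeedbackCoding.infoStructure chCl coCl) n) atTop) ∧
    liminf (fun n => FeedbackCoding.charCapacityRate μ Q γ κ
      (FeedbackCoding.infoStructure chCl coCl) n) atTop = FeedbackCoding.ftfiRate μ Q γ κ ∧
    (∀ R : ℝ, FeedbackCoding.IsAchievable μ T γ κ R →
      (R : EReal) ≤ ((FeedbackCoding.ftfiRate μ Q γ κ : ℝ≥0∞) : EReal)) ∧
    -- (b) direct part, under iii) and iv)
    (FeedbackCoding.InfoDensityStable μ Q πs → FeedbackCoding.CostStable μ Q γ πs →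
      ∀ R : ℝ, (R : EReal) < ((FeedbackCoding.ftfiRate μ Q γ κ : ℝ≥0∞) : EReal) →
        FeedbackCoding.IsAchievable μ T γ κ R) := by
  have hC := FeedbackCoding.isCompatible_infoStructure hQ hγ
  have hle {M : ℕ → ℕ} {ε : ℕ → ℝ≥0} (h : FeedbackCoding.IsCodeSequence μ T γ κ M ε) :
      liminf (fun n => FeedbackCoding.encoderInfoRate μ T γ κ n (M n)) atTop ≤
        liminf (fun n => FeedbackCoding.charCapacityRate μ Q γ κ
          (FeedbackCoding.infoStructure chCl coCl) n) atTop :=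
    liminf_le_liminf (Eventually.of_forall fun n => hC.encoderInfoRate_le hT (h.1 n).1 n)
  refine ⟨fun M ε h => ⟨hC.liminfRate_le hT h, hle h⟩, hC.liminf_charCapacityRate_eq κ,
    fun R ⟨M, ε, h, hR⟩ => ?_, fun hstab _ R hR => hC.isAchievable_of_lt hT hπs hstab hR⟩
  refine (hR.trans (hC.liminfRate_le hT h)).trans ?_
  rw [← hC.liminf_charCapacityRate_eq κ]
  exact EReal.coe_ennreal_le_coe_ennreal_iff.mpr (hle h)
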